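/- **Setting.** Let $m>0$, $r_0=2m$, and consider the Schwarzschild spacetime in double null coordinates $(s,\underline s,\vartheta)$, $\vartheta\in\mathbb S^2$: $$g=2\Omega^2(\mathrm ds\otimes \mathrm d\underline s+\mathrm d\underline s\otimes \mathrm ds)+r^2\mathring g,\qquad (r-r_0)e^{r/r_0}=s\,e^{(\underline s+s+r_0)/r_0},\qquad \Omega^2=\tfrac{s+r_0}{r}e^{(\underline s+s+r_0-r)/r_0},$$ where $\mathring g$ is the round metric of $\mathbb S^2$; the event horizon is $\{s=0\}$. For a foliation $\{\Sigma_u\}$ of a null hypersurface by spacelike spheres let $\underline L^u$ be the null tangent with $\underline L^u u=1$, $L'^u$ the other null normal of $\Sigma_u$ with $g(L'^u,\underline L^u)=2$, $\chi'(X,Y)=g(\nabla_XL'^u,Y)$, $\underline\chi(X,Y)=g(\nabla_X\underline L^u,Y)$, $\eta(X)=\frac12g(\nabla_X\underline L^u,L'^u)$, $K$ the Gauss curvature of $\Sigma_u$ and $r_u$ its area radius ($|\Sigma_u|=4\pi r_u^2$). It is a *constant mass aspect function foliation* if $\mu=K-\frac14\mathrm{tr}\chi'\,\mathrm{tr}\underline\chi-\mathrm{div}\,\eta$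 is constant on every $\Sigma_u$; it is labelled by $r_u=r_{u=0}+u$. The leaves $\Sigma_{u,0}=\{s=u,\underline s=0\}$, $u\ge0$, form such a foliation, starting from $\Sigma_{0,0}$ in the horizon. For a smooth function $h$ on $\mathbb S^2$, a *linearised perturbation generated by $h$* is a smooth family, with parameter $t$ near $0$, of families of spheres $\{\Sigma^t_u\}_{u\ge0}$, equal to $\{\Sigma_{u,0}\}$ at $t=0$, whose initial leaf $\Sigma^t_0$ is the graph $\underline s=t\,h$ in the horizon $\{s=0\}$, and which satisfies the equations of a labelled constant mass aspect function foliation of a null hypersurface to first order in $t$ at $t=0$. Let $$\delta\mathbf g(h)=\lim_{u\to\infty}\frac{\mathrm d}{\mathrm dt}\Big|_{t=0}(r^t_u)^{-2}g_{\Sigma^t_u},\qquad \delta\mathbf k(h)=\lim_{u\to\infty}\frac{\mathrm d}{\mathrm dt}\Big|_{t=0}(r^t_u)^{2}K_{\Sigma^t_u}$$ be the resulting linearisations of the limit renormalised metric and of the limit renormalised Gauss curvature. Let $\lambda_l=l(l+1)$. **Theorem.** For every smooth $h$ a linearised perturbation generated by $h$ exists, the above limits exist and do not depend on its choice, and $\delta\mathbf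 g$, $\delta\mathbf k$ are linear in $h$. 1. $\delta\mathbf g(h)$ is a smooth function times $\mathring g$ (a linear conformal deformation), and $\delta\mathbf k(h)=\frac{\mathrm d}{\mathrm dt}|_{t=0}K[\mathring g+t\,\delta\mathbf g(h)]$ is the corresponding linearised Gauss curvature. For every spherical harmonic $Y_l$ of degree $l\ge1$, $$\delta\mathbf g(r_0Y_l)=\Big[\tfrac23\lambda_l(\lambda_l+2)-\tfrac23\lambda_l(\lambda_l-1)e^{3/\lambda_l}\Big]Y_l\,\mathring g,$$ $$\delta\mathbf k(r_0Y_l)=\Big[\tfrac13\lambda_l(\lambda_l+2)(\lambda_l-2)-\tfrac13\lambda_l(\lambda_l-1)(\lambda_l-2)e^{3/\lambda_l}\Big]Y_l,$$ and both vanish for $l=0$. 2. $\delta\mathbf k$ extends to a bounded linear map $H^2(\mathbb S^2,\mathring g)\to L^2(\mathbb S^2,\mathring g)$, which is self-adjoint as an operator on $L^2$ with domain $H^2$. Let $V$ be the span of the spherical harmonics of degrees $0$ and $1$, and $V^\perp$ its $L^2$ orthogonal complement. Then $\ker\delta\mathbf k=V$, $\operatorname{im}\delta\mathbf k=V^\perp$,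 and $\delta\mathbf k$ restricts to a bounded self-adjoint bijection from $H^2\cap V^\perp$ to $V^\perp$. 3. $\dim V=4$, and $V$ is exactly the set of linearised perturbations $h$ of $\Sigma_{0,0}$ within the horizon for which the foliation stays asymptotically round (an asymptotic reference frame) at null infinity to first order, i.e. for which the limit renormalised Gauss curvature stays equal to $1$ to first order. -/

import Mathlib

open scoped Manifold ContDiff Topology Matrix

noncomputable section

namespace Schwarzschild

/-! ### Coordinate (pseudo-)Riemannian geometry

A metric on an open set of `ι → ℝ` is given by its matrix of components. -/

section Coordinates

variable {ι : Type*} [Fintype ι] [DecidableEq ι]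

/-- The coordinate derivative `∂_i φ`. -/
def pd (i : ι) (φ : (ι → ℝ) → ℝ) (x : ι → ℝ) : ℝ :=
  fderiv ℝ φ x (Pi.single i 1)

/-- The Christoffel symbol `Γ^k_{ij}` of the Levi-Civita connection of `G`. -/
def christoffel (G : (ι → ℝ) → Matrix ι ι ℝ) (x : ι → ℝ) (k i j : ι) : ℝ :=
  (1 / 2) * ∑ l, (G x)⁻¹ k l *
    (pd i (fun z => G z j l) x + pd j (fun z => G z i l) x - pd l (fun z => G z i j) x)

/-- The curvature tensor: `R(∂_i, ∂_j) ∂_k = ∑ l, curvature G x l k i j ∂_l`, with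
`R(X, Y) = ∇_X ∇_Y - ∇_Y ∇_X - ∇_{[X, Y]}`. -/
def curvature (G : (ι → ℝ) → Matrix ι ι ℝ) (x : ι → ℝ) (l k i j : ι) : ℝ :=
  pd i (fun z => christoffel G z l j k) x - pd j (fun z => christoffel G z l i k) x
    + ∑ m, (christoffel G x l i m * christoffel G x m j k
      - christoffel G x l j m * christoffel G x m i k)

/-- The divergence `G^{ij} ∇_i ω_j` of a one-form. -/
def divergence (G : (ι → ℝ) → Matrix ι ι ℝ) (A : (ι → ℝ) → ι → ℝ) (x : ι → ℝ) : ℝ :=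
  ∑ i, ∑ j, (G x)⁻¹ i j * (pd i (fun z => A z j) x - ∑ k, christoffel G x k i j * A x k)

/-- The trace `G^{ij} A_{ij}` of a bilinear form. -/
def trace (G A : Matrix ι ι ℝ) : ℝ := ∑ i, ∑ j, G⁻¹ i j * A i j

/-- The scalar product `G(v, w)`. -/
def ip (G : Matrix ι ι ℝ) (v w : ι → ℝ) : ℝ := v ⬝ᵥ (G *ᵥ w)

end Coordinates

/-- The Gauss curvature `G(R(∂_0, ∂_1) ∂_1, ∂_0) / det G` of a metric on a surface. -/
def gaussCurvature (G : (Fin 2 → ℝ) → Matrix (Fin 2) (Fin 2) ℝ) (y : Fin 2 → ℝ) : ℝ :=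
  (∑ l, G y 0 l * curvature G y l 1 0 1) / (G y).det

/-! ### The round sphere -/

/-- The unit sphere `𝕊²`. -/
abbrev Sph : Type := Metric.sphere (0 : EuclideanSpace ℝ (Fin 3)) 1

/-- Smooth real functions on `𝕊²`. -/
abbrev SmoothFun : Type := C^∞⟮𝓡 2, Sph; 𝓘(ℝ, ℝ), ℝ⟯

/-- The point of `𝕊²` with coordinates `y` in the (stereographic) chart centred at `p`; it is
defined for all `y`. -/
def pt (p : Sph) (y : Fin 2 → ℝ) : Sph :=
  (chartAt (EuclideanSpace ℝ (Fin 2)) p).symm (WithLp.toLp 2 y)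

/-- The coordinates of `p` in the chart centred at `p`. -/
def centre (p : Sph) : Fin 2 → ℝ :=
  WithLp.ofLp (chartAt (EuclideanSpace ℝ (Fin 2)) p p)

/-- The components in the chart centred at `p` of the round metric, which is induced from the
Euclidean metric of `ℝ³`. -/
def roundMetric (p : Sph) (y : Fin 2 → ℝ) : Matrix (Fin 2) (Fin 2) ℝ :=
  Matrix.of fun i j => ∑ k : Fin 3,
    pd i (fun z => (pt p z : EuclideanSpace ℝ (Fin 3)) k) y *
    pd j (fun z => (pt p z : EuclideanSpace ℝ (Fin 3)) k) y

/-- Fields of bilinear forms on `𝕊²`, given by their components in the chart centred at `p`,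
for each `p`, at the point with coordinates `y`. -/
abbrev TensorField : Type := Sph → (Fin 2 → ℝ) → Matrix (Fin 2) (Fin 2) ℝ

/-- The surface measure of `𝕊²`. -/
abbrev surf : MeasureTheory.Measure Sph :=
  (MeasureTheory.volume : MeasureTheory.Measure (EuclideanSpace ℝ (Fin 3))).toSphere

/-! ### The Schwarzschild spacetime in double null coordinates -/

/-- The area radius `r(s, s̲)`: the positive solution of
`(r - r₀) exp (r / r₀) = s exp ((s̲ + s + r₀) / r₀)`. -/
def radius (r₀ s sb : ℝ) : ℝ :=
  Function.invFunOn (fun ρ : ℝ => (ρ - r₀) * Real.exp (ρ / r₀)) (Set.Ioi 0)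
    (s * Real.exp ((sb + s + r₀) / r₀))

/-- `Ω²`. -/
def OmegaSq (r₀ s sb : ℝ) : ℝ :=
  (s + r₀) / radius r₀ s sb * Real.exp ((sb + s + r₀ - radius r₀ s sb) / r₀)

/-- Indices of the spacetime coordinates: `inl 0` is `s`, `inl 1` is `s̲`, and `inr` are the
coordinates on the sphere. -/
abbrev Idx : Type := Fin 2 ⊕ Fin 2

/-- The Schwarzschild metric `2 Ω² (ds ⊗ ds̲ + ds̲ ⊗ ds) + r² g°` in the coordinates
`(s, s̲, y)`, where `y` are the coordinates on the sphere centred at `p`. -/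
def metric (r₀ : ℝ) (p : Sph) (x : Idx → ℝ) : Matrix Idx Idx ℝ :=
  Matrix.fromBlocks
    !![0, 2 * OmegaSq r₀ (x (Sum.inl 0)) (x (Sum.inl 1));
       2 * OmegaSq r₀ (x (Sum.inl 0)) (x (Sum.inl 1)), 0] 0 0
    (radius r₀ (x (Sum.inl 0)) (x (Sum.inl 1)) ^ 2 • roundMetric p (fun i => x (Sum.inr i)))

/-! ### Foliations of hypersurfaces by spheres

A one-parameter family of spheres `{Σ_u}` is a map `F : ℝ → Sph → ℝ × ℝ`: the leaf `Σ_u` is the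
graph of `(s, s̲) = F u ϑ` over the sphere. -/

section Foliation

variable (r₀ : ℝ) (F : ℝ → Sph → ℝ × ℝ) (p : Sph) (u : ℝ) (y : Fin 2 → ℝ)

/-- The parametrisation `(u, y) ↦ (s, s̲, y)`. -/
def embed : Idx → ℝ :=
  Sum.elim ![(F u (pt p y)).1, (F u (pt p y)).2] y

/-- The spacetime metric at a point of the leaf. -/
def metricAt : Matrix Idx Idx ℝ := metric r₀ p (embed F p u y)

/-- The coordinate tangent vectors of the leaf. -/
def tangent (i : Fin 2) : Idx → ℝ := fun a => pd i (fun z => embed F p u z a) y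

/-- The induced metric of the leaf. -/
def leafMetric : Matrix (Fin 2) (Fin 2) ℝ :=
  Matrix.of fun i j => ip (metricAt r₀ F p u y) (tangent F p u y i) (tangent F p u y j)

/-- The component normal to the leaf of a spacetime vector. -/
def normalPart (v : Idx → ℝ) : Idx → ℝ :=
  v - ∑ i, ∑ j, ((leafMetric r₀ F p u y)⁻¹ i j *
    ip (metricAt r₀ F p u y) v (tangent F p u y j)) • tangent F p u y i

/-- The vector `L̲^u`: the tangent vector of the hypersurface swept out by the leaves that is
normal to the leaf and satisfies `L̲^u u = 1`. The hypersurface is null iff `L̲^u` is null. -/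
def Lbar : Idx → ℝ :=
  normalPart r₀ F p u y (fun a => deriv (fun v => embed F p v y a) u)

/-- The vector `L'^u`: when `L̲^u` is null, this is the null normal of the leaf with
`g(L'^u, L̲^u) = 2`. It is computed from the normal part of `∂_s̲`. -/
def Lprime : Idx → ℝ :=
  let G := metricAt r₀ F p u y
  let n := normalPart r₀ F p u y (Pi.single (Sum.inl 1) 1)
  let L := Lbar r₀ F p u y
  (2 / ip G n L) • (n - (ip G n n / (2 * ip G n L)) • L)

/-- The covariant derivative `∇_{∂_i} X` along the leaf of a spacetime vector field `X` given on
the leaf. -/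
def covDeriv (i : Fin 2) (X : (Fin 2 → ℝ) → Idx → ℝ) : Idx → ℝ := fun a =>
  pd i (fun z => X z a) y +
    ∑ b, ∑ c, christoffel (metric r₀ p) (embed F p u y) a b c * tangent F p u y i b * X y c

/-- The second fundamental form `χ̲(X, Y) = g(∇_X L̲^u, Y)`. -/
def chiBar : Matrix (Fin 2) (Fin 2) ℝ :=
  Matrix.of fun i j => ip (metricAt r₀ F p u y)
    (covDeriv r₀ F p u y i (fun z => Lbar r₀ F p u z)) (tangent F p u y j)

/-- The second fundamental form `χ'(X, Y) = g(∇_X L'^u, Y)`. -/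
def chiPrime : Matrix (Fin 2) (Fin 2) ℝ :=
  Matrix.of fun i j => ip (metricAt r₀ F p u y)
    (covDeriv r₀ F p u y i (fun z => Lprime r₀ F p u z)) (tangent F p u y j)

/-- The torsion `η(X) = g(∇_X L̲^u, L'^u) / 2`. -/
def torsion (i : Fin 2) : ℝ :=
  ip (metricAt r₀ F p u y)
    (covDeriv r₀ F p u y i (fun z => Lbar r₀ F p u z)) (Lprime r₀ F p u y) / 2

/-- `g(L̲^u, L̲^u)` at the point `p` of the leaf `Σ_u`; it vanishes iff the hypersurface swept
out by the leaves is null there. -/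
def nullity : ℝ :=
  ip (metricAt r₀ F p u (centre p)) (Lbar r₀ F p u (centre p)) (Lbar r₀ F p u (centre p))

/-- The Gauss curvature of the leaf `Σ_u` at `p`. -/
def leafCurvature : ℝ := gaussCurvature (leafMetric r₀ F p u) (centre p)

/-- The mass aspect function `μ = K - tr χ' tr χ̲ / 4 - div η` of the leaf `Σ_u` at `p`, relative
to the conjugate null frame `{L'^u, L̲^u}`. -/
def massAspect : ℝ :=
  leafCurvature r₀ F p u
    - trace (leafMetric r₀ F p u (centre p)) (chiPrime r₀ F p u (centre p))
      * trace (leafMetric r₀ F p u (centre p)) (chiBar r₀ F p u (centre p)) / 4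
    - divergence (leafMetric r₀ F p u) (torsion r₀ F p u) (centre p)

/-- The area of the leaf `Σ_u`. -/
def leafArea : ℝ :=
  ∫ q : Sph, Real.sqrt ((leafMetric r₀ F q u (centre q)).det / (roundMetric q (centre q)).det) ∂surf

/-- The area radius `r_u` of the leaf: its area is `4 π r_u²`. -/
def leafRadius : ℝ := Real.sqrt (leafArea r₀ F u / (4 * Real.pi))

/-- The renormalised metric `r_u⁻² g_u` of the leaf. -/
def renormMetric : Matrix (Fin 2) (Fin 2) ℝ :=
  (leafRadius r₀ F u ^ 2)⁻¹ • leafMetric r₀ F p u y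

/-- The renormalised Gauss curvature `r_u² K_u` of the leaf. -/
def renormCurvature : ℝ := leafRadius r₀ F u ^ 2 * leafCurvature r₀ F p u

end Foliation

/-- `{Σ_u}`, `u ≥ 0`, is a constant mass aspect function foliation of a null hypersurface, with
the labelling `r_u = r_0 + u`. -/
structure IsConstMassAspectFoliation (r₀ : ℝ) (F : ℝ → Sph → ℝ × ℝ) : Prop where
  /-- The leaves depend smoothly on `u ≥ 0` (up to the boundary). -/
  smooth : ∃ ε > 0, ContMDiffOn (𝓘(ℝ, ℝ).prod (𝓡 2)) 𝓘(ℝ, ℝ × ℝ) ∞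
    (fun x : ℝ × Sph => F x.1 x.2) (Set.Ioi (-ε) ×ˢ Set.univ)
  spacelike : ∀ u, 0 ≤ u → ∀ p, (leafMetric r₀ F p u (centre p)).PosDef
  null : ∀ u, 0 ≤ u → ∀ p, nullity r₀ F p u = 0
  /-- The null tangent `L̲^u` is past directed and transversal to `∂_s̲`. -/
  incoming : ∀ u, 0 ≤ u → ∀ p, 0 < ip (metricAt r₀ F p u (centre p))
    (Pi.single (Sum.inl 1) 1) (Lbar r₀ F p u (centre p))
  constant : ∀ u, 0 ≤ u → ∀ p q, massAspect r₀ F p u = massAspect r₀ F q u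
  labelling : ∀ u, 0 ≤ u → leafRadius r₀ F u = leafRadius r₀ F 0 + u

/-! ### Linearised perturbations -/

/-- The spherically symmetric foliation `{Σ_{u, 0}}` of the hypersurface `s̲ = 0`; its leaf at
`u = 0` is `Σ_{0,0}`, in the event horizon `s = 0`. -/
def sphericalFoliation : ℝ → Sph → ℝ × ℝ := fun u _ => (u, 0)

/-- A linearised perturbation of the foliation `{Σ_{u, 0}}` generated by the linearised
perturbation `h` of the initial leaf `Σ_{0,0}` within the event horizon. It is presented by a
smooth family `F t` of families of spheres, with `F 0 = {Σ_{u, 0}}`, such that the leaf `u = 0` of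
`F t` is the graph of `s̲ = t h` in the event horizon `s = 0`, and such that the equations of a
constant mass aspect function foliation hold to first order in `t` at `t = 0`. -/
structure IsLinearisedPerturbation (r₀ : ℝ) (h : Sph → ℝ) (F : ℝ → ℝ → Sph → ℝ × ℝ) :
    Prop where
  smooth : ∃ ε > 0, ContMDiffOn (𝓘(ℝ, ℝ × ℝ).prod (𝓡 2)) 𝓘(ℝ, ℝ × ℝ) ∞
    (fun x : (ℝ × ℝ) × Sph => F x.1.1 x.1.2 x.2)
    ((Set.Ioo (-ε) ε ×ˢ Set.Ioi (-ε)) ×ˢ Set.univ)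
  background : ∀ u, 0 ≤ u → ∀ p, F 0 u p = sphericalFoliation u p
  initial : ∀ᶠ t in 𝓝 (0 : ℝ), ∀ p, F t 0 p = (0, t * h p)
  null : ∀ u, 0 ≤ u → ∀ p, HasDerivAt (fun t => nullity r₀ (F t) p u) 0 0
  constant : ∀ u, 0 ≤ u → ∀ p q,
    HasDerivAt (fun t => massAspect r₀ (F t) p u - massAspect r₀ (F t) q u) 0 0
  labelling : ∀ u, 0 ≤ u →
    HasDerivAt (fun t => leafRadius r₀ (F t) u - (leafRadius r₀ (F t) 0 + u)) 0 0

/-- A smooth family of genuine constant mass aspect function foliations starting from the surfaces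
`s̲ = t h` in the event horizon is a linearised perturbation. -/
theorem IsLinearisedPerturbation.of_family {r₀ : ℝ} {h : Sph → ℝ} {F : ℝ → ℝ → Sph → ℝ × ℝ}
    (smooth : ∃ ε > 0, ContMDiffOn (𝓘(ℝ, ℝ × ℝ).prod (𝓡 2)) 𝓘(ℝ, ℝ × ℝ) ∞
      (fun x : (ℝ × ℝ) × Sph => F x.1.1 x.1.2 x.2)
      ((Set.Ioo (-ε) ε ×ˢ Set.Ioi (-ε)) ×ˢ Set.univ))
    (background : ∀ u, 0 ≤ u → ∀ p, F 0 u p = sphericalFoliation u p)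
    (initial : ∀ᶠ t in 𝓝 (0 : ℝ), ∀ p, F t 0 p = (0, t * h p))
    (hF : ∀ᶠ t in 𝓝 (0 : ℝ), IsConstMassAspectFoliation r₀ (F t)) :
    IsLinearisedPerturbation r₀ h F where
  smooth := smooth
  background := background
  initial := initial
  null u hu p := (hasDerivAt_const (0 : ℝ) (0 : ℝ)).congr_of_eventuallyEq <| by
    filter_upwards [hF] with t ht using ht.null u hu p
  constant u hu p q := (hasDerivAt_const (0 : ℝ) (0 : ℝ)).congr_of_eventuallyEq <| by
    filter_upwards [hF] with t ht using sub_eq_zero.2 (ht.constant u hu p q)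
  labelling u hu := (hasDerivAt_const (0 : ℝ) (0 : ℝ)).congr_of_eventuallyEq <| by
    filter_upwards [hF] with t ht using sub_eq_zero.2 (ht.labelling u hu)

/-- `γ` is the linearised perturbation of the limit renormalised metric generated by `h`: the
limit as `u → ∞` of the linearised perturbations of the renormalised metrics of the leaves. -/
def IsLinearisedLimitMetric (r₀ : ℝ) (h : Sph → ℝ) (γ : TensorField) : Prop :=
  (∃ F, IsLinearisedPerturbation r₀ h F) ∧
  ∀ F, IsLinearisedPerturbation r₀ h F → ∃ γu : ℝ → TensorField,
    (∀ u, 0 ≤ u → ∀ p y i j,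
      HasDerivAt (fun t => renormMetric r₀ (F t) p u y i j) (γu u p y i j) 0) ∧
    ∀ p y i j, Filter.Tendsto (fun u => γu u p y i j) Filter.atTop (𝓝 (γ p y i j))

/-- `κ` is the linearised perturbation of the limit renormalised Gauss curvature generated by `h`:
the limit as `u → ∞` of the linearised perturbations of the renormalised Gauss curvatures of the
leaves. -/
def IsLinearisedLimitCurvature (r₀ : ℝ) (h : Sph → ℝ) (κ : Sph → ℝ) : Prop :=
  (∃ F, IsLinearisedPerturbation r₀ h F) ∧
  ∀ F, IsLinearisedPerturbation r₀ h F → ∃ κu : ℝ → Sph → ℝ,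
    (∀ u, 0 ≤ u → ∀ p, HasDerivAt (fun t => renormCurvature r₀ (F t) p u) (κu u p) 0) ∧
    ∀ p, Filter.Tendsto (fun u => κu u p) Filter.atTop (𝓝 (κ p))

/-- The perturbed foliation stays an asymptotic reference frame at null infinity on the linearised
level: the limit renormalised Gauss curvature stays equal to `1` to first order. -/
def StaysAsymptoticallyRound (r₀ : ℝ) (h : Sph → ℝ) : Prop :=
  IsLinearisedLimitCurvature r₀ h (fun _ => 0)

/-! ### Spherical harmonics and function spaces -/

/-- `Y` is a spherical harmonic of degree `l`: the restriction to `𝕊²` of a harmonic homogeneous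
polynomial of degree `l`. -/
def IsSphericalHarmonic (l : ℕ) (Y : Sph → ℝ) : Prop :=
  ∃ P : MvPolynomial (Fin 3) ℝ, P.IsHomogeneous l ∧
    ∑ i, MvPolynomial.pderiv i (MvPolynomial.pderiv i P) = 0 ∧
    ∀ x : Sph, Y x = MvPolynomial.eval (fun i => (x : EuclideanSpace ℝ (Fin 3)) i) P

/-- `λ_l = l (l + 1)`. -/
def lam (l : ℕ) : ℝ := (l : ℝ) * (l + 1)

/-- The conformal factor of `δg (r₀ Y_l)` relative to `Y_l g°`. -/
def conformalCoeff (l : ℕ) : ℝ :=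
  if l = 0 then 0
  else 2 / 3 * lam l * (lam l + 2) - 2 / 3 * lam l * (lam l - 1) * Real.exp (3 / lam l)

/-- The factor of `δk (r₀ Y_l)` relative to `Y_l`. -/
def curvatureCoeff (l : ℕ) : ℝ :=
  if l = 0 then 0
  else 1 / 3 * lam l * (lam l + 2) * (lam l - 2)
    - 1 / 3 * lam l * (lam l - 1) * (lam l - 2) * Real.exp (3 / lam l)

/-- `L²(𝕊², g°)`. -/
abbrev L2 : Type := MeasureTheory.Lp ℝ 2 surf

/-- The class in `L²` of a smooth function. -/
def toL2 (h : SmoothFun) : L2 :=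
  ContinuousMap.toLp 2 surf ℝ ⟨h, h.contMDiff.continuous⟩

/-- The rotation vector field `x ↦ e_i × x`, tangent to the sphere. -/
def rot (i : Fin 3) (x : EuclideanSpace ℝ (Fin 3)) : EuclideanSpace ℝ (Fin 3) :=
  WithLp.toLp 2 (crossProduct (Pi.single i 1) (WithLp.ofLp x))

/-- `g` is the weak derivative of `f` along the rotation field `rot i` (which is divergence free).
Test functions are the restrictions to the sphere of smooth functions on `ℝ³`, that is, all smooth
functions on the sphere. -/
def IsWeakDeriv (i : Fin 3) (f g : L2) : Prop :=
  ∀ Ψ : EuclideanSpace ℝ (Fin 3) → ℝ, ContDiff ℝ ∞ Ψ →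
    ∫ x : Sph, f x * fderiv ℝ Ψ x (rot i x) ∂surf = - ∫ x : Sph, g x * Ψ x ∂surf

theorem integrable_mul_continuous (f : L2) {φ : Sph → ℝ} (hφ : Continuous φ) :
    MeasureTheory.Integrable (fun x => f x * φ x) surf := by
  have h1 : MeasureTheory.MemLp φ 2 surf :=
    (ContinuousMap.toLp 2 surf ℝ ⟨φ, hφ⟩ |> MeasureTheory.Lp.memLp).ae_eq
      (ContinuousMap.coeFn_toLp (p := 2) (𝕜 := ℝ) surf ⟨φ, hφ⟩)
  exact (MeasureTheory.Lp.memLp f).integrable_mul h1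

theorem continuous_rot (i : Fin 3) : Continuous (rot i) := by
  unfold rot
  refine (PiLp.continuous_toLp 2 _).comp ?_
  exact (LinearMap.continuous_of_finiteDimensional
    (crossProduct (Pi.single i (1 : ℝ)))).comp (PiLp.continuous_ofLp 2 _)

theorem continuous_rotDeriv (i : Fin 3) {Ψ : EuclideanSpace ℝ (Fin 3) → ℝ}
    (hΨ : ContDiff ℝ ∞ Ψ) : Continuous fun x : Sph => fderiv ℝ Ψ x (rot i x) :=
  ((hΨ.continuous_fderiv (by simp)).comp continuous_subtype_val).clm_apply
    ((continuous_rot i).comp continuous_subtype_val)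

theorem IsWeakDeriv.add {i : Fin 3} {f g f' g' : L2} (h : IsWeakDeriv i f g)
    (h' : IsWeakDeriv i f' g') : IsWeakDeriv i (f + f') (g + g') := by
  intro Ψ hΨ
  have key : ∀ (a b : L2) {φ : Sph → ℝ}, Continuous φ →
      ∫ x : Sph, (a + b) x * φ x ∂surf = ∫ x, a x * φ x ∂surf + ∫ x, b x * φ x ∂surf := by
    intro a b φ hφ
    rw [← MeasureTheory.integral_add (integrable_mul_continuous a hφ)
      (integrable_mul_continuous b hφ)]
    refine MeasureTheory.integral_congr_ae ?_
    filter_upwards [MeasureTheory.Lp.coeFn_add a b] with x hx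
    rw [hx, Pi.add_apply, add_mul]
  rw [key f f' (continuous_rotDeriv i hΨ),
    key g g' (φ := fun x => Ψ x) (hΨ.continuous.comp continuous_subtype_val), h Ψ hΨ, h' Ψ hΨ]
  ring

theorem IsWeakDeriv.smul {i : Fin 3} {f g : L2} (c : ℝ) (h : IsWeakDeriv i f g) :
    IsWeakDeriv i (c • f) (c • g) := by
  intro Ψ hΨ
  have key : ∀ (a : L2) (φ : Sph → ℝ),
      ∫ x : Sph, (c • a) x * φ x ∂surf = c * ∫ x, a x * φ x ∂surf := by
    intro a φ
    rw [← MeasureTheory.integral_const_mul]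
    refine MeasureTheory.integral_congr_ae ?_
    filter_upwards [MeasureTheory.Lp.coeFn_smul c a] with x hx
    rw [hx, Pi.smul_apply, smul_eq_mul, mul_assoc]
  rw [key f, key g (fun x => Ψ x), h Ψ hΨ]
  ring

theorem IsWeakDeriv.zero (i : Fin 3) : IsWeakDeriv i 0 0 := by
  intro Ψ _
  have key : ∀ φ : Sph → ℝ, ∫ x : Sph, (0 : L2) x * φ x ∂surf = 0 := by
    intro φ
    rw [← MeasureTheory.integral_zero Sph ℝ (μ := surf)]
    refine MeasureTheory.integral_congr_ae ?_
    filter_upwards [MeasureTheory.Lp.coeFn_zero ℝ 2 surf] with x hx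
    rw [hx, Pi.zero_apply, zero_mul]
  rw [key, key (fun x => Ψ x), neg_zero]

/-- Indices of a function, its first and its second derivatives. -/
abbrev Jet : Type := Unit ⊕ Fin 3 ⊕ (Fin 3 × Fin 3)

/-- The Sobolev space `H²(𝕊², g°)`: functions in `L²` with first and second weak derivatives in
`L²`. An element is stored together with its derivatives along the three rotation fields, so that
the norm is the `L²` norm of the function and of these derivatives; the rotation fields span every
tangent space of the sphere. -/
def H2 : Submodule ℝ (PiLp 2 (fun _ : Jet => L2)) where
  carrier := {w | (∀ i, IsWeakDeriv i (w (Sum.inl ())) (w (Sum.inr (Sum.inl i)))) ∧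
    ∀ i j, IsWeakDeriv j (w (Sum.inr (Sum.inl i))) (w (Sum.inr (Sum.inr (i, j))))}
  add_mem' h h' := ⟨fun i => (h.1 i).add (h'.1 i), fun i j => (h.2 i j).add (h'.2 i j)⟩
  zero_mem' := ⟨fun i => IsWeakDeriv.zero i, fun _ j => IsWeakDeriv.zero j⟩
  smul_mem' c _ h := ⟨fun i => (h.1 i).smul c, fun i j => (h.2 i j).smul c⟩

/-- The inclusion of `H²` in `L²`. -/
def incl : H2 →ₗ[ℝ] L2 where
  toFun w := (w : PiLp 2 (fun _ : Jet => L2)) (Sum.inl ())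
  map_add' _ _ := rfl
  map_smul' _ _ := rfl

/-- A linear map `H² → L²`, as an unbounded operator on `L²` with domain `H²`. -/
def toOperator (T : H2 →L[ℝ] L2) : L2 →ₗ.[ℝ] L2 :=
  (LinearMap.range (incl.prod (T : H2 →ₗ[ℝ] L2))).toLinearPMap

/-- The part of `T : H² → L²` in the subspace `K` of `L²`, as an unbounded operator on `K`. -/
def toOperatorOn (T : H2 →L[ℝ] L2) (K : Submodule ℝ L2) : K →ₗ.[ℝ] K :=
  ((LinearMap.range (incl.prod (T : H2 →ₗ[ℝ] L2))).comap
    (K.subtype.prodMap K.subtype)).toLinearPMap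

/-- The space `V` spanned by the spherical harmonics of degrees `0` and `1`. -/
def V : Submodule ℝ L2 :=
  Submodule.span ℝ {f | ∃ l ≤ 1, ∃ Y : SmoothFun, IsSphericalHarmonic l Y ∧ toL2 Y = f}

end Schwarzschild

end

open scoped Manifold ContDiff Topology Matrix

noncomputable section

namespace Schwarzschild

open MeasureTheory

/-! Write a family as s = u + t f, s̲ = t b, and put r = r₀ + u. On the background s̲ = 0 the leaves
are round of radius r and Ω² = 1, so the first order equations for (f, b) have coefficients
depending on u alone, and they decouple into spherical harmonics.

Nullity to first order says ∂_u b = 0, so b = h for all u. The area radius function on the leaf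
varies by ρ = f + (u/r) h. Along a leaf ds and ds̲ are both O(t), so their product does not enter,
and the induced metric changes by the conformal factor 2ρ/r only. Hence δK = -(2ρ + Δρ)/r³, and the
labelling says that ρ has mean zero. Expanding the normals, the two null expansions and the torsion
(`LeafJets`) gives δμ = -3r₀ρ/r⁴ - Δρ/r³ + 2Δf/r³ - Δ∂_u f/r². In terms of φ = ρ/r the terms in Δφ
cancel. On degree l ≥ 1, with λ = l(l+1), constancy of μ becomes φ' = 3r₀φ/(λr²) + (r₀ - 2u)h/r³, φ
= 0 at u = 0. In the variable x = r₀/r this reads dφ/dx = -(3/λ)φ - (3x - 2)h/r₀ with φ = 0 at x =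
1. Its solution is φ = (h/r₀)(-λx + λ(λ+2)/3 - λ(λ-1)/3 · exp(3(1-x)/λ)). Null infinity is x = 0,
which produces exp(3/λ). The metric coefficient is 2φ and the curvature coefficient is (λ-2)φ.

Uniqueness (`IsLinearisedPerturbation.eq_sol`) follows by testing an arbitrary linearised
perturbation against each harmonic and solving the scalar equation with an integrating factor.
Existence (`isLinearisedPerturbation_solFamily`) needs the sum over l to be smooth jointly in u and
the point of the sphere. This rests on the operators (-Δ)⁻ᵏ exp(τ(-Δ)⁻¹), whose defining series form
a class closed under differentiation (`hasFDerivAt_expSeries`). They converge because the harmonic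
components of a smooth function decay in sup norm (`harm_bound`), a consequence of a maximum
principle estimate (`sup_bound`).

For the operator statements, the curvature coefficient vanishes for l = 0, 1. For l ≥ 2 the leading
powers of λ cancel against the expansion of exp(3/λ), and what remains is comparable to -λ
(`curvatureCoeff_bounds`). A diagonal operator with such coefficients is a self-adjoint Fredholm map
of order two (`exists_diagonal_map`, `isSelfAdjoint_diagonal`). -/

/-- The ambient Euclidean space. -/
abbrev E3 : Type := EuclideanSpace ℝ (Fin 3)

instance finrankE3 : Fact (Module.finrank ℝ E3 = 2 + 1) := ⟨by simp⟩

/-! ### Stereographic coordinates -/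

/-- The orthonormal frame at `p` underlying the stereographic chart centred at `p`. -/
def frame (p : Sph) (i : Fin 2) : E3 :=
  ((OrthonormalBasis.fromOrthogonalSpanSingleton (𝕜 := ℝ) 2
    (ne_zero_of_mem_unit_sphere (-p)) i : (Submodule.span ℝ {((-p : Sph) : E3)})ᗮ) : E3)

theorem inner_frame (p : Sph) (i j : Fin 2) :
    inner ℝ (frame p i) (frame p j) = if i = j then 1 else 0 := by
  have := orthonormal_iff_ite.1 (OrthonormalBasis.fromOrthogonalSpanSingleton (𝕜 := ℝ) 2
    (ne_zero_of_mem_unit_sphere (-p))).orthonormal i j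
  exact this

theorem inner_frame_point (p : Sph) (i : Fin 2) : inner ℝ (p : E3) (frame p i) = 0 := by
  have := Submodule.mem_orthogonal_singleton_iff_inner_right.1
    (OrthonormalBasis.fromOrthogonalSpanSingleton (𝕜 := ℝ) 2
    (ne_zero_of_mem_unit_sphere (-p)) i).2
  change inner ℝ (-(p : E3)) (frame p i) = 0 at this
  rwa [inner_neg_left, neg_eq_zero] at this

theorem inner_self_sphere (p : Sph) : inner ℝ (p : E3) (p : E3) = 1 := by
  simp

/-- The chart centred at `p` is the stereographic projection from the antipode `-p`. This explicit
inverse makes all later coordinate computations elementary. -/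
theorem pt_coe (p : Sph) (y : Fin 2 → ℝ) :
    (pt p y : E3) = (y 0 ^ 2 + y 1 ^ 2 + 4)⁻¹ •
      ((4 * y 0) • frame p 0 + (4 * y 1) • frame p 1 + (4 - (y 0 ^ 2 + y 1 ^ 2)) • (p : E3)) := by
  have h := stereographic'_symm_apply (E := E3) (n := 2) (-p) (WithLp.toLp 2 y)
  set b := OrthonormalBasis.fromOrthogonalSpanSingleton (𝕜 := ℝ) 2
    (ne_zero_of_mem_unit_sphere (-p)) with hb
  have hU : ((b.repr.symm (WithLp.toLp 2 y) : (Submodule.span ℝ {((-p : Sph) : E3)})ᗮ) : E3)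
      = y 0 • frame p 0 + y 1 • frame p 1 := by
    rw [← b.sum_repr_symm]
    rw [Fin.sum_univ_two]
    rfl
  have hn : ‖y 0 • frame p 0 + y 1 • frame p 1‖ ^ 2 = y 0 ^ 2 + y 1 ^ 2 := by
    rw [← real_inner_self_eq_norm_sq]
    simp only [inner_add_left, inner_add_right, inner_smul_left, inner_smul_right, inner_frame]
    simp; ring
  change ((stereographic' 2 (-p)).symm (WithLp.toLp 2 y) : E3) = _
  rw [h]
  dsimp only
  rw [hU, hn]
  simp only [smul_add, smul_smul]
  rw [show ((-p : Sph) : E3) = -(p : E3) from rfl]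
  module

theorem centre_eq (p : Sph) : centre p = 0 := by
  change WithLp.ofLp (stereographic' 2 (-p) p) = 0
  have : stereographic' 2 (-p) p = 0 := by
    have h : stereographic (norm_eq_of_mem_sphere (-p)) p = 0 := stereographic_neg_apply p
    change (OrthonormalBasis.fromOrthogonalSpanSingleton (𝕜 := ℝ) 2
      (ne_zero_of_mem_unit_sphere (-p))).repr
        (stereographic (norm_eq_of_mem_sphere (-p)) p) = 0
    rw [h, map_zero]
  rw [this]; rfl

theorem pt_zero (p : Sph) : pt p 0 = p := by
  ext1
  rw [pt_coe]
  simp [smul_smul]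

theorem contDiff_pt (p : Sph) : ContDiff ℝ ∞ (fun y : Fin 2 → ℝ => (pt p y : E3)) := by
  have : (fun y : Fin 2 → ℝ => (pt p y : E3)) = fun y => (y 0 ^ 2 + y 1 ^ 2 + 4)⁻¹ •
      ((4 * y 0) • frame p 0 + (4 * y 1) • frame p 1 + (4 - (y 0 ^ 2 + y 1 ^ 2)) • (p : E3)) :=
    funext fun y => pt_coe p y
  rw [this]
  have h0 : ∀ i : Fin 2, ContDiff ℝ ∞ (fun y : Fin 2 → ℝ => y i) := fun i => contDiff_apply ℝ ℝ i
  have h1 := h0 0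
  have h2 := h0 1
  have h3 : ContDiff ℝ ∞ (fun y : Fin 2 → ℝ => y 0 ^ 2 + y 1 ^ 2 + 4) := by fun_prop
  refine (h3.inv fun y => by positivity).smul ?_
  fun_prop

/-- The conformal factor of the round metric in stereographic coordinates. -/
def psi (y : Fin 2 → ℝ) : ℝ := 16 / (y 0 ^ 2 + y 1 ^ 2 + 4) ^ 2

theorem psi_pos (y : Fin 2 → ℝ) : 0 < psi y := by unfold psi; positivity

theorem contDiff_psi : ContDiff ℝ ∞ psi := by
  unfold psi
  have h0 : ∀ i : Fin 2, ContDiff ℝ ∞ (fun y : Fin 2 → ℝ => y i) := fun i => contDiff_apply ℝ ℝ i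
  have h1 := h0 0
  have h2 := h0 1
  exact ContDiff.div (by fun_prop) (by fun_prop) fun y => by positivity

theorem hasFDerivAt_pt (p : Sph) (y v : Fin 2 → ℝ) :
    fderiv ℝ (fun y => (pt p y : E3)) y v = (y 0 ^ 2 + y 1 ^ 2 + 4)⁻¹ •
      ((4 * v 0) • frame p 0 + (4 * v 1) • frame p 1 - (2 * (y 0 * v 0 + y 1 * v 1)) • (p : E3))
      - (2 * (y 0 * v 0 + y 1 * v 1) * ((y 0 ^ 2 + y 1 ^ 2 + 4) ^ 2)⁻¹) •
      ((4 * y 0) • frame p 0 + (4 * y 1) • frame p 1 + (4 - (y 0 ^ 2 + y 1 ^ 2)) • (p : E3)) := by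
  have hd : ∀ i, HasFDerivAt (fun y : Fin 2 → ℝ => y i)
      (ContinuousLinearMap.proj (R := ℝ) (φ := fun _ : Fin 2 => ℝ) i) y :=
    fun i => (ContinuousLinearMap.proj (R := ℝ) (φ := fun _ : Fin 2 => ℝ) i).hasFDerivAt
  have hs := ((hd 0).pow 2).add ((hd 1).pow 2)
  have hne : y 0 ^ 2 + y 1 ^ 2 + 4 ≠ 0 := by positivity
  have hi := (hasDerivAt_inv hne).comp_hasFDerivAt y (hs.add_const 4)
  have hn := ((((hd 0).const_mul 4).smul_const (frame p 0)).add
    (((hd 1).const_mul 4).smul_const (frame p 1))).add ((hs.const_sub 4).smul_const (p : E3))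
  have hh := hi.smul hn
  have heq : (fun y : Fin 2 → ℝ => (pt p y : E3)) = fun y => (y 0 ^ 2 + y 1 ^ 2 + 4)⁻¹ •
      ((4 * y 0) • frame p 0 + (4 * y 1) • frame p 1 + (4 - (y 0 ^ 2 + y 1 ^ 2)) • (p : E3)) :=
    funext fun y => pt_coe p y
  rw [heq]
  erw [hh.fderiv]
  simp
  module

theorem pd_pt (p : Sph) (i : Fin 2) (k : Fin 3) (y : Fin 2 → ℝ) :
    pd i (fun z => (pt p z : E3) k) y =
      (fderiv ℝ (fun y => (pt p y : E3)) y (Pi.single i 1)) k := by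
  unfold pd
  have h := ((contDiff_pt p).differentiable (by simp) y).hasFDerivAt
  have h2 := (EuclideanSpace.proj (𝕜 := ℝ) k).hasFDerivAt.comp y h
  erw [h2.fderiv]
  rfl

/-- Stereographic projection is conformal. All round Christoffel symbols thereby reduce to
derivatives of the single factor `psi`, which equals 1 and is stationary at the centre of the chart.
-/
theorem roundMetric_eq (p : Sph) (y : Fin 2 → ℝ) :
    roundMetric p y = psi y • (1 : Matrix (Fin 2) (Fin 2) ℝ) := by
  have key : ∀ i j, roundMetric p y i j = inner ℝ
      (fderiv ℝ (fun y => (pt p y : E3)) y (Pi.single i 1))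
      (fderiv ℝ (fun y => (pt p y : E3)) y (Pi.single j 1)) := by
    intro i j
    simp only [roundMetric, Matrix.of_apply, pd_pt, PiLp.inner_apply]
    refine Finset.sum_congr rfl fun k _ => ?_
    simp [mul_comm]
  ext i j
  rw [key, hasFDerivAt_pt, hasFDerivAt_pt]
  have hf := inner_frame p
  have hp := inner_frame_point p
  have hp' : ∀ i, inner ℝ (frame p i) (p : E3) = 0 := fun i => by rw [real_inner_comm, hp]
  have hs := inner_self_sphere p
  have hne : y 0 ^ 2 + y 1 ^ 2 + 4 ≠ 0 := by positivity
  simp only [inner_add_left, inner_add_right, inner_sub_left, inner_sub_right, inner_smul_left,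
    inner_smul_right, hf, hp, hp', hs]
  fin_cases i <;> fin_cases j <;> simp [psi] <;> field_simp <;> ring

section

/-! ### Extension of functions on the sphere to the punctured space -/

/-- The radial projection to the sphere (with an arbitrary value at the origin). -/
def nrm (x : E3) : Sph :=
  if h : x ≠ 0 then ⟨‖x‖⁻¹ • x, by simp [norm_smul, h]⟩
  else ⟨EuclideanSpace.single 0 1, by simp⟩

theorem nrm_coe {x : E3} (hx : x ≠ 0) : (nrm x : E3) = ‖x‖⁻¹ • x := by
  simp [nrm, hx]

theorem sphere_ne_zero (p : Sph) : (p : E3) ≠ 0 := ne_zero_of_mem_unit_sphere p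

@[simp] theorem nrm_sphere (p : Sph) : nrm p = p := by
  ext1
  rw [nrm_coe (sphere_ne_zero p)]
  simp

theorem nrm_smul {c : ℝ} (hc : 0 < c) {x : E3} (hx : x ≠ 0) : nrm (c • x) = nrm x := by
  ext1
  rw [nrm_coe hx, nrm_coe (smul_ne_zero hc.ne' hx), norm_smul, smul_smul]
  congr 1
  simp only [Real.norm_eq_abs, abs_of_pos hc]
  field_simp

/-- The punctured space is treated as a manifold in its own right, so that the projection is a
globally smooth map there and can be corestricted to the sphere. -/
theorem contMDiffOn_nrm : ContMDiffOn 𝓘(ℝ, E3) (𝓡 2) ∞ nrm {0}ᶜ := by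
  let U : TopologicalSpace.Opens E3 := ⟨{0}ᶜ, isOpen_compl_singleton⟩
  have h1 : ContMDiff 𝓘(ℝ, E3) 𝓘(ℝ, E3) ∞ (fun x : U => ‖(x : E3)‖⁻¹ • (x : E3)) := by
    intro x
    have : ContMDiffAt 𝓘(ℝ, E3) 𝓘(ℝ, E3) ∞ (fun y : E3 => ‖y‖⁻¹ • y) x := by
      refine ContDiffAt.contMDiffAt ?_
      have hx : (x : E3) ≠ 0 := x.2
      exact ((contDiffAt_norm ℝ hx).inv (norm_ne_zero_iff.2 hx)).smul contDiffAt_id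
    exact contMDiffAt_subtype_iff.2 this
  have hm : ∀ x : U, ‖(x : E3)‖⁻¹ • (x : E3) ∈ Metric.sphere (0 : E3) 1 := by
    intro x
    have hx : (x : E3) ≠ 0 := x.2
    simp [norm_smul, hx]
  have h2 := ContMDiff.codRestrict_sphere (n := 2) h1 hm
  intro x hx
  have h3 := h2 ⟨x, hx⟩
  refine ContMDiffAt.contMDiffWithinAt ?_
  refine contMDiffAt_subtype_iff (U := U) (x := ⟨x, hx⟩) |>.1 ?_
  convert! h3 using 1
  ext1 y
  ext1
  rw [nrm_coe y.2]
  rfl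

set_option linter.unusedSectionVars false

variable {N V : Type*} [NormedAddCommGroup N] [NormedSpace ℝ N] [NormedAddCommGroup V]
  [NormedSpace ℝ V]

/-- Together with `contMDiffOn_of_contDiffOn` this exchanges smoothness on the manifold for ordinary
smoothness on an open subset of a normed space, where all differentiation is carried out. -/
theorem contDiffOn_comp_nrm {Φ : N × Sph → V} {U : Set N}
    (h : ContMDiffOn (𝓘(ℝ, N).prod (𝓡 2)) 𝓘(ℝ, V) ∞ Φ (U ×ˢ Set.univ)) :
    ContDiffOn ℝ ∞ (fun x : N × E3 => Φ (x.1, nrm x.2)) (U ×ˢ {0}ᶜ) := by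
  rw [← contMDiffOn_iff_contDiffOn]
  have h1 : ContMDiffOn 𝓘(ℝ, N × E3) 𝓘(ℝ, N) ∞ (fun x : N × E3 => x.1) (U ×ˢ {0}ᶜ) :=
    contDiff_fst.contMDiff.contMDiffOn
  have h2 : ContMDiffOn 𝓘(ℝ, N × E3) (𝓡 2) ∞ (fun x : N × E3 => nrm x.2) (U ×ˢ {0}ᶜ) :=
    contMDiffOn_nrm.comp contDiff_snd.contMDiff.contMDiffOn fun x hx => hx.2
  exact h.comp (h1.prodMk h2) fun x hx => ⟨hx.1, Set.mem_univ _⟩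

theorem contMDiffOn_of_contDiffOn {Ψ : N × E3 → V} {U : Set N}
    (h : ContDiffOn ℝ ∞ Ψ (U ×ˢ {0}ᶜ)) :
    ContMDiffOn (𝓘(ℝ, N).prod (𝓡 2)) 𝓘(ℝ, V) ∞ (fun x : N × Sph => Ψ (x.1, x.2))
      (U ×ˢ Set.univ) := by
  have h1 : ContMDiff (𝓘(ℝ, N).prod (𝓡 2)) 𝓘(ℝ, N × E3) ∞ (fun x : N × Sph => (x.1, (x.2 : E3))) :=
    contMDiff_fst.prodMk_space ((contMDiff_coe_sphere (n := 2)).comp contMDiff_snd)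
  exact h.contMDiffOn.comp h1.contMDiffOn fun x hx => ⟨hx.1, sphere_ne_zero x.2⟩

/-- The extension of a function on the sphere that is constant along rays. -/
def ext (h : Sph → V) (x : E3) : V := h (nrm x)

@[simp] theorem ext_sphere (h : Sph → V) (p : Sph) : ext h p = h p := by simp [ext]

theorem contDiffOn_ext {h : Sph → V} (hh : ContMDiff (𝓡 2) 𝓘(ℝ, V) ∞ h) :
    ContDiffOn ℝ ∞ (ext h) {0}ᶜ := by
  rw [← contMDiffOn_iff_contDiffOn]
  exact (contMDiffOn_univ.2 hh).comp contMDiffOn_nrm fun x _ => Set.mem_univ _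

theorem contDiffAt_ext {h : Sph → V} (hh : ContMDiff (𝓡 2) 𝓘(ℝ, V) ∞ h) {x : E3} (hx : x ≠ 0) :
    ContDiffAt ℝ ∞ (ext h) x :=
  (contDiffOn_ext hh).contDiffAt (isOpen_compl_singleton.mem_nhds hx)

theorem contMDiff_restrict {Ψ : E3 → V} (h : ContDiffOn ℝ ∞ Ψ {0}ᶜ) :
    ContMDiff (𝓡 2) 𝓘(ℝ, V) ∞ (fun p : Sph => Ψ p) := by
  rw [← contMDiffOn_univ]
  exact h.contMDiffOn.comp (contMDiff_coe_sphere (n := 2)).contMDiffOn fun x _ => sphere_ne_zero x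

theorem ext_smul (h : Sph → V) {c : ℝ} (hc : 0 < c) {x : E3} (hx : x ≠ 0) :
    ext h (c • x) = ext h x := by
  rw [ext, nrm_smul hc hx, ext]

theorem fderiv_ext_smul (h : Sph → V) {c : ℝ} (hc : 0 < c) {x : E3} (hx : x ≠ 0) (v : E3) :
    fderiv ℝ (ext h) (c • x) (c • v) = fderiv ℝ (ext h) x v := by
  have h1 : (fun y : E3 => ext h (c • y)) =ᶠ[𝓝 x] ext h := by
    filter_upwards [isOpen_compl_singleton.mem_nhds hx] with y hy
    exact ext_smul h hc hy
  rw [← h1.fderiv_eq, fderiv_comp_smul]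
  simp

theorem fderiv_ext_self {h : Sph → V} (hh : ContMDiff (𝓡 2) 𝓘(ℝ, V) ∞ h) {x : E3} (hx : x ≠ 0) :
    fderiv ℝ (ext h) x x = 0 := by
  have h1 : HasDerivAt (fun s : ℝ => (1 + s) • x) x 0 := by
    simpa using ((hasDerivAt_id (0 : ℝ)).const_add 1).smul_const x
  have h2 : HasFDerivAt (ext h) (fderiv ℝ (ext h) x) ((1 + (0 : ℝ)) • x) := by
    simpa using ((contDiffAt_ext hh hx).differentiableAt (by simp)).hasFDerivAt
  have h3 := h2.comp_hasDerivAt (0 : ℝ) h1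
  have h4 : (ext h ∘ fun s : ℝ => (1 + s) • x) =ᶠ[𝓝 0] fun _ => ext h x := by
    filter_upwards [Ioi_mem_nhds (show (-1 : ℝ) < 0 by norm_num)] with s hs
    exact ext_smul h (by have := Set.mem_Ioi.1 hs; linarith) hx
  exact (h3.congr_of_eventuallyEq h4.symm).unique (hasDerivAt_const _ _)

/-! ### Rotation fields -/

/-- The rotation field as a continuous linear map. -/
def rotL (i : Fin 3) : E3 →L[ℝ] E3 :=
  LinearMap.toContinuousLinearMap
    { toFun := rot i
      map_add' := fun x y => by simp [rot]
      map_smul' := fun c x => by simp [rot] }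

@[simp] theorem rotL_apply (i : Fin 3) (x : E3) : rotL i x = rot i x := rfl

theorem rot_zero_apply (x : E3) : rot 0 x = !₂[0, -x 2, x 1] := by
  ext k; fin_cases k <;> simp [rot, crossProduct]

theorem rot_one_apply (x : E3) : rot 1 x = !₂[x 2, 0, -x 0] := by
  ext k; fin_cases k <;> simp [rot, crossProduct]

theorem rot_two_apply (x : E3) : rot 2 x = !₂[-x 1, x 0, 0] := by
  ext k; fin_cases k <;> simp [rot, crossProduct]

theorem inner_E3 (x y : E3) : inner ℝ x y = x 0 * y 0 + x 1 * y 1 + x 2 * y 2 := by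
  simp [PiLp.inner_apply, Fin.sum_univ_three, mul_comm]

theorem inner_rot_self (i : Fin 3) (x : E3) : inner ℝ x (rot i x) = 0 := by
  fin_cases i <;> simp [inner_E3, rot_zero_apply, rot_one_apply, rot_two_apply] <;> ring

theorem sum_rot_rot (x : E3) : ∑ i, rot i (rot i x) = (-2 : ℝ) • x := by
  ext k
  fin_cases k <;>
    simp [Fin.sum_univ_three, rot_zero_apply, rot_one_apply, rot_two_apply] <;> ring

/-- Since ⟨e_i × x, v⟩ = ⟨e_i, x × v⟩, the left side is ⟨x × v, x × w⟩, and this is Lagrange's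
identity. On the unit sphere it says that the rotation fields form a tight frame of each tangent
plane. -/
theorem sum_inner_rot (x v w : E3) : ∑ i, inner ℝ (rot i x) v * inner ℝ (rot i x) w =
    inner ℝ x x * inner ℝ v w - inner ℝ x v * inner ℝ x w := by
  simp only [inner_E3]
  simp [Fin.sum_univ_three, rot_zero_apply, rot_one_apply, rot_two_apply]
  ring

/-- A vector orthogonal to `x` is a combination of rotation fields at `x`. -/
theorem sum_inner_rot_smul (x v : E3) : ∑ i, inner ℝ (rot i x) v • rot i x =
    inner ℝ x x • v - inner ℝ x v • x := by
  simp only [inner_E3]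
  ext k
  fin_cases k <;>
    simp [Fin.sum_univ_three, rot_zero_apply, rot_one_apply, rot_two_apply] <;> ring

theorem contDiffOn_fderiv_ext {h : Sph → V} (hh : ContMDiff (𝓡 2) 𝓘(ℝ, V) ∞ h) :
    ContDiffOn ℝ ∞ (fderiv ℝ (ext h)) {0}ᶜ :=
  (contDiffOn_ext hh).fderiv_of_isOpen isOpen_compl_singleton (by simp)

/-- The derivative of a smooth function along a rotation field. -/
def rotD (i : Fin 3) : SmoothFun →ₗ[ℝ] SmoothFun where
  toFun h := ⟨fun p => fderiv ℝ (ext h) p (rot i p),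
    contMDiff_restrict (Ψ := fun x => fderiv ℝ (ext h) x (rotL i x))
      ((contDiffOn_fderiv_ext h.contMDiff).clm_apply (rotL i).contDiff.contDiffOn)⟩
  map_add' h k := by
    ext p
    change fderiv ℝ (ext h + ext k) p (rot i p) = _
    rw [fderiv_add ((contDiffAt_ext h.contMDiff (sphere_ne_zero p)).differentiableAt (by simp))
      ((contDiffAt_ext k.contMDiff (sphere_ne_zero p)).differentiableAt (by simp))]
    rfl
  map_smul' c h := by
    ext p
    change fderiv ℝ (c • ext h) p (rot i p) = _
    rw [fderiv_const_smul ((contDiffAt_ext h.contMDiff (sphere_ne_zero p)).differentiableAt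
      (by simp))]
    rfl

theorem rotD_apply (i : Fin 3) (h : SmoothFun) (p : Sph) :
    rotD i h p = fderiv ℝ (ext h) p (rot i p) := rfl

theorem ext_rotD (i : Fin 3) (h : SmoothFun) {x : E3} (hx : x ≠ 0) :
    ext (rotD i h) x = fderiv ℝ (ext h) x (rot i x) := by
  rw [ext, rotD_apply, nrm_coe hx, ← rotL_apply, map_smul,
    fderiv_ext_smul h (inv_pos.2 (norm_pos_iff.2 hx)) hx]
  rfl

/-- The derivative of the extension of a function, in terms of its rotational derivatives. -/
theorem fderiv_ext_eq (h : SmoothFun) {x : E3} (hx : x ≠ 0) (v : E3) :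
    fderiv ℝ (ext h) x v = ∑ i, (inner ℝ (rot i x) v / inner ℝ x x) * ext (rotD i h) x := by
  have h0 : inner ℝ x x ≠ 0 := by simpa using hx
  have h1 : inner ℝ x x * fderiv ℝ (ext h) x v =
      ∑ i, inner ℝ (rot i x) v * ext (rotD i h) x := by
    have := congrArg (fderiv ℝ (ext h) x) (sum_inner_rot_smul x v)
    rw [map_sum, map_sub, map_smul, map_smul, fderiv_ext_self h.contMDiff hx] at this
    simp only [map_smul, smul_eq_mul, mul_zero, sub_zero] at this
    rw [← this]
    exact Finset.sum_congr rfl fun i _ => by rw [ext_rotD i h hx]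
  rw [eq_comm, ← mul_right_inj' h0, h1, Finset.mul_sum]
  refine Finset.sum_congr rfl fun i _ => ?_
  field_simp

/-- The restriction to the sphere of a smooth function. -/
def restrict (Ψ : E3 → ℝ) (hΨ : ContDiff ℝ ∞ Ψ) : SmoothFun :=
  ⟨fun p => Ψ p, contMDiff_restrict hΨ.contDiffOn⟩

/-- The radial extension of a restriction is not the original function, but both have the same
tangential derivatives on the sphere: the differential of x / ‖x‖ at a unit vector fixes vectors
orthogonal to it. -/
theorem hasFDerivAt_ext_restrict {Ψ : E3 → ℝ} (hΨ : ContDiff ℝ ∞ Ψ) (i : Fin 3) (p : Sph) :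
    rotD i (restrict Ψ hΨ) p = fderiv ℝ Ψ p (rot i p) := by
  rw [rotD_apply]
  have hp := sphere_ne_zero p
  have h1 : HasFDerivAt (fun x : E3 => ‖x‖⁻¹ • x) (fderiv ℝ (fun x : E3 => ‖x‖⁻¹ • x) (p : E3)) p :=
    DifferentiableAt.hasFDerivAt (by
      refine ContDiffAt.differentiableAt (n := ∞) ?_ (by simp)
      exact ((contDiffAt_norm ℝ hp).inv (norm_ne_zero_iff.2 hp)).smul contDiffAt_id)
  have h2 : ext (restrict Ψ hΨ) =ᶠ[𝓝 (p : E3)] fun x => Ψ (‖x‖⁻¹ • x) := by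
    filter_upwards [isOpen_compl_singleton.mem_nhds hp] with x hx
    change Ψ (nrm x) = _
    rw [nrm_coe hx]
  have h3 : HasFDerivAt Ψ (fderiv ℝ Ψ p) (‖(p : E3)‖⁻¹ • (p : E3)) := by
    simpa using ((hΨ.differentiable (by simp)) (p : E3)).hasFDerivAt
  rw [h2.fderiv_eq]
  have h4 := HasFDerivAt.comp (f := fun x : E3 => ‖x‖⁻¹ • x) (p : E3) h3 h1
  have h4' : fderiv ℝ (fun x => Ψ (‖x‖⁻¹ • x)) p = _ := h4.fderiv
  rw [h4', ContinuousLinearMap.comp_apply]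
  congr 1
  have hn : HasFDerivAt (fun x : E3 => ‖x‖) (innerSL ℝ (p : E3)) p := by
    have := (hasStrictFDerivAt_norm_sq (p : E3)).hasFDerivAt.sqrt (by simp)
    convert! this using 1
    · ext v
      simp
    · ext v
      simp
  have hi := (hasDerivAt_inv (norm_ne_zero_iff.2 hp)).comp_hasFDerivAt (p : E3) hn
  have := hi.smul (hasFDerivAt_id (p : E3))
  have h5 : fderiv ℝ (fun x : E3 => ‖x‖⁻¹ • x) (p : E3) = _ := this.fderiv
  rw [h5]
  simp [inner_rot_self]

theorem rotD_mul (i : Fin 3) (h k : SmoothFun) :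
    rotD i (h * k) = rotD i h * k + h * rotD i k := by
  ext p
  change fderiv ℝ (fun x => ext h x * ext k x) p (rot i p) = _
  rw [fderiv_fun_mul ((contDiffAt_ext h.contMDiff (sphere_ne_zero p)).differentiableAt (by simp))
      ((contDiffAt_ext k.contMDiff (sphere_ne_zero p)).differentiableAt (by simp))]
  simp [rotD_apply]
  ring

/-- The Laplacian of the round sphere. -/
def lap : SmoothFun →ₗ[ℝ] SmoothFun := ∑ i, rotD i ∘ₗ rotD i

theorem lap_eq (h : SmoothFun) : lap h = ∑ i, rotD i (rotD i h) := by simp [lap]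

theorem sum_frame (p : Sph) {v : E3} (hv : inner ℝ (p : E3) v = 0) :
    v = ∑ k, inner ℝ (frame p k) v • frame p k := by
  have hv' : v ∈ (Submodule.span ℝ {((-p : Sph) : E3)})ᗮ := by
    rw [Submodule.mem_orthogonal_singleton_iff_inner_right]
    change inner ℝ (-(p : E3)) v = 0
    rw [inner_neg_left, hv, neg_zero]
  set b := OrthonormalBasis.fromOrthogonalSpanSingleton (𝕜 := ℝ) 2
    (ne_zero_of_mem_unit_sphere (-p)) with hb
  have h1 := congrArg (Subtype.val) (b.sum_repr' ⟨v, hv'⟩)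
  rw [Fin.sum_univ_two] at h1 ⊢
  exact h1.symm

theorem rotD_rotD_apply (i j : Fin 3) (h : SmoothFun) (p : Sph) :
    rotD j (rotD i h) p = fderiv ℝ (fderiv ℝ (ext h)) p (rot j p) (rot i p) +
      fderiv ℝ (ext h) p (rot i (rot j p)) := by
  have hp := sphere_ne_zero p
  have h1 : ext (rotD i h) =ᶠ[𝓝 (p : E3)] fun x => fderiv ℝ (ext h) x (rotL i x) := by
    filter_upwards [isOpen_compl_singleton.mem_nhds hp] with x hx
    exact ext_rotD i h hx
  rw [rotD_apply, h1.fderiv_eq]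
  have h2 : HasFDerivAt (fderiv ℝ (ext h)) (fderiv ℝ (fderiv ℝ (ext h)) p) (p : E3) :=
    (((contDiffOn_fderiv_ext h.contMDiff).contDiffAt
      (isOpen_compl_singleton.mem_nhds hp)).differentiableAt (by simp)).hasFDerivAt
  have h3 : fderiv ℝ (fun x => fderiv ℝ (ext h) x (rotL i x)) (p : E3) = _ :=
    (h2.clm_apply (rotL i).hasFDerivAt).fderiv
  rw [h3, add_comm]
  rfl

/-- The first order terms of the iterated rotational derivatives add up to the derivative along -2p,
which is radial and kills the extension. In the second order terms the frame identity
`sum_inner_rot` turns the sum over rotations into a trace over the tangent plane. -/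
theorem lap_apply (h : SmoothFun) (p : Sph) :
    lap h p = ∑ k, fderiv ℝ (fderiv ℝ (ext h)) p (frame p k) (frame p k) := by
  have hp := sphere_ne_zero p
  have h0 : lap h p = ∑ i, fderiv ℝ (fderiv ℝ (ext h)) p (rot i p) (rot i p) := by
    rw [lap_eq]
    have : (∑ i, rotD i (rotD i h)) p = ∑ i, rotD i (rotD i h) p := by
      simp [Fin.sum_univ_three]
    rw [this]
    simp only [rotD_rotD_apply, Finset.sum_add_distrib, ← map_sum, sum_rot_rot]
    rw [map_smul, fderiv_ext_self h.contMDiff hp]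
    simp
  set B := fderiv ℝ (fderiv ℝ (ext h)) (p : E3)
  have h1 : ∀ i, B (rot i p) (rot i p) = ∑ k, ∑ l,
      inner ℝ (rot i p) (frame p k) * inner ℝ (rot i p) (frame p l) * B (frame p k) (frame p l) := by
    intro i
    conv_lhs => rw [sum_frame p (inner_rot_self i p)]
    simp only [Fin.sum_univ_two, map_add, add_apply, map_smul, smul_apply, smul_eq_mul,
      real_inner_comm (rot i p)]
    ring
  rw [h0]
  simp only [h1]
  rw [Finset.sum_comm]
  refine Finset.sum_congr rfl fun k _ => ?_
  rw [Finset.sum_comm]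
  simp only [← Finset.sum_mul, sum_inner_rot, inner_self_sphere, inner_frame_point, inner_frame]
  simp

theorem contDiff_comp_pt {h : Sph → V} (hh : ContMDiff (𝓡 2) 𝓘(ℝ, V) ∞ h) (p : Sph) :
    ContDiff ℝ ∞ (fun z => h (pt p z)) := by
  have : (fun z => h (pt p z)) = fun z => ext h (pt p z) := by simp
  rw [this]
  exact (contDiffOn_ext hh).comp_contDiff (contDiff_pt p) fun z => sphere_ne_zero _

theorem pd_comp_pt {h : Sph → ℝ} (hh : ContMDiff (𝓡 2) 𝓘(ℝ, ℝ) ∞ h) (p : Sph) (k : Fin 2)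
    (z : Fin 2 → ℝ) : pd k (fun z => h (pt p z)) z =
      fderiv ℝ (ext h) (pt p z) (fderiv ℝ (fun y => (pt p y : E3)) z (Pi.single k 1)) := by
  have : (fun z => h (pt p z)) = ext h ∘ fun z => (pt p z : E3) := by ext; simp
  rw [pd, this, fderiv_comp (f := fun y => (pt p y : E3)) z ((contDiffAt_ext hh (sphere_ne_zero _)).differentiableAt (by simp))
    ((contDiff_pt p).differentiable (by simp) z)]
  rfl

theorem fderiv_pt_zero (p : Sph) (k : Fin 2) :
    fderiv ℝ (fun y => (pt p y : E3)) 0 (Pi.single k 1) = frame p k := by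
  rw [hasFDerivAt_pt]
  fin_cases k <;> simp [smul_smul]

theorem pd_comp_pt_zero {h : Sph → ℝ} (hh : ContMDiff (𝓡 2) 𝓘(ℝ, ℝ) ∞ h) (p : Sph) (k : Fin 2) :
    pd k (fun z => h (pt p z)) 0 = fderiv ℝ (ext h) p (frame p k) := by
  rw [pd_comp_pt hh, fderiv_pt_zero, pt_zero]

theorem contDiff_pd {ι : Type*} [Fintype ι] [DecidableEq ι] {φ : (ι → ℝ) → ℝ} (hφ : ContDiff ℝ ∞ φ)
    (i : ι) : ContDiff ℝ ∞ (pd i φ) :=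
  (hφ.fderiv_right (m := ∞) (by simp)).clm_apply contDiff_const

/-- Along a coordinate line through the centre, the curve on the sphere has velocity `frame p k` and
acceleration `-p`. The acceleration is radial, so it contributes nothing to the second derivative.
-/
theorem pd_pd_comp_pt (h : SmoothFun) (p : Sph) (k : Fin 2) :
    pd k (pd k (fun z => h (pt p z))) 0 =
      fderiv ℝ (fderiv ℝ (ext h)) p (frame p k) (frame p k) := by
  have hl : HasDerivAt (fun s : ℝ => s • (Pi.single k 1 : Fin 2 → ℝ)) (Pi.single k 1) 0 := by
    simpa using (hasDerivAt_id (0 : ℝ)).smul_const (Pi.single k 1 : Fin 2 → ℝ)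
  have hφ := contDiff_comp_pt h.contMDiff p
  have h1 : HasDerivAt (fun s : ℝ => pd k (fun z => h (pt p z)) (s • Pi.single k 1))
      (pd k (pd k (fun z => h (pt p z))) 0) 0 := by
    have := ((contDiff_pd hφ k).differentiable (by simp)
      ((0 : ℝ) • Pi.single k 1)).hasFDerivAt.comp_hasDerivAt (0 : ℝ) hl
    rw [zero_smul] at this
    exact this
  have hpt : HasDerivAt (fun s : ℝ => (pt p (s • Pi.single k 1) : E3)) (frame p k) 0 := by
    have := ((contDiff_pt p).differentiable (by simp)
      ((0 : ℝ) • Pi.single k 1)).hasFDerivAt.comp_hasDerivAt (0 : ℝ) hl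
    rw [zero_smul, fderiv_pt_zero] at this
    exact this
  have hg : HasDerivAt (fun s : ℝ => fderiv ℝ (ext h) (pt p (s • Pi.single k 1)))
      (fderiv ℝ (fderiv ℝ (ext h)) p (frame p k)) 0 := by
    have h2 : HasFDerivAt (fderiv ℝ (ext h)) (fderiv ℝ (fderiv ℝ (ext h)) p)
        (pt p ((0 : ℝ) • Pi.single k 1) : E3) := by
      rw [zero_smul, pt_zero]
      exact (((contDiffOn_fderiv_ext h.contMDiff).contDiffAt
        (isOpen_compl_singleton.mem_nhds (sphere_ne_zero p))).differentiableAt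
        (by simp)).hasFDerivAt
    exact HasFDerivAt.comp_hasDerivAt (f := fun s : ℝ => (pt p (s • Pi.single k 1) : E3)) 0 h2 hpt
  have hv : HasDerivAt (fun s : ℝ => fderiv ℝ (fun y => (pt p y : E3)) (s • Pi.single k 1)
      (Pi.single k 1)) (-(p : E3)) 0 := by
    have hf : (fun s : ℝ => fderiv ℝ (fun y => (pt p y : E3)) (s • Pi.single k 1)
      (Pi.single k 1)) = fun s : ℝ => (s ^ 2 + 4)⁻¹ • ((4 : ℝ) • frame p k - (2 * s) • (p : E3)) -
        (2 * s * ((s ^ 2 + 4) ^ 2)⁻¹) • ((4 * s) • frame p k + (4 - s ^ 2) • (p : E3)) := by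
      ext1 s
      rw [hasFDerivAt_pt]
      fin_cases k <;> simp
    rw [hf]
    have hs := hasDerivAt_id (0 : ℝ)
    have hsq := (hs.pow 2).add_const 4
    have e1 := (hsq.inv (by simp)).smul ((hs.const_mul 2).smul_const (p : E3) |>.const_sub
      ((4 : ℝ) • frame p k))
    have e2 := ((hs.const_mul 2).mul ((hsq.pow 2).inv (by simp))).smul
      (((hs.const_mul 4).smul_const (frame p k)).add
      (((hs.pow 2).const_sub 4).smul_const (p : E3)))
    convert! e1.sub e2 using 1
    simp [smul_smul]
    module
  have h3 := hg.clm_apply hv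
  have h4 : (fun s : ℝ => pd k (fun z => h (pt p z)) (s • Pi.single k 1)) = fun s : ℝ =>
      fderiv ℝ (ext h) (pt p (s • Pi.single k 1))
        (fderiv ℝ (fun y => (pt p y : E3)) (s • Pi.single k 1) (Pi.single k 1)) := by
    ext1 s
    exact pd_comp_pt h.contMDiff p k _
  rw [h4] at h1
  rw [h1.unique h3]
  simp only [zero_smul, fderiv_pt_zero, pt_zero, map_neg]
  rw [fderiv_ext_self h.contMDiff (sphere_ne_zero p)]
  simp

/-- The Laplacian at `p` is the flat Laplacian in the stereographic chart centred at `p`. -/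
theorem lap_eq_chart (h : SmoothFun) (p : Sph) :
    lap h p = ∑ k, pd k (pd k (fun z => h (pt p z))) 0 := by
  rw [lap_apply]
  exact Finset.sum_congr rfl fun k _ => (pd_pd_comp_pt h p k).symm

end

/-! ### The surface measure -/

theorem surf_univ : surf.real Set.univ = 4 * Real.pi := by
  rw [Measure.toSphere_real_apply_univ, Measure.real, EuclideanSpace.volume_ball_fin_three]
  have : 0 ≤ Real.pi * 4 / 3 := by positivity
  simp [ENNReal.toReal_ofReal this]
  ring

/-- The action of a linear isometry on the sphere. -/
def isomSph (R : E3 ≃ₗᵢ[ℝ] E3) (p : Sph) : Sph := ⟨R p, by simp⟩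

theorem continuous_isomSph (R : E3 ≃ₗᵢ[ℝ] E3) : Continuous (isomSph R) :=
  (R.continuous.comp continuous_subtype_val).subtype_mk _

-- The surface measure of a set is defined through the volume of the cone over it, and an isometry
-- carries cones to cones of equal volume.
open scoped Pointwise in
theorem measurePreserving_isomSph (R : E3 ≃ₗᵢ[ℝ] E3) : MeasurePreserving (isomSph R) surf surf := by
  refine ⟨(continuous_isomSph R).measurable, ?_⟩
  ext s hs
  rw [Measure.map_apply (continuous_isomSph R).measurable hs,
    Measure.toSphere_apply' _ ((continuous_isomSph R).measurable hs), Measure.toSphere_apply' _ hs]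
  congr 1
  rw [← R.measurePreserving.measure_preimage_equiv (f := R.toMeasurableEquiv)
    (Set.Ioo (0 : ℝ) 1 • ((↑) '' s : Set E3))]
  congr 1
  ext x
  simp only [Set.mem_smul, Set.mem_preimage, Set.mem_image]
  constructor
  · rintro ⟨c, hc, y, ⟨p, hp, rfl⟩, rfl⟩
    exact ⟨c, hc, R p, ⟨isomSph R p, hp, rfl⟩, (map_smul R c (p : E3)).symm⟩
  · rintro ⟨c, hc, y, ⟨p, hp, rfl⟩, hx⟩
    refine ⟨c, hc, R.symm p, ⟨isomSph R.symm p, ?_, rfl⟩, ?_⟩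
    · have : isomSph R (isomSph R.symm p) = p := by ext1; simp [isomSph]
      change isomSph R _ ∈ s
      rwa [this]
    · apply R.injective
      rw [map_smul, R.apply_symm_apply]
      exact hx

/-- Differentiation under the integral sign over the sphere. -/
theorem hasDerivAt_integral_sphere {Φ Φ' : ℝ → Sph → ℝ} {t₀ : ℝ} {U : Set ℝ} (hU : U ∈ 𝓝 t₀)
    (hΦ : ∀ t ∈ U, Continuous (Φ t)) (hΦ' : ContinuousOn (Function.uncurry Φ') (U ×ˢ Set.univ))
    (hd : ∀ t ∈ U, ∀ p, HasDerivAt (fun s => Φ s p) (Φ' t p) t) :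
    HasDerivAt (fun t => ∫ p, Φ t p ∂surf) (∫ p, Φ' t₀ p ∂surf) t₀ := by
  obtain ⟨ε, hε, hεU⟩ := Metric.nhds_basis_closedBall.mem_iff.1 hU
  have hK : IsCompact (Metric.closedBall t₀ ε ×ˢ (Set.univ : Set Sph)) :=
    (isCompact_closedBall t₀ ε).prod isCompact_univ
  obtain ⟨C, hC⟩ := hK.exists_bound_of_continuousOn
    (hΦ'.mono (Set.prod_mono hεU (Set.subset_univ _)))
  have hcont : Continuous (Φ' t₀) := by
    have : Continuous fun p : Sph => ((t₀, p) : ℝ × Sph) := by fun_prop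
    exact hΦ'.comp_continuous this fun p => ⟨mem_of_mem_nhds hU, Set.mem_univ _⟩
  refine (hasDerivAt_integral_of_dominated_loc_of_deriv_le (F := Φ) (F' := Φ') (bound := fun _ => C)
    (s := Metric.closedBall t₀ ε) (Metric.closedBall_mem_nhds _ hε) ?_ ?_
    hcont.aestronglyMeasurable ?_ ?_ ?_).2
  · filter_upwards [hU] with t ht using (hΦ t ht).aestronglyMeasurable
  · exact (hΦ t₀ (mem_of_mem_nhds hU)).integrable_of_hasCompactSupport
      (HasCompactSupport.of_compactSpace _)
  · exact Filter.Eventually.of_forall fun p t ht => hC (t, p) ⟨ht, Set.mem_univ _⟩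
  · exact integrable_const _
  · exact Filter.Eventually.of_forall fun p t ht => hd t (hεU ht) p

theorem SmoothFun.integrable (h : SmoothFun) : Integrable (fun p => h p) surf :=
  h.contMDiff.continuous.integrable_of_hasCompactSupport (HasCompactSupport.of_compactSpace _)

theorem SmoothFun.integrable_mul (h k : SmoothFun) : Integrable (fun p => h p * k p) surf :=
  SmoothFun.integrable (h * k)

/-! ### The flow of a rotation field -/

/-- With R the rotation generator, R³ = -R is what makes id + sin θ R + (1 - cos θ) R² (Rodrigues'
formula) satisfy the flow equation. -/
theorem rot_rot_rot (i : Fin 3) (x : E3) : rot i (rot i (rot i x)) = -rot i x := by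
  ext k
  fin_cases i <;> fin_cases k <;> simp [rot_zero_apply, rot_one_apply, rot_two_apply]

/-- The rotation about the `i`-th axis. -/
def flowL (i : Fin 3) (θ : ℝ) : E3 →L[ℝ] E3 :=
  ContinuousLinearMap.id ℝ E3 + Real.sin θ • rotL i + (1 - Real.cos θ) • (rotL i ∘L rotL i)

theorem flowL_apply (i : Fin 3) (θ : ℝ) (x : E3) :
    flowL i θ x = x + Real.sin θ • rot i x + (1 - Real.cos θ) • rot i (rot i x) := rfl

theorem norm_flowL (i : Fin 3) (θ : ℝ) (x : E3) : ‖flowL i θ x‖ = ‖x‖ := by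
  rw [← sq_eq_sq₀ (norm_nonneg _) (norm_nonneg _), ← real_inner_self_eq_norm_sq,
    ← real_inner_self_eq_norm_sq, flowL_apply, inner_E3, inner_E3]
  have h := Real.sin_sq_add_cos_sq θ
  fin_cases i <;> simp [rot_zero_apply, rot_one_apply, rot_two_apply]
  · linear_combination (x 1 ^ 2 + x 2 ^ 2) * h
  · linear_combination (x 0 ^ 2 + x 2 ^ 2) * h
  · linear_combination (x 0 ^ 2 + x 1 ^ 2) * h

/-- The rotation about the `i`-th axis, as an isometry. -/
def flow (i : Fin 3) (θ : ℝ) : E3 ≃ₗᵢ[ℝ] E3 :=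
  LinearIsometry.toLinearIsometryEquiv ⟨(flowL i θ : E3 →ₗ[ℝ] E3), norm_flowL i θ⟩ rfl

theorem flow_apply (i : Fin 3) (θ : ℝ) (x : E3) :
    flow i θ x = x + Real.sin θ • rot i x + (1 - Real.cos θ) • rot i (rot i x) := rfl

theorem flow_zero (i : Fin 3) (p : Sph) : isomSph (flow i 0) p = p := by
  ext1
  change flow i 0 (p : E3) = p
  simp [flow_apply]

theorem hasDerivAt_flow (i : Fin 3) (x : E3) (θ : ℝ) :
    HasDerivAt (fun θ => flow i θ x) (rot i (flow i θ x)) θ := by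
  have h := (((Real.hasDerivAt_sin θ).smul_const (rot i x)).const_add x).add
    (((Real.hasDerivAt_cos θ).const_sub 1).smul_const (rot i (rot i x)))
  convert! h using 1
  rw [flow_apply, ← rotL_apply, map_add, map_add, map_smul, map_smul]
  simp only [rotL_apply, rot_rot_rot]
  module

theorem hasDerivAt_comp_flow (i : Fin 3) (h : SmoothFun) (p : Sph) (θ : ℝ) :
    HasDerivAt (fun θ => h (isomSph (flow i θ) p)) (rotD i h (isomSph (flow i θ) p)) θ := by
  have h1 : HasFDerivAt (ext h) (fderiv ℝ (ext h) (isomSph (flow i θ) p : E3)) (flow i θ p) :=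
    ((contDiffAt_ext h.contMDiff (sphere_ne_zero _)).differentiableAt (by simp)).hasFDerivAt
  have h2 := h1.comp_hasDerivAt θ (hasDerivAt_flow i p θ)
  have h3 : (fun θ => h (isomSph (flow i θ) p)) = ext h ∘ fun θ => flow i θ (p : E3) := by
    ext θ
    exact (ext_sphere h (isomSph (flow i θ) p)).symm
  rw [h3]
  exact h2

theorem continuous_flow (i : Fin 3) :
    Continuous fun x : ℝ × Sph => isomSph (flow i x.1) x.2 := by
  refine Continuous.subtype_mk ?_ _
  simp only [flow_apply]
  have h1 := continuous_rot i
  fun_prop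

/-- Differentiate the rotation invariance of the integral at angle zero. Integration by parts and
the symmetry of the Laplacian all come from this. -/
theorem integral_rotD (i : Fin 3) (h : SmoothFun) : ∫ p, rotD i h p ∂surf = 0 := by
  have h1 := hasDerivAt_integral_sphere (Φ := fun θ p => h (isomSph (flow i θ) p))
    (Φ' := fun θ p => rotD i h (isomSph (flow i θ) p)) (t₀ := 0) (U := Set.univ) Filter.univ_mem
    (fun θ _ => h.contMDiff.continuous.comp (continuous_isomSph _))
    ((rotD i h).contMDiff.continuous.comp (continuous_flow i)).continuousOn
    (fun θ _ p => hasDerivAt_comp_flow i h p θ)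
  have h2 : (fun θ => ∫ p, h (isomSph (flow i θ) p) ∂surf) = fun _ => ∫ p, h p ∂surf := by
    ext θ
    exact (measurePreserving_isomSph (flow i θ)).integral_comp'
      (f := ((flow i θ).toHomeomorph.subtype (fun x => by simp)).toMeasurableEquiv) _
  rw [h2] at h1
  simpa [flow_zero] using h1.unique (hasDerivAt_const _ _)

theorem integral_rotD_mul (i : Fin 3) (h k : SmoothFun) :
    ∫ p, rotD i h p * k p ∂surf = -∫ p, h p * rotD i k p ∂surf := by
  have h1 := integral_rotD i (h * k)
  rw [rotD_mul] at h1
  have h2 : ∫ p, rotD i h p * k p ∂surf + ∫ p, h p * rotD i k p ∂surf = 0 := by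
    rw [← integral_add (SmoothFun.integrable_mul _ _) (SmoothFun.integrable_mul _ _)]
    exact h1
  linarith

theorem lap_coe (h : SmoothFun) (p : Sph) : lap h p = ∑ i, rotD i (rotD i h) p := by
  rw [lap_eq]
  simp [Fin.sum_univ_three]

theorem integral_lap (h : SmoothFun) : ∫ p, lap h p ∂surf = 0 := by
  simp only [lap_coe]
  rw [integral_finsetSum _ fun i _ => SmoothFun.integrable (rotD i (rotD i h))]
  simp [integral_rotD]

theorem integral_lap_mul (h k : SmoothFun) :
    ∫ p, lap h p * k p ∂surf = -∑ i, ∫ p, rotD i h p * rotD i k p ∂surf := by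
  simp only [lap_coe, Finset.sum_mul]
  rw [integral_finsetSum _ fun i _ => SmoothFun.integrable_mul (rotD i (rotD i h)) k,
    ← Finset.sum_neg_distrib]
  exact Finset.sum_congr rfl fun i _ => integral_rotD_mul i _ _

theorem integral_lap_symm (h k : SmoothFun) :
    ∫ p, lap h p * k p ∂surf = ∫ p, h p * lap k p ∂surf := by
  have : ∫ p, h p * lap k p ∂surf = ∫ p, lap k p * h p ∂surf :=
    integral_congr_ae (Filter.Eventually.of_forall fun p => mul_comm _ _)
  rw [this, integral_lap_mul, integral_lap_mul]
  congr 1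
  refine Finset.sum_congr rfl fun i _ => integral_congr_ae (Filter.Eventually.of_forall fun p => ?_)
  exact mul_comm _ _

/-! ### Polynomials on the sphere -/

open MvPolynomial in
/-- The polynomial function on `ℝ³`. -/
def evE (P : MvPolynomial (Fin 3) ℝ) (x : E3) : ℝ := eval (fun i => x i) P

open MvPolynomial in
theorem hasFDerivAt_evE (P : MvPolynomial (Fin 3) ℝ) (x : E3) :
    HasFDerivAt (evE P) (∑ k, evE (pderiv k P) x • EuclideanSpace.proj (𝕜 := ℝ) k) x := by
  induction P using MvPolynomial.induction_on with
  | C a =>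
    have : evE (C a) = fun _ => a := by ext; simp [evE]
    rw [this]
    have h0 : (∑ k, evE (pderiv k (C a)) x • EuclideanSpace.proj (𝕜 := ℝ) k : E3 →L[ℝ] ℝ) = 0 := by
      simp [evE]
    rw [h0]
    exact hasFDerivAt_const a x
  | add p q hp hq =>
    have : evE (p + q) = evE p + evE q := by ext; simp [evE]
    rw [this]
    convert! hp.add hq using 1
    rw [← Finset.sum_add_distrib]
    refine Finset.sum_congr rfl fun k _ => ?_
    simp [evE, add_smul]
  | mul_X p n hp =>
    have : evE (p * X n) = fun x => evE p x * x n := by ext; simp [evE]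
    rw [this]
    convert! hp.mul (EuclideanSpace.proj (𝕜 := ℝ) n).hasFDerivAt using 1
    ext v
    simp only [evE, Derivation.leibniz, smul_eq_mul, eval_add, eval_mul, eval_X, pderiv_X,
      Fin.sum_univ_three, Pi.single_apply]
    fin_cases n <;> simp <;> ring

theorem contDiff_evE (P : MvPolynomial (Fin 3) ℝ) : ContDiff ℝ ∞ (evE P) := by
  induction P using MvPolynomial.induction_on with
  | C a =>
    have : evE (MvPolynomial.C a) = fun _ => a := by ext; simp [evE]
    rw [this]
    exact contDiff_const
  | add p q hp hq =>
    have : evE (p + q) = evE p + evE q := by ext; simp [evE]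
    rw [this]
    exact hp.add hq
  | mul_X p n hp =>
    have : evE (p * MvPolynomial.X n) = fun x => evE p x * x n := by ext; simp [evE]
    rw [this]
    exact hp.mul (EuclideanSpace.proj (𝕜 := ℝ) n).contDiff

/-- The restriction of a polynomial to the sphere. -/
def polyFun : MvPolynomial (Fin 3) ℝ →ₗ[ℝ] SmoothFun where
  toFun P := restrict (evE P) (contDiff_evE P)
  map_add' P Q := by ext p; exact map_add (MvPolynomial.eval fun i => (p : E3) i) P Q
  map_smul' c P := by ext p; exact MvPolynomial.smul_eval _ P c

theorem polyFun_apply (P : MvPolynomial (Fin 3) ℝ) (p : Sph) :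
    polyFun P p = MvPolynomial.eval (fun i => (p : E3) i) P := rfl

/-! ### Algebra of the rotation fields, the Laplacian and the Euler operator on polynomials. -/

section Algebra

open MvPolynomial

/-- The rotation fields acting on polynomials. -/
def rotP (i : Fin 3) (P : MvPolynomial (Fin 3) ℝ) : MvPolynomial (Fin 3) ℝ :=
  ![X 1 * pderiv 2 P - X 2 * pderiv 1 P, X 2 * pderiv 0 P - X 0 * pderiv 2 P,
    X 0 * pderiv 1 P - X 1 * pderiv 0 P] i

theorem rotD_polyFun (i : Fin 3) (P : MvPolynomial (Fin 3) ℝ) :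
    rotD i (polyFun P) = polyFun (rotP i P) := by
  ext p
  change rotD i (restrict (evE P) (contDiff_evE P)) p = _
  rw [hasFDerivAt_ext_restrict, (hasFDerivAt_evE P _).fderiv, polyFun_apply]
  simp only [Fin.sum_univ_three, evE]
  fin_cases i <;> simp [rot_zero_apply, rot_one_apply, rot_two_apply, rotP] <;> ring

/-- The Laplacian of `ℝ³` on polynomials. -/
def lapP : Module.End ℝ (MvPolynomial (Fin 3) ℝ) :=
  ∑ i, (pderiv i : Derivation ℝ (MvPolynomial (Fin 3) ℝ) (MvPolynomial (Fin 3) ℝ)).toLinearMap ∘ₗ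
    (pderiv i : Derivation ℝ (MvPolynomial (Fin 3) ℝ) (MvPolynomial (Fin 3) ℝ)).toLinearMap

theorem lapP_apply (P : MvPolynomial (Fin 3) ℝ) : lapP P = ∑ i, pderiv i (pderiv i P) := by
  simp [lapP]

theorem pderiv_comm (i j : Fin 3) (P : MvPolynomial (Fin 3) ℝ) :
    pderiv i (pderiv j P) = pderiv j (pderiv i P) := by
  have h : ⁅(pderiv i : Derivation ℝ (MvPolynomial (Fin 3) ℝ) (MvPolynomial (Fin 3) ℝ)),
      (pderiv j : Derivation ℝ (MvPolynomial (Fin 3) ℝ) (MvPolynomial (Fin 3) ℝ))⁆ = 0 := by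
    refine MvPolynomial.derivation_ext fun k => ?_
    simp [Derivation.commutator_apply, pderiv_X, Pi.single_apply, apply_ite]
  have := congrArg (fun D => D P) h
  simpa [Derivation.commutator_apply, sub_eq_zero] using this

/-- The Euler operator. -/
def eulerP (P : MvPolynomial (Fin 3) ℝ) : MvPolynomial (Fin 3) ℝ := ∑ i, X i * pderiv i P

theorem eulerP_of_isHomogeneous {P : MvPolynomial (Fin 3) ℝ} {n : ℕ} (h : P.IsHomogeneous n) :
    eulerP P = (n : ℝ) • P := by
  rw [eulerP, h.sum_X_mul_pderiv]
  simp [nsmul_eq_mul, smul_eq_C_mul]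

theorem isHomogeneous_rotP (i : Fin 3) {P : MvPolynomial (Fin 3) ℝ} {n : ℕ}
    (h : P.IsHomogeneous n) : (rotP i P).IsHomogeneous n := by
  have key : ∀ j k, (X j * pderiv k P).IsHomogeneous n := by
    intro j k
    rcases n with _ | n
    · have : pderiv k P = 0 := by
        rw [← totalDegree_zero_iff_isHomogeneous, totalDegree_eq_zero_iff_eq_C] at h
        rw [h, pderiv_C]
      simp [this, isHomogeneous_zero]
    · have := (isHomogeneous_X ℝ j).mul (h.pderiv (i := k))
      rwa [show 1 + (n + 1 - 1) = n + 1 by omega] at this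
  fin_cases i <;> exact (key _ _).sub (key _ _)

theorem lapP_rotP (i : Fin 3) (P : MvPolynomial (Fin 3) ℝ) :
    lapP (rotP i P) = rotP i (lapP P) := by
  have h01 := fun Q => pderiv_comm 1 0 Q
  have h02 := fun Q => pderiv_comm 2 0 Q
  have h12 := fun Q => pderiv_comm 2 1 Q
  fin_cases i <;>
  · simp [lapP_apply, rotP, Fin.sum_univ_three, pderiv_X, Derivation.leibniz, h01, h02, h12]
    try ring

/-- This is the Laplacian in polar coordinates: the angular part is |x|²Δ - E(E + 1), with E the
Euler operator. On a harmonic homogeneous polynomial of degree l only -l(l + 1) survives. -/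
theorem sum_rotP_rotP (P : MvPolynomial (Fin 3) ℝ) : ∑ i, rotP i (rotP i P) =
    (∑ i, X i ^ 2) * lapP P - eulerP (eulerP P) - eulerP P := by
  have h01 := fun Q => pderiv_comm 1 0 Q
  have h02 := fun Q => pderiv_comm 2 0 Q
  have h12 := fun Q => pderiv_comm 2 1 Q
  simp [lapP_apply, rotP, eulerP, Fin.sum_univ_three, pderiv_X, Derivation.leibniz, h01, h02, h12]
  ring

theorem lapP_normSq_mul (P : MvPolynomial (Fin 3) ℝ) : lapP ((∑ i, X i ^ 2) * P) =
    6 * P + 4 * eulerP P + (∑ i, X i ^ 2) * lapP P := by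
  have h2 : ∀ i, pderiv i (2 : MvPolynomial (Fin 3) ℝ) = 0 := fun i => by
    rw [← map_ofNat (C (σ := Fin 3) (R := ℝ)) 2, pderiv_C]
  simp [lapP_apply, eulerP, Fin.sum_univ_three, pderiv_X, Derivation.leibniz, h2]
  ring

theorem isHomogeneous_normSq : (∑ i, X i ^ 2 : MvPolynomial (Fin 3) ℝ).IsHomogeneous 2 := by
  refine IsHomogeneous.sum _ _ _ fun i _ => ?_
  simpa using (isHomogeneous_X ℝ i).pow 2

/-- The factor on the right is positive, which is what allows `exists_lapP_pow` to recover H from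
|x|^{2k} H by applying the Laplacian k times. -/
theorem lapP_normSq_pow_mul {H : MvPolynomial (Fin 3) ℝ} {d : ℕ} (hd : H.IsHomogeneous d)
    (hH : lapP H = 0) (j : ℕ) : lapP ((∑ i, X i ^ 2) ^ (j + 1) * H) =
      (2 * (j + 1) * (2 * j + 2 * d + 3) : ℝ) • ((∑ i, X i ^ 2) ^ j * H) := by
  have hom : ∀ j : ℕ, ((∑ i, X i ^ 2) ^ j * H : MvPolynomial (Fin 3) ℝ).IsHomogeneous (2 * j + d) :=
    fun j => (isHomogeneous_normSq.pow j).mul hd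
  induction j with
  | zero =>
    rw [zero_add, pow_one, lapP_normSq_mul, hH, eulerP_of_isHomogeneous hd]
    simp only [smul_eq_C_mul, map_add, map_mul, map_natCast, map_ofNat, map_one]
    simp
    ring
  | succ j ih =>
    rw [pow_succ', mul_assoc, lapP_normSq_mul, ih, eulerP_of_isHomogeneous (hom (j + 1))]
    simp only [smul_eq_C_mul, map_add, map_mul, map_natCast, map_ofNat, map_one]
    push_cast
    ring

theorem exists_lapP_pow {H : MvPolynomial (Fin 3) ℝ} {d : ℕ} (hd : H.IsHomogeneous d)
    (hH : lapP H = 0) (k : ℕ) :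
    ∃ c : ℝ, c ≠ 0 ∧ (lapP ^ k) ((∑ i, X i ^ 2) ^ k * H) = c • H := by
  induction k with
  | zero => exact ⟨1, one_ne_zero, by simp⟩
  | succ k ih =>
    obtain ⟨c, hc, h⟩ := ih
    refine ⟨2 * (k + 1) * (2 * k + 2 * d + 3) * c, by positivity, ?_⟩
    rw [pow_succ, Module.End.mul_apply, lapP_normSq_pow_mul hd hH, map_smul, h, smul_smul]

theorem isHomogeneous_lapP {P : MvPolynomial (Fin 3) ℝ} {n : ℕ} (h : P.IsHomogeneous n) :
    (lapP P).IsHomogeneous (n - 2) := by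
  rw [lapP_apply]
  exact IsHomogeneous.sum _ _ _ fun i _ => h.pderiv.pderiv

theorem lapP_eq_zero {P : MvPolynomial (Fin 3) ℝ} {n : ℕ} (h : P.IsHomogeneous n) (hn : n < 2) :
    lapP P = 0 := by
  rw [lapP_apply]
  refine Finset.sum_eq_zero fun i _ => ?_
  have h1 : (pderiv i P).IsHomogeneous 0 := by
    have := h.pderiv (i := i)
    rwa [show n - 1 = 0 by omega] at this
  rw [← totalDegree_zero_iff_isHomogeneous, totalDegree_eq_zero_iff_eq_C] at h1
  rw [h1, pderiv_C]

theorem lapP_pow_eq_zero (k : ℕ) {P : MvPolynomial (Fin 3) ℝ} {n : ℕ} (h : P.IsHomogeneous n)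
    (hn : n < 2 * k) : (lapP ^ k) P = 0 := by
  induction k generalizing P n with
  | zero => omega
  | succ k ih =>
    rw [pow_succ, Module.End.mul_apply]
    by_cases h2 : n < 2
    · rw [lapP_eq_zero h h2, map_zero]
    · exact ih (isHomogeneous_lapP h) (by omega)

theorem isHomogeneous_lapP_pow (k : ℕ) {P : MvPolynomial (Fin 3) ℝ} {n : ℕ}
    (h : P.IsHomogeneous n) : ((lapP ^ k) P).IsHomogeneous (n - 2 * k) := by
  induction k generalizing P n with
  | zero => simpa using h
  | succ k ih =>
    rw [pow_succ, Module.End.mul_apply]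
    have := ih (isHomogeneous_lapP h)
    rwa [show n - 2 - 2 * k = n - 2 * (k + 1) by omega] at this

end Algebra

/-! ### Spherical harmonics -/

/-- The space of spherical harmonics of degree `l`. -/
def Harm (l : ℕ) : Submodule ℝ SmoothFun where
  carrier := {Y | IsSphericalHarmonic l Y}
  add_mem' := by
    rintro Y Z ⟨P, hP, hP', hPe⟩ ⟨Q, hQ, hQ', hQe⟩
    refine ⟨P + Q, hP.add hQ, ?_, fun x => ?_⟩
    · simp only [map_add, Finset.sum_add_distrib, hP', hQ', add_zero]
    · simp [hPe, hQe]
  zero_mem' := ⟨0, MvPolynomial.isHomogeneous_zero _ _ _, by simp, fun x => by simp⟩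
  smul_mem' := by
    rintro c Y ⟨P, hP, hP', hPe⟩
    refine ⟨c • P, (MvPolynomial.homogeneousSubmodule _ _ _).smul_mem c hP, ?_, fun x => ?_⟩
    · simp only [Derivation.map_smul, ← Finset.smul_sum, hP', smul_zero]
    · simp [hPe]

theorem mem_Harm {l : ℕ} {Y : SmoothFun} : Y ∈ Harm l ↔
    ∃ P : MvPolynomial (Fin 3) ℝ, P.IsHomogeneous l ∧ lapP P = 0 ∧ polyFun P = Y := by
  constructor
  · rintro ⟨P, hP, hP', hPe⟩
    exact ⟨P, hP, by rw [lapP_apply, hP'], by ext x; rw [polyFun_apply, hPe]⟩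
  · rintro ⟨P, hP, hP', rfl⟩
    exact ⟨P, hP, by rw [← lapP_apply, hP'], fun x => rfl⟩

theorem rotD_mem_Harm (i : Fin 3) {l : ℕ} {Y : SmoothFun} (hY : Y ∈ Harm l) : rotD i Y ∈ Harm l := by
  obtain ⟨P, hP, hP', rfl⟩ := mem_Harm.1 hY
  refine mem_Harm.2 ⟨rotP i P, isHomogeneous_rotP i hP, ?_, (rotD_polyFun i P).symm⟩
  rw [lapP_rotP, hP']
  fin_cases i <;> simp [rotP]

theorem sum_sq_sphere (p : Sph) : (p : E3) 0 ^ 2 + (p : E3) 1 ^ 2 + (p : E3) 2 ^ 2 = 1 := by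
  have := inner_self_sphere p
  rw [inner_E3] at this
  linarith

theorem lap_of_mem_Harm {l : ℕ} {Y : SmoothFun} (hY : Y ∈ Harm l) : lap Y = (-lam l) • Y := by
  obtain ⟨P, hP, hP', rfl⟩ := mem_Harm.1 hY
  rw [lap_eq]
  simp only [rotD_polyFun]
  rw [← map_sum, sum_rotP_rotP, hP', eulerP_of_isHomogeneous hP,
    eulerP_of_isHomogeneous ((MvPolynomial.homogeneousSubmodule _ _ _).smul_mem _ hP),
    mul_zero, zero_sub, smul_smul, ← map_smul]
  congr 1
  rw [lam]
  module

theorem polyFun_normSq_pow_mul (k : ℕ) (H : MvPolynomial (Fin 3) ℝ) :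
    polyFun ((∑ i, MvPolynomial.X i ^ 2) ^ k * H) = polyFun H := by
  ext p
  simp [polyFun_apply, Fin.sum_univ_three, sum_sq_sphere]

/-- Induction on the power of the Laplacian that kills P. If Δ^{k+1} P = 0, then H = Δ^k P is
harmonic. Subtracting the right multiple of |x|^{2k} H leaves a polynomial killed by Δ^k, and the
subtracted term restricts to a multiple of H on the sphere. The bound on k keeps the natural number
subtraction n - 2k exact. -/
theorem polyFun_mem_iSup_of_isHomogeneous (k n : ℕ) (P : MvPolynomial (Fin 3) ℝ)
    (hk : 2 * k ≤ n + 2) (hP : P.IsHomogeneous n) (h0 : (lapP ^ k) P = 0) :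
    polyFun P ∈ ⨆ l, Harm l := by
  induction k generalizing P with
  | zero =>
    have : P = 0 := by simpa using h0
    rw [this, map_zero]
    exact zero_mem _
  | succ k ih =>
    set H := (lapP ^ k) P with hHdef
    have hH : H.IsHomogeneous (n - 2 * k) := isHomogeneous_lapP_pow k hP
    have hH0 : lapP H = 0 := by rwa [pow_succ', Module.End.mul_apply] at h0
    obtain ⟨c, hc, hcH⟩ := exists_lapP_pow hH hH0 k
    set P' := P - c⁻¹ • ((∑ i, MvPolynomial.X i ^ 2) ^ k * H)
    have h1 : polyFun P' ∈ ⨆ l, Harm l := by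
      refine ih P' (by omega) ?_ ?_
      · refine hP.sub ((MvPolynomial.homogeneousSubmodule _ _ _).smul_mem _ ?_)
        have := (isHomogeneous_normSq.pow k).mul hH
        rwa [show 2 * k + (n - 2 * k) = n by omega] at this
      · rw [map_sub, map_smul, hcH, smul_smul, inv_mul_cancel₀ hc, one_smul, sub_self]
    have h2 : polyFun H ∈ ⨆ l, Harm l :=
      (le_iSup Harm (n - 2 * k)) (mem_Harm.2 ⟨H, hH, hH0, rfl⟩)
    have h3 : polyFun P = polyFun P' + c⁻¹ • polyFun H := by
      rw [map_sub, map_smul, polyFun_normSq_pow_mul]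
      simp
    rw [h3]
    exact add_mem h1 (Submodule.smul_mem _ _ h2)

theorem polyFun_mem_iSup (P : MvPolynomial (Fin 3) ℝ) : polyFun P ∈ ⨆ l, Harm l := by
  rw [← MvPolynomial.sum_homogeneousComponent P, map_sum]
  refine Submodule.sum_mem _ fun n _ => ?_
  have h := MvPolynomial.homogeneousComponent_isHomogeneous n P
  -- The exponent n/2 + 1 is large enough to annihilate degree n and still satisfies 2k ≤ n + 2.
  exact polyFun_mem_iSup_of_isHomogeneous (n / 2 + 1) n _ (by omega) h
    (lapP_pow_eq_zero _ h (by omega))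

theorem finiteDimensional_Harm (l : ℕ) : FiniteDimensional ℝ (Harm l) := by
  have hfin := Finsupp.finite_of_degree_eq (σ := Fin 3) l
  let S : Submodule ℝ SmoothFun := Submodule.span ℝ
    ((fun d : Fin 3 →₀ ℕ => polyFun (MvPolynomial.monomial d 1)) '' {d | d.degree = l})
  have hS : FiniteDimensional ℝ S := FiniteDimensional.span_of_finite ℝ (hfin.image _)
  refine Submodule.finiteDimensional_of_le (S₂ := S) ?_
  intro Y hY
  obtain ⟨P, hP, -, rfl⟩ := mem_Harm.1 hY
  rw [P.as_sum, map_sum]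
  refine Submodule.sum_mem _ fun d hd => ?_
  have : MvPolynomial.monomial d (P.coeff d) = (P.coeff d) • MvPolynomial.monomial d (1 : ℝ) := by
    simp [MvPolynomial.smul_monomial]
  rw [this, map_smul]
  refine Submodule.smul_mem _ _ (Submodule.subset_span ⟨d, ?_, rfl⟩)
  have := hP (MvPolynomial.mem_support_iff.1 hd)
  change d.degree = l
  rw [Finsupp.degree_eq_weight_one]
  exact this

/-! ### The decomposition of `L²` into spherical harmonics -/

/-- A smooth function as a continuous map. -/
def toCM (h : SmoothFun) : C(Sph, ℝ) := ⟨h, h.contMDiff.continuous⟩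

theorem toL2_eq (h : SmoothFun) : toL2 h = ContinuousMap.toLp 2 surf ℝ (toCM h) := rfl

theorem coeFn_toL2 (h : SmoothFun) : toL2 h =ᵐ[surf] fun p => h p :=
  ContinuousMap.coeFn_toLp (p := 2) (𝕜 := ℝ) surf (toCM h)

/-- The map to `L²`, as a linear map. -/
def toL2L : SmoothFun →ₗ[ℝ] L2 where
  toFun := toL2
  map_add' h k := (ContinuousMap.toLp 2 surf ℝ).map_add (toCM h) (toCM k)
  map_smul' c h := (ContinuousMap.toLp 2 surf ℝ).map_smul c (toCM h)

@[simp] theorem toL2L_apply (h : SmoothFun) : toL2L h = toL2 h := rfl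

theorem toL2_injective : Function.Injective toL2 := by
  intro h k hhk
  have := ContinuousMap.toLp_injective (p := 2) (𝕜 := ℝ) surf hhk
  ext p
  exact DFunLike.congr_fun this p

theorem inner_toL2 (h k : SmoothFun) : inner ℝ (toL2 h) (toL2 k) = ∫ p, h p * k p ∂surf := by
  rw [toL2_eq, toL2_eq, ContinuousMap.inner_toLp]
  refine integral_congr_ae (Filter.Eventually.of_forall fun p => ?_)
  exact mul_comm _ _

theorem inner_toL2_right (f : L2) (k : SmoothFun) :
    inner ℝ f (toL2 k) = ∫ p, f p * k p ∂surf := by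
  rw [L2.inner_def]
  refine integral_congr_ae ?_
  filter_upwards [coeFn_toL2 k] with p hp
  rw [hp]
  exact mul_comm _ _

theorem norm_toL2_sq (h : SmoothFun) : ‖toL2 h‖ ^ 2 = ∫ p, h p ^ 2 ∂surf := by
  rw [← real_inner_self_eq_norm_sq, inner_toL2]
  simp only [sq]

theorem lam_nonneg (l : ℕ) : 0 ≤ lam l := by unfold lam; positivity

theorem lam_pos {l : ℕ} (hl : l ≠ 0) : 0 < lam l := by
  unfold lam
  have : (0 : ℝ) < l := by exact_mod_cast Nat.pos_of_ne_zero hl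
  positivity

theorem lam_strictMono : StrictMono lam := by
  intro l m h
  unfold lam
  have : (l : ℝ) < m := by exact_mod_cast h
  have h0 : (0 : ℝ) ≤ l := by positivity
  nlinarith

/-- The Laplacian is symmetric and the two eigenvalues differ. -/
theorem inner_Harm_eq_zero {l m : ℕ} (hlm : l ≠ m) {Y Z : SmoothFun} (hY : Y ∈ Harm l)
    (hZ : Z ∈ Harm m) : ∫ p, Y p * Z p ∂surf = 0 := by
  have h1 := integral_lap_symm Y Z
  rw [lap_of_mem_Harm hY, lap_of_mem_Harm hZ] at h1
  have h2 : ∫ p, ((-lam l) • Y) p * Z p ∂surf = (-lam l) * ∫ p, Y p * Z p ∂surf := by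
    rw [← integral_const_mul]
    exact integral_congr_ae (Filter.Eventually.of_forall fun p => mul_assoc _ _ _)
  have h3 : ∫ p, Y p * ((-lam m) • Z) p ∂surf = (-lam m) * ∫ p, Y p * Z p ∂surf := by
    rw [← integral_const_mul]
    exact integral_congr_ae (Filter.Eventually.of_forall fun p => mul_left_comm _ _ _)
  rw [h2, h3] at h1
  have h4 : lam m - lam l ≠ 0 := sub_ne_zero.2 fun h => hlm (lam_strictMono.injective h).symm
  refine (mul_eq_zero.1 (?_ : (lam m - lam l) * ∫ p, Y p * Z p ∂surf = 0)).resolve_left h4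
  linarith

/-- The space of spherical harmonics of degree `l`, in `L²`. -/
def HL (l : ℕ) : Submodule ℝ L2 := (Harm l).map toL2L

instance (l : ℕ) : FiniteDimensional ℝ (HL l) := by
  have := finiteDimensional_Harm l
  unfold HL
  infer_instance

theorem toL2_mem_HL {l : ℕ} {Y : SmoothFun} (hY : Y ∈ Harm l) : toL2 Y ∈ HL l := ⟨Y, hY, rfl⟩

theorem orthogonalFamily_HL :
    OrthogonalFamily ℝ (fun l => HL l) fun l => (HL l).subtypeₗᵢ := by
  intro l m hlm
  rintro ⟨_, Y, hY, rfl⟩ ⟨_, Z, hZ, rfl⟩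
  exact (inner_toL2 Y Z).trans (inner_Harm_eq_zero hlm hY hZ)

/-- Stone–Weierstrass for the algebra generated by the three coordinates, followed by the density of
continuous functions in L². -/
theorem dense_polyFun : (LinearMap.range (toL2L ∘ₗ polyFun)).topologicalClosure = ⊤ := by
  let φ : MvPolynomial (Fin 3) ℝ →ₐ[ℝ] C(Sph, ℝ) :=
    MvPolynomial.aeval fun i => toCM (polyFun (MvPolynomial.X i))
  have hφ : ∀ P, φ P = toCM (polyFun P) := by
    intro P
    induction P using MvPolynomial.induction_on with
    | C a =>
      rw [MvPolynomial.algHom_C]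
      ext p
      simp [toCM, polyFun_apply]
    | add p q hp hq =>
      rw [map_add, hp, hq, map_add]
      rfl
    | mul_X P n hP =>
      rw [map_mul, hP, MvPolynomial.aeval_X]
      ext p
      simp [toCM, polyFun_apply]
  have hsep : φ.range.SeparatesPoints := by
    intro x y hxy
    by_contra! hcon
    refine hxy ?_
    ext k
    have := hcon (fun p => φ (MvPolynomial.X k) p) ⟨φ (MvPolynomial.X k), ⟨_, rfl⟩, rfl⟩
    simpa [hφ, toCM, polyFun_apply] using this
  have htop := ContinuousMap.subalgebra_topologicalClosure_eq_top_of_separatesPoints φ.range hsep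
  have hd : Dense (Set.range φ) := by
    have : (φ.range.topologicalClosure : Set C(Sph, ℝ)) = Set.univ := by rw [htop]; rfl
    rw [Subalgebra.topologicalClosure_coe] at this
    exact dense_iff_closure_eq.2 this
  have hdr : DenseRange φ := hd
  have hdr2 := (ContinuousMap.toLp_denseRange ℝ surf ℝ (p := 2) (by simp)).comp hdr
    (ContinuousMap.toLp 2 surf ℝ).continuous
  rw [← Submodule.dense_iff_topologicalClosure_eq_top]
  have heq : ((LinearMap.range (toL2L ∘ₗ polyFun) : Submodule ℝ L2) : Set L2) =
      Set.range (ContinuousMap.toLp 2 surf ℝ ∘ φ) := by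
    ext f
    simp only [LinearMap.coe_range, Set.mem_range, Function.comp_apply, hφ]
    rfl
  rw [heq]
  exact hdr2

theorem dense_HL : ⊤ ≤ (⨆ l, HL l).topologicalClosure := by
  rw [← dense_polyFun]
  refine Submodule.topologicalClosure_mono ?_
  rintro _ ⟨P, rfl⟩
  have h1 : (⨆ l, HL l) = (⨆ l, Harm l).map toL2L := by
    simp only [HL, Submodule.map_iSup]
  rw [h1]
  exact ⟨polyFun P, polyFun_mem_iSup P, rfl⟩

theorem isHilbertSum_HL : IsHilbertSum ℝ (fun l => HL l) fun l => (HL l).subtypeₗᵢ :=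
  IsHilbertSum.mkInternal HL orthogonalFamily_HL dense_HL

/-- The orthogonal projection to the spherical harmonics of degree `l`. -/
def proj (l : ℕ) : L2 →L[ℝ] L2 := (HL l).starProjection

theorem proj_mem (l : ℕ) (f : L2) : proj l f ∈ HL l := Submodule.starProjection_apply_mem _ _

theorem proj_of_mem {l : ℕ} {f : L2} (hf : f ∈ HL l) : proj l f = f :=
  Submodule.starProjection_eq_self_iff.2 hf

theorem inner_of_mem_HL {l m : ℕ} (hlm : l ≠ m) {f g : L2} (hf : f ∈ HL l) (hg : g ∈ HL m) :
    inner ℝ f g = 0 := by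
  obtain ⟨Y, hY, rfl⟩ := hf
  obtain ⟨Z, hZ, rfl⟩ := hg
  exact (inner_toL2 Y Z).trans (inner_Harm_eq_zero hlm hY hZ)

theorem proj_of_mem_ne {l m : ℕ} (hlm : l ≠ m) {f : L2} (hf : f ∈ HL m) : proj l f = 0 := by
  refine (Submodule.starProjection_apply_eq_zero_iff (HL l)).2 fun g hg => ?_
  exact inner_of_mem_HL hlm hg hf

theorem inner_proj_left (l : ℕ) (f g : L2) : inner ℝ (proj l f) g = inner ℝ f (proj l g) :=
  Submodule.inner_starProjection_left_eq_right _ _ _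

theorem proj_of_hasSum {w : ℕ → L2} (hw : ∀ l, w l ∈ HL l) {g : L2} (h : HasSum w g) (l : ℕ) :
    proj l g = w l := by
  have h1 := h.mapL (proj l)
  have h2 : HasSum (fun m => proj l (w m)) (w l) := by
    have := hasSum_single (f := fun m => proj l (w m)) l fun m hm => proj_of_mem_ne hm.symm (hw m)
    rwa [proj_of_mem (hw l)] at this
  exact h1.unique h2

theorem hasSum_proj (f : L2) : HasSum (fun l => proj l f) f := by
  obtain ⟨w, rfl⟩ := isHilbertSum_HL.linearIsometryEquiv.symm.surjective f
  have h := isHilbertSum_HL.hasSum_linearIsometryEquiv_symm w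
  have h2 : ∀ l, proj l (isHilbertSum_HL.linearIsometryEquiv.symm w) = w l :=
    fun l => proj_of_hasSum (fun l => (w l).2) h l
  simp only [h2]
  exact h

theorem ext_proj {f g : L2} (h : ∀ l, proj l f = proj l g) : f = g := by
  have h1 := hasSum_proj f
  simp only [h] at h1
  exact h1.unique (hasSum_proj g)

theorem hasSum_inner_proj (f g : L2) :
    HasSum (fun l => inner ℝ (proj l f) (proj l g)) (inner ℝ f g) := by
  have h := (hasSum_proj f).mapL ((innerSL ℝ (E := L2)) g)
  convert! h using 1
  · ext l
    rw [innerSL_apply_apply, ← inner_proj_left, proj_of_mem (proj_mem l f), real_inner_comm]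
  · rw [innerSL_apply_apply, real_inner_comm]

theorem hasSum_norm_proj (f : L2) : HasSum (fun l => ‖proj l f‖ ^ 2) (‖f‖ ^ 2) := by
  simpa only [real_inner_self_eq_norm_sq] using hasSum_inner_proj f f

theorem exists_hasSum {w : ℕ → L2} (hw : ∀ l, w l ∈ HL l) (hs : Summable fun l => ‖w l‖ ^ 2) :
    ∃ g, HasSum w g := by
  have h := (orthogonalFamily_HL.summable_iff_norm_sq_summable (fun l => ⟨w l, hw l⟩)).2
    (by simpa using hs)
  exact ⟨_, h.hasSum⟩

theorem summable_mul_proj {c : ℕ → ℝ} {C : ℝ} (hc : ∀ l, |c l| ≤ C) (f : L2) :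
    Summable fun l => ‖c l • proj l f‖ ^ 2 := by
  refine Summable.of_nonneg_of_le (fun l => by positivity) (fun l => ?_)
    ((hasSum_norm_proj f).summable.mul_left (C ^ 2))
  rw [norm_smul, mul_pow]
  gcongr
  exact hc l

/-- The operator that multiplies the spherical harmonics of degree `l` by `c l`. -/
def mult (c : ℕ → ℝ) (C : ℝ) (hc : ∀ l, |c l| ≤ C) : L2 →L[ℝ] L2 :=
  have hs : ∀ f : L2, HasSum (fun l => c l • proj l f) (∑' l, c l • proj l f) := fun f =>
    (exists_hasSum (fun l => (HL l).smul_mem _ (proj_mem l f)) (summable_mul_proj hc f)).elim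
      fun _ h => h.summable.hasSum
  LinearMap.mkContinuous
    { toFun := fun f => ∑' l, c l • proj l f
      map_add' := fun f g => by
        refine (hs (f + g)).unique ?_
        simpa only [map_add, smul_add] using (hs f).add (hs g)
      map_smul' := fun a f => by
        refine (hs (a • f)).unique ?_
        simpa only [map_smul, smul_comm a, RingHom.id_apply] using (hs f).const_smul a } |C|
    (fun f => by
      have hC : 0 ≤ C := (abs_nonneg _).trans (hc 0)
      rw [abs_of_nonneg hC]
      refine abs_le_of_sq_le_sq' ?_ (by positivity) |>.2
      set g := ∑' l, c l • proj l f
      have h1 : ∀ l, proj l g = c l • proj l f :=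
        proj_of_hasSum (fun l => (HL l).smul_mem _ (proj_mem l f)) (hs f)
      have h2 := hasSum_norm_proj g
      rw [mul_pow]
      refine hasSum_le (fun l => ?_) h2 ((hasSum_norm_proj f).mul_left (C ^ 2))
      rw [h1, norm_smul, mul_pow]
      gcongr
      exact hc l)

theorem proj_mult {c : ℕ → ℝ} {C : ℝ} (hc : ∀ l, |c l| ≤ C) (f : L2) (l : ℕ) :
    proj l (mult c C hc f) = c l • proj l f := by
  obtain ⟨g, hg⟩ := exists_hasSum (fun l => (HL l).smul_mem (c l) (proj_mem l f))
    (summable_mul_proj hc f)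
  have : mult c C hc f = g := hg.tsum_eq
  rw [this]
  exact proj_of_hasSum (fun l => (HL l).smul_mem (c l) (proj_mem l f)) hg l

/-! ### The harmonic components of a smooth function -/

/-- `HL l` is the image of a space of smooth functions, so an L² projection onto it always has a
smooth representative. -/
theorem exists_harm (l : ℕ) (h : SmoothFun) : ∃ Y ∈ Harm l, toL2 Y = proj l (toL2 h) :=
  proj_mem l (toL2 h)

/-- The component of degree `l` of a smooth function. -/
def harm (l : ℕ) : SmoothFun →ₗ[ℝ] SmoothFun where
  toFun h := (exists_harm l h).choose
  map_add' h k := by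
    apply toL2_injective
    change _ = toL2L (_ + _)
    rw [map_add, toL2L_apply, toL2L_apply, (exists_harm l h).choose_spec.2,
      (exists_harm l k).choose_spec.2, (exists_harm l (h + k)).choose_spec.2, ← toL2L_apply, map_add,
      map_add]
    rfl
  map_smul' c h := by
    apply toL2_injective
    change _ = toL2L (_ • _)
    rw [map_smul, toL2L_apply, (exists_harm l h).choose_spec.2,
      (exists_harm l (c • h)).choose_spec.2, ← toL2L_apply, map_smul, map_smul]
    rfl

theorem harm_mem (l : ℕ) (h : SmoothFun) : harm l h ∈ Harm l := (exists_harm l h).choose_spec.1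

theorem toL2_harm (l : ℕ) (h : SmoothFun) : toL2 (harm l h) = proj l (toL2 h) :=
  (exists_harm l h).choose_spec.2

theorem harm_of_mem_ne {l m : ℕ} (hlm : l ≠ m) {Y : SmoothFun} (hY : Y ∈ Harm m) :
    harm l Y = 0 := by
  apply toL2_injective
  rw [toL2_harm, proj_of_mem_ne hlm (toL2_mem_HL hY), ← toL2L_apply, map_zero]

theorem inner_toL2_rotD (i : Fin 3) (h k : SmoothFun) :
    inner ℝ (toL2 (rotD i h)) (toL2 k) = -inner ℝ (toL2 h) (toL2 (rotD i k)) := by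
  rw [inner_toL2, inner_toL2, integral_rotD_mul]

/-- A rotational derivative is antisymmetric and preserves each space of harmonics, hence also the
orthogonal complements, so it commutes with the projections. -/
theorem harm_rotD (i : Fin 3) (l : ℕ) (h : SmoothFun) : harm l (rotD i h) = rotD i (harm l h) := by
  apply toL2_injective
  rw [toL2_harm]
  refine Submodule.eq_starProjection_of_mem_of_inner_eq_zero
    (toL2_mem_HL (rotD_mem_Harm i (harm_mem l h))) ?_
  rintro _ ⟨Y, hY, rfl⟩
  have h1 : inner ℝ (toL2 h - proj l (toL2 h)) (toL2 (rotD i Y)) = 0 :=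
    Submodule.starProjection_inner_eq_zero _ _ (toL2_mem_HL (rotD_mem_Harm i hY))
  rw [← toL2_harm, inner_sub_left] at h1
  rw [toL2L_apply, inner_sub_left, inner_toL2_rotD, inner_toL2_rotD]
  linarith

theorem harm_lap (l : ℕ) (h : SmoothFun) : harm l (lap h) = (-lam l) • harm l h := by
  rw [← lap_of_mem_Harm (harm_mem l h), lap_eq, lap_eq, map_sum]
  simp only [harm_rotD]

theorem ext_harm {h k : SmoothFun} (H : ∀ l, harm l h = harm l k) : h = k :=
  toL2_injective (ext_proj fun l => by rw [← toL2_harm, ← toL2_harm, H])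

instance : Nonempty Sph := ⟨nrm 0⟩

/-! ### A uniform bound for spherical harmonics -/

/-- If the second derivative were positive, 0 would also be a local minimum. The function would then
be constant near 0 and its second derivative would vanish. -/
theorem second_deriv_nonpos_of_max {g g' : ℝ → ℝ} {c : ℝ} (hg : ∀ θ, HasDerivAt g (g' θ) θ)
    (hg' : HasDerivAt g' c 0) (hmax : ∀ θ, g θ ≤ g 0) : c ≤ 0 := by
  by_contra! hc
  have hd : deriv g = g' := funext fun θ => (hg θ).deriv
  have hloc : IsLocalMax g 0 := Filter.Eventually.of_forall hmax
  have h0 : deriv g 0 = 0 := hloc.deriv_eq_zero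
  have hmin : IsLocalMin g 0 := isLocalMin_of_deriv_deriv_pos (by rw [hd, hg'.deriv]; exact hc) h0
    (hg 0).continuousAt
  have hconst : g =ᶠ[𝓝 0] fun _ => g 0 := by
    filter_upwards [hmin] with θ hθ using le_antisymm (hmax θ) hθ
  have h1 : deriv g =ᶠ[𝓝 0] fun _ => 0 := by
    have := hconst.deriv
    simpa using this
  have h2 : deriv (deriv g) 0 = 0 := by rw [h1.deriv_eq]; simp
  rw [hd, hg'.deriv] at h2
  exact hc.ne' h2

theorem lap_nonpos_of_max {W : SmoothFun} {x : Sph} (hx : ∀ y, W y ≤ W x) : lap W x ≤ 0 := by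
  rw [lap_coe]
  refine Finset.sum_nonpos fun i _ => ?_
  have h1 := fun θ => hasDerivAt_comp_flow i W x θ
  have h2 := hasDerivAt_comp_flow i (rotD i W) x 0
  rw [flow_zero] at h2
  refine second_deriv_nonpos_of_max h1 h2 fun θ => ?_
  rw [flow_zero]
  exact hx _

theorem lap_mul_self (h : SmoothFun) (p : Sph) :
    lap (h * h) p = 2 * h p * lap h p + 2 * ∑ i, rotD i h p ^ 2 := by
  rw [lap_coe, lap_coe]
  have : ∀ i, rotD i (rotD i (h * h)) p = 2 * h p * rotD i (rotD i h) p + 2 * rotD i h p ^ 2 := by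
    intro i
    rw [rotD_mul, map_add, rotD_mul, rotD_mul]
    simp
    ring
  simp only [this, Finset.sum_add_distrib, Finset.mul_sum]

theorem lap_rotD_of_mem_Harm {l : ℕ} {Y : SmoothFun} (hY : Y ∈ Harm l) (i : Fin 3) (p : Sph) :
    lap (rotD i Y) p = -lam l * rotD i Y p := by
  rw [lap_of_mem_Harm (rotD_mem_Harm i hY)]
  rfl

/-- A gradient estimate for spherical harmonics, from the maximum principle. -/
theorem gradient_bound {l : ℕ} {Y : SmoothFun} (hY : Y ∈ Harm l) {M : ℝ} (hM : ∀ p, |Y p| ≤ M)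
    (p : Sph) : ∑ i, rotD i Y p ^ 2 ≤ ((lam l + 1) * M) ^ 2 := by
  have hl := lam_nonneg l
  -- Bernstein's auxiliary function |∇Y|² + (λ+1) Y². Discarding the squared second derivatives
  -- gives ΔW ≥ 2|∇Y|² - 2λ(λ+1) Y². At a maximum of W this bounds |∇Y|² by λ(λ+1) M², so W ≤ (λ+1)²
  -- M² everywhere.
  set W : SmoothFun := (∑ i, rotD i Y * rotD i Y) + (lam l + 1) • (Y * Y) with hW
  have hWp : ∀ q, W q = ∑ i, rotD i Y q ^ 2 + (lam l + 1) * Y q ^ 2 := by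
    intro q
    simp [hW, Fin.sum_univ_three, sq]
  have hlW : ∀ q, lap W q ≥ 2 * ∑ i, rotD i Y q ^ 2 - 2 * (lam l + 1) * lam l * Y q ^ 2 := by
    intro q
    have e1 : lap W q = ∑ i, lap (rotD i Y * rotD i Y) q + (lam l + 1) * lap (Y * Y) q := by
      rw [hW, map_add, map_sum, map_smul]
      simp [Fin.sum_univ_three]
    have e2 : lap Y q = -lam l * Y q := by
      rw [lap_of_mem_Harm hY]
      rfl
    have e3 : ∑ i, lap (rotD i Y * rotD i Y) q ≥ -2 * lam l * ∑ i, rotD i Y q ^ 2 := by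
      rw [Finset.mul_sum]
      refine Finset.sum_le_sum fun i _ => ?_
      rw [lap_mul_self, lap_rotD_of_mem_Harm hY]
      have : 0 ≤ ∑ j, rotD j (rotD i Y) q ^ 2 := Finset.sum_nonneg fun j _ => sq_nonneg _
      nlinarith
    rw [e1, lap_mul_self, e2]
    nlinarith
  obtain ⟨x, -, hx⟩ := isCompact_univ.exists_isMaxOn (Set.univ_nonempty (α := Sph))
    W.contMDiff.continuous.continuousOn
  have hx' : ∀ y, W y ≤ W x := fun y => hx (Set.mem_univ y)
  have h1 := lap_nonpos_of_max hx'
  have h2 := hlW x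
  have h3 : Y x ^ 2 ≤ M ^ 2 := sq_le_sq' (by linarith [abs_le.1 (hM x)]) (abs_le.1 (hM x)).2
  have h4 := hx' p
  rw [hWp, hWp] at h4
  have h5 : 0 ≤ (lam l + 1) * Y p ^ 2 := by positivity
  have h6 : (lam l + 1) * Y x ^ 2 ≤ (lam l + 1) * M ^ 2 := by gcongr
  have h7 : (lam l + 1) * lam l * Y x ^ 2 ≤ (lam l + 1) * lam l * M ^ 2 := by gcongr
  nlinarith

/-- Cauchy–Schwarz in the expansion of the derivative along rotations, with Lagrange's identity
bounding the coefficients. -/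
theorem norm_fderiv_ext_le {Y : SmoothFun} {A : ℝ} (hA : 0 ≤ A)
    (h : ∀ p, ∑ i, rotD i Y p ^ 2 ≤ A ^ 2) {x : E3} (hx : x ≠ 0) :
    ‖fderiv ℝ (ext Y) x‖ ≤ A / ‖x‖ := by
  have hx0 : 0 < ‖x‖ := norm_pos_iff.2 hx
  refine ContinuousLinearMap.opNorm_le_bound _ (by positivity) fun v => ?_
  rw [fderiv_ext_eq Y hx]
  have h1 : ∑ i, (inner ℝ (rot i x) v / inner ℝ x x) * ext (rotD i Y) x =
      (∑ i, inner ℝ (rot i x) v * ext (rotD i Y) x) / ‖x‖ ^ 2 := by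
    rw [Finset.sum_div, real_inner_self_eq_norm_sq]
    exact Finset.sum_congr rfl fun i _ => by ring
  have h2 : (∑ i, inner ℝ (rot i x) v * ext (rotD i Y) x) ^ 2 ≤ (‖x‖ * ‖v‖ * A) ^ 2 := by
    refine (Finset.sum_mul_sq_le_sq_mul_sq _ _ _).trans ?_
    have e1 : ∑ i, inner ℝ (rot i x) v ^ 2 ≤ (‖x‖ * ‖v‖) ^ 2 := by
      have := sum_inner_rot x v v
      simp only [← sq] at this
      rw [this, real_inner_self_eq_norm_sq, real_inner_self_eq_norm_sq, mul_pow]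
      nlinarith [sq_nonneg (inner ℝ x v)]
    rw [mul_pow _ A]
    exact mul_le_mul e1 (h (nrm x)) (Finset.sum_nonneg fun i _ => sq_nonneg _) (sq_nonneg _)
  have h3 := abs_le_of_sq_le_sq h2 (by positivity)
  rw [h1, Real.norm_eq_abs, abs_div, abs_of_pos (show 0 < ‖x‖ ^ 2 by positivity),
    div_le_iff₀ (by positivity)]
  refine h3.trans (le_of_eq ?_)
  field_simp

/-- Where |Y| attains its maximum M, the gradient estimate keeps |Y| ≥ M/2 on a ball of radius
comparable to 1/(λ+1). The mass of Y² on that ball is at most the squared L² norm. Any polynomial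
power of λ would do for the later use. -/
theorem sup_bound {l : ℕ} {Y : SmoothFun} (hY : Y ∈ Harm l) (p : Sph) :
    |Y p| ≤ 100 * (lam l + 1) ^ 2 * ‖toL2 Y‖ := by
  have hl := lam_nonneg l
  obtain ⟨x, -, hx⟩ := isCompact_univ.exists_isMaxOn (Set.univ_nonempty (α := Sph))
    (Y.contMDiff.continuous.abs).continuousOn
  set M := |Y x| with hMdef
  have hM : ∀ q, |Y q| ≤ M := fun q => hx (Set.mem_univ q)
  have hM0 : 0 ≤ M := abs_nonneg _
  have hg := gradient_bound hY hM
  -- On the Euclidean ball of radius 1/2 about x the norm is at least 1/2, so the extension is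
  -- Lipschitz there with constant 2(λ+1)M. Over the distance ε it changes by at most M/2.
  set ε : ℝ := 1 / (4 * (lam l + 1)) with hε
  have hε0 : 0 < ε := by positivity
  have hε4 : ε ≤ 1 / 4 := by
    rw [hε]
    apply one_div_le_one_div_of_le <;> linarith
  have hlip : ∀ q ∈ Metric.ball x ε, M / 2 ≤ |Y q| := by
    intro q hq
    have hnorm : ∀ y ∈ Metric.ball (x : E3) (1 / 2), 1 / 2 ≤ ‖y‖ := by
      intro y hy
      have h1 : ‖(x : E3)‖ = 1 := by simp
      have h2 : ‖y - x‖ < 1 / 2 := by rwa [← dist_eq_norm]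
      have h3 := norm_sub_norm_le (x : E3) y
      rw [norm_sub_rev] at h3
      linarith
    have hqx : (q : E3) ∈ Metric.ball (x : E3) (1 / 2) :=
      Metric.ball_subset_ball (by linarith) (show dist (q : E3) x < ε from hq)
    have := (convex_ball (x : E3) (1 / 2)).norm_image_sub_le_of_norm_fderiv_le (𝕜 := ℝ) (f := ext Y)
      (C := 2 * ((lam l + 1) * M)) (fun y hy => by
        have hy0 : y ≠ 0 := norm_pos_iff.1 (by linarith [hnorm y hy])
        exact (contDiffAt_ext Y.contMDiff hy0).differentiableAt (by simp)) (fun y hy => by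
        have hy0 : y ≠ 0 := norm_pos_iff.1 (by linarith [hnorm y hy])
        refine (norm_fderiv_ext_le (by positivity) hg hy0).trans ?_
        have := hnorm y hy
        rw [div_le_iff₀ (by linarith)]
        nlinarith [show 0 ≤ (lam l + 1) * M by positivity])
      (Metric.mem_ball_self (by norm_num)) hqx
    rw [ext_sphere, ext_sphere, ← dist_eq_norm (q : E3)] at this
    have hq' : dist (q : E3) x ≤ ε := le_of_lt hq
    have h5 : 2 * ((lam l + 1) * M) * dist (q : E3) x ≤ M / 2 := by
      calc 2 * ((lam l + 1) * M) * dist (q : E3) x ≤ 2 * ((lam l + 1) * M) * ε := by gcongr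
        _ = M / 2 := by rw [hε]; field_simp; ring
    have h6 := abs_sub_abs_le_abs_sub (Y x) (Y q)
    rw [abs_sub_comm] at h6
    have h7 : |Y q - Y x| ≤ M / 2 := (this.trans h5)
    linarith
  -- A crude cubic lower bound for the area of a spherical cap; the lost power of ε only costs a
  -- power of λ+1.
  have hvol : 3 * (ε / 4) ^ 3 ≤ surf.real (Metric.ball x ε) := by
    have h1 := Measure.toSphereBallBound_mul_measureReal_unitBall_le_toSphere_ball
      (volume : Measure E3) hε0 x
    have h2 : (volume : Measure E3).real (Metric.ball 0 1) = Real.pi * 4 / 3 := by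
      rw [Measure.real, EuclideanSpace.volume_ball_fin_three]
      have : 0 ≤ Real.pi * 4 / 3 := by positivity
      simp [ENNReal.toReal_ofReal this]
    have h3 : (Measure.toSphereBallBound (Module.finrank ℝ E3) ε : ℝ) = 3 * (ε / 4) ^ 3 := by
      rw [Measure.toSphereBallBound, if_pos ⟨by simp, hε0⟩]
      have : min (Real.toNNReal ε) 2 = Real.toNNReal ε := by
        rw [min_eq_left]
        exact Real.toNNReal_le_iff_le_coe.2 (by simp; linarith)
      rw [this]
      simp [Real.coe_toNNReal _ hε0.le]
    rw [h2, h3] at h1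
    have h4 : 1 ≤ Real.pi * 4 / 3 := by linarith [Real.pi_gt_three]
    nlinarith [show 0 ≤ 3 * (ε / 4) ^ 3 by positivity]
  have hmass : (M / 2) ^ 2 * surf.real (Metric.ball x ε) ≤ ‖toL2 Y‖ ^ 2 := by
    rw [norm_toL2_sq]
    have hi : Integrable (fun q => Y q ^ 2) surf := by
      simpa only [sq] using SmoothFun.integrable_mul Y Y
    calc (M / 2) ^ 2 * surf.real (Metric.ball x ε) = ∫ q in Metric.ball x ε, (M / 2) ^ 2 ∂surf := by
          rw [setIntegral_const, smul_eq_mul, mul_comm]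
      _ ≤ ∫ q in Metric.ball x ε, Y q ^ 2 ∂surf := by
          refine setIntegral_mono_on (integrableOn_const (by finiteness)) hi.integrableOn
            Metric.isOpen_ball.measurableSet fun q hq => ?_
          rw [← sq_abs (Y q)]
          have := hlip q hq
          gcongr
      _ ≤ ∫ q, Y q ^ 2 ∂surf :=
          setIntegral_le_integral hi (Filter.Eventually.of_forall fun q => sq_nonneg _)
  have hfin : M ^ 2 ≤ (100 * (lam l + 1) ^ 2 * ‖toL2 Y‖) ^ 2 := by
    have h1 : (M / 2) ^ 2 * (3 * (ε / 4) ^ 3) ≤ ‖toL2 Y‖ ^ 2 :=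
      (mul_le_mul_of_nonneg_left hvol (by positivity)).trans hmass
    have h2 : (M / 2) ^ 2 * (3 * (ε / 4) ^ 3) = 3 * M ^ 2 / (4 * 4096 * (lam l + 1) ^ 3) := by
      rw [hε]
      field_simp
      ring
    rw [h2, div_le_iff₀ (by positivity)] at h1
    -- Raising the exponent to an even number makes the right side a perfect square, and 4 · 4096 /
    -- 3 ≤ 100² accounts for the constant.
    have h3 : (lam l + 1) ^ 3 ≤ (lam l + 1) ^ 4 := pow_le_pow_right₀ (by linarith) (by norm_num)
    have h4 : ‖toL2 Y‖ ^ 2 * (lam l + 1) ^ 3 ≤ ‖toL2 Y‖ ^ 2 * (lam l + 1) ^ 4 := by gcongr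
    nlinarith [show 0 ≤ ‖toL2 Y‖ ^ 2 * (lam l + 1) ^ 4 by positivity]
  exact (hM p).trans (abs_le_of_sq_le_sq' hfin (by positivity)).2

theorem harm_sub_lap (l : ℕ) (h : SmoothFun) : harm l (h - lap h) = (lam l + 1) • harm l h := by
  rw [map_sub, harm_lap]
  module

theorem norm_toL2_harm_le (l : ℕ) (h : SmoothFun) : ‖toL2 (harm l h)‖ ≤ ‖toL2 h‖ := by
  rw [toL2_harm]
  exact Submodule.norm_starProjection_apply_le _ _

/-- Applying 1 - Δ three times gains (λ+1)⁻³ in L², while `sup_bound` loses (λ+1)². The remaining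
factor (λ+1)⁻¹ is at most 2/(l+1)², which is summable. -/
theorem harm_bound (h : SmoothFun) : ∃ C, 0 ≤ C ∧ ∀ (l : ℕ) (p : Sph),
    |harm l h p| ≤ C * (1 / ((l : ℝ) + 1) ^ 2) := by
  let D : SmoothFun → SmoothFun := fun h => h - lap h
  refine ⟨200 * ‖toL2 (D (D (D h)))‖, by positivity, fun l p => ?_⟩
  have hl := lam_nonneg l
  have h1 : harm l (D (D (D h))) = ((lam l + 1) ^ 3) • harm l h := by
    simp only [D, harm_sub_lap, smul_smul]
    congr 1
    ring
  have h2 := norm_toL2_harm_le l (D (D (D h)))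
  rw [h1, ← toL2L_apply, map_smul, norm_smul, toL2L_apply, Real.norm_eq_abs,
    abs_of_nonneg (by positivity)] at h2
  refine (sup_bound (harm_mem l h) p).trans ?_
  have h3 : ((l : ℝ) + 1) ^ 2 ≤ 2 * (lam l + 1) := by
    unfold lam
    nlinarith [sq_nonneg (l : ℝ), (Nat.cast_nonneg l : (0 : ℝ) ≤ l)]
  have h4 : (0 : ℝ) < ((l : ℝ) + 1) ^ 2 := by positivity
  rw [mul_one_div, le_div_iff₀ h4]
  calc 100 * (lam l + 1) ^ 2 * ‖toL2 (harm l h)‖ * ((l : ℝ) + 1) ^ 2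
      ≤ 100 * (lam l + 1) ^ 2 * ‖toL2 (harm l h)‖ * (2 * (lam l + 1)) := by gcongr
    _ = 200 * ((lam l + 1) ^ 3 * ‖toL2 (harm l h)‖) := by ring
    _ ≤ _ := by gcongr

/-! ### The operators `(-Δ)⁻ᵏ exp (τ (-Δ)⁻¹)` on functions of mean zero -/

/-- The multiplier of `(-Δ)⁻ᵏ` on functions of mean zero. -/
def invPow (k l : ℕ) : ℝ := if l = 0 then 0 else (lam l)⁻¹ ^ k

theorem lam_inv_le (l : ℕ) : (lam l)⁻¹ ≤ 1 := by
  rcases Nat.eq_zero_or_pos l with rfl | hl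
  · simp [lam]
  · have : (1 : ℝ) ≤ l := by exact_mod_cast hl
    exact inv_le_one_of_one_le₀ (by unfold lam; nlinarith)

theorem lam_inv_nonneg (l : ℕ) : 0 ≤ (lam l)⁻¹ := inv_nonneg.2 (lam_nonneg l)

theorem abs_invPow_le (k l : ℕ) : |invPow k l| ≤ 1 := by
  unfold invPow
  split_ifs
  · simp
  · rw [abs_of_nonneg (pow_nonneg (lam_inv_nonneg l) k)]
    exact pow_le_one₀ (lam_inv_nonneg l) (lam_inv_le l)

theorem invPow_succ (k l : ℕ) : invPow (k + 1) l = (lam l)⁻¹ * invPow k l := by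
  unfold invPow
  split_ifs
  · simp
  · rw [pow_succ']

/-- At l = 0, k = 0 this holds only because `invPow` is set to zero on constants; the bare power
would give 1. -/
theorem lam_mul_invPow_succ (k l : ℕ) : lam l * invPow (k + 1) l = invPow k l := by
  unfold invPow
  split_ifs with h
  · simp
  · rw [pow_succ', ← mul_assoc, mul_inv_cancel₀ (lam_pos h).ne', one_mul]

/-- The multiplier of `(-Δ)⁻ᵏ exp (τ (-Δ)⁻¹)`. -/
def expCoeff (k : ℕ) (τ : ℝ) (l : ℕ) : ℝ := invPow k l * Real.exp (τ * (lam l)⁻¹)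

theorem abs_expCoeff_le (k : ℕ) (τ : ℝ) (l : ℕ) : |expCoeff k τ l| ≤ Real.exp |τ| := by
  unfold expCoeff
  rw [abs_mul, Real.abs_exp]
  have h1 : τ * (lam l)⁻¹ ≤ |τ| := by
    calc τ * (lam l)⁻¹ ≤ |τ| * (lam l)⁻¹ :=
          mul_le_mul_of_nonneg_right (le_abs_self τ) (lam_inv_nonneg l)
      _ ≤ |τ| * 1 := by gcongr; exact lam_inv_le l
      _ = |τ| := mul_one _
  calc |invPow k l| * Real.exp (τ * (lam l)⁻¹) ≤ 1 * Real.exp |τ| := by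
        gcongr
        exact abs_invPow_le k l
    _ = _ := one_mul _

/-- Differentiation in τ only raises k, so the coefficients form a family closed under ∂_τ. -/
theorem hasDerivAt_expCoeff (k : ℕ) (τ : ℝ) (l : ℕ) :
    HasDerivAt (fun τ => expCoeff k τ l) (expCoeff (k + 1) τ l) τ := by
  have := ((hasDerivAt_id τ).mul_const (lam l)⁻¹).exp.const_mul (invPow k l)
  convert! this using 1
  simp [expCoeff, invPow_succ]
  ring

/-- The series `∑ₗ expCoeff k τ l gₗ`, extended to the punctured space. -/
def expSeries (k : ℕ) (g : SmoothFun) (x : ℝ × E3) : ℝ :=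
  ∑' l, expCoeff k x.1 l * ext (harm l g) x.2

theorem summable_inv_sq : Summable fun l : ℕ => 1 / ((l : ℝ) + 1) ^ 2 := by
  have := (summable_nat_add_iff 1).2 (Real.summable_one_div_nat_pow.2 (one_lt_two))
  simpa using this

/-- The constant depends on g alone, and the majorant is locally uniform in τ. The same Weierstrass
bound thus serves the series and its derivatives. -/
theorem expSeries_bound (g : SmoothFun) : ∃ C, 0 ≤ C ∧ ∀ (k l : ℕ) (τ : ℝ) (x : E3),
    |expCoeff k τ l * ext (harm l g) x| ≤ Real.exp |τ| * C * (1 / ((l : ℝ) + 1) ^ 2) := by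
  obtain ⟨C, hC, h⟩ := harm_bound g
  refine ⟨C, hC, fun k l τ x => ?_⟩
  rw [abs_mul, mul_assoc]
  exact mul_le_mul (abs_expCoeff_le k τ l) (h l (nrm x)) (abs_nonneg _) (Real.exp_pos _).le

theorem summable_expSeries (k : ℕ) (g : SmoothFun) (x : ℝ × E3) :
    Summable fun l => expCoeff k x.1 l * ext (harm l g) x.2 := by
  obtain ⟨C, hC, h⟩ := expSeries_bound g
  exact Summable.of_norm_bounded (summable_inv_sq.mul_left _) fun l => h k l x.1 x.2

/-- The one-forms dual to the rotation fields. -/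
def rotForm (i : Fin 3) (x : E3) : E3 →L[ℝ] ℝ := (inner ℝ x x)⁻¹ • innerSL ℝ (rot i x)

theorem contDiffOn_rotForm (i : Fin 3) : ContDiffOn ℝ ∞ (rotForm i) {0}ᶜ := by
  refine ContDiffOn.smul (ContDiffOn.inv (contDiff_id.inner ℝ contDiff_id).contDiffOn ?_) ?_
  · intro x hx
    simpa using hx
  · exact ((innerSL ℝ (E := E3)).contDiff.comp (rotL i).contDiff).contDiffOn

theorem norm_rotForm_le (i : Fin 3) {x : E3} (hx : x ≠ 0) : ‖rotForm i x‖ ≤ ‖rotL i‖ / ‖x‖ := by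
  have hx0 : 0 < ‖x‖ := norm_pos_iff.2 hx
  rw [rotForm, norm_smul, innerSL_apply_norm, real_inner_self_eq_norm_sq, Real.norm_eq_abs, abs_inv,
    abs_of_pos (by positivity)]
  have := (rotL i).le_opNorm x
  rw [rotL_apply] at this
  calc (‖x‖ ^ 2)⁻¹ * ‖rot i x‖ ≤ (‖x‖ ^ 2)⁻¹ * (‖rotL i‖ * ‖x‖) := by gcongr
    _ = _ := by field_simp

/-- The derivative of the terms of `expSeries`. -/
def expTermDeriv (k : ℕ) (g : SmoothFun) (l : ℕ) (x : ℝ × E3) : ℝ × E3 →L[ℝ] ℝ :=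
  (expCoeff (k + 1) x.1 l * ext (harm l g) x.2) • ContinuousLinearMap.fst ℝ ℝ E3 +
    ∑ i, (expCoeff k x.1 l * ext (harm l (rotD i g)) x.2) •
      (rotForm i x.2 ∘L ContinuousLinearMap.snd ℝ ℝ E3)

theorem hasFDerivAt_expTerm (k : ℕ) (g : SmoothFun) (l : ℕ) {x : ℝ × E3} (hx : x.2 ≠ 0) :
    HasFDerivAt (fun x : ℝ × E3 => expCoeff k x.1 l * ext (harm l g) x.2)
      (expTermDeriv k g l x) x := by
  have h1 := (hasDerivAt_expCoeff k x.1 l).comp_hasFDerivAt x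
    (hasFDerivAt_fst (𝕜 := ℝ) (E := ℝ) (F := E3) (p := x))
  have h2 := ((contDiffAt_ext (harm l g).contMDiff hx).differentiableAt
    (by simp)).hasFDerivAt.comp x (hasFDerivAt_snd (𝕜 := ℝ) (E := ℝ) (F := E3) (p := x))
  convert! h1.mul h2 using 1
  refine ContinuousLinearMap.ext fun v => ?_
  simp only [expTermDeriv, harm_rotD, add_apply, smul_apply, sum_apply, smul_eq_mul,
    ContinuousLinearMap.comp_apply, ContinuousLinearMap.coe_fst', ContinuousLinearMap.coe_snd',
    Function.comp_apply]
  rw [fderiv_ext_eq (harm l g) hx, Finset.mul_sum, add_comm]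
  congr 1
  · refine Finset.sum_congr rfl fun i _ => ?_
    simp [rotForm]
    ring
  · ring

/-- Termwise differentiation. Because `harm` commutes with rotations, the derivative is again built
from series of the same kind, with k raised for the τ direction and g replaced by its rotational
derivatives for the spatial ones. -/
theorem hasFDerivAt_expSeries (k : ℕ) (g : SmoothFun) {x : ℝ × E3} (hx : x.2 ≠ 0) :
    HasFDerivAt (expSeries k g) (expSeries (k + 1) g x • ContinuousLinearMap.fst ℝ ℝ E3 +
      ∑ i, expSeries k (rotD i g) x • (rotForm i x.2 ∘L ContinuousLinearMap.snd ℝ ℝ E3)) x := by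
  have hx0 : 0 < ‖x.2‖ := norm_pos_iff.2 hx
  -- On this product of balls τ is bounded and the spatial variable stays away from the origin, so
  -- the one-forms dual to the rotations are uniformly bounded.
  set s : Set (ℝ × E3) := Metric.ball x.1 1 ×ˢ Metric.ball x.2 (‖x.2‖ / 2) with hs
  have hso : IsOpen s := Metric.isOpen_ball.prod Metric.isOpen_ball
  have hsc : IsPreconnected s :=
    ((convex_ball x.1 1).prod (convex_ball x.2 (‖x.2‖ / 2))).isPreconnected
  have hxs : x ∈ s := ⟨Metric.mem_ball_self one_pos, Metric.mem_ball_self (by positivity)⟩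
  have hs2 : ∀ y ∈ s, ‖x.2‖ / 2 ≤ ‖y.2‖ := by
    intro y hy
    have h2 : ‖y.2 - x.2‖ < ‖x.2‖ / 2 := by rw [← dist_eq_norm]; exact hy.2
    have h3 := norm_sub_norm_le x.2 y.2
    rw [norm_sub_rev] at h3
    linarith
  have hs1 : ∀ y ∈ s, Real.exp |y.1| ≤ Real.exp (|x.1| + 1) := by
    intro y hy
    have h2 : |y.1 - x.1| < 1 := hy.1
    have h3 := abs_sub_abs_le_abs_sub y.1 x.1
    exact Real.exp_le_exp.2 (by linarith)
  obtain ⟨C, hC, hCb⟩ := expSeries_bound g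
  choose D hD hDb using fun i => expSeries_bound (rotD i g)
  set R := Real.exp (|x.1| + 1)
  set u : ℕ → ℝ := fun l => (R * C + ∑ i, R * D i * (‖rotL i‖ / (‖x.2‖ / 2))) *
    (1 / ((l : ℝ) + 1) ^ 2) with hu
  have key := hasFDerivAt_tsum_of_isPreconnected (f := fun l (x : ℝ × E3) =>
    expCoeff k x.1 l * ext (harm l g) x.2) (f' := expTermDeriv k g) (u := u)
    (summable_inv_sq.mul_left _) hso hsc (fun l y hy => by
      have hy0 : y.2 ≠ 0 := norm_pos_iff.1 (by linarith [hs2 y hy])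
      exact hasFDerivAt_expTerm k g l hy0) (fun l y hy => by
      have hy0 : y.2 ≠ 0 := norm_pos_iff.1 (by linarith [hs2 y hy])
      have e0 : ∀ i, ‖rotForm i y.2 ∘L ContinuousLinearMap.snd ℝ ℝ E3‖ ≤
          ‖rotL i‖ / (‖x.2‖ / 2) := by
        intro i
        calc _ ≤ ‖rotForm i y.2‖ * ‖ContinuousLinearMap.snd ℝ ℝ E3‖ :=
              ContinuousLinearMap.opNorm_comp_le _ _
          _ ≤ ‖rotForm i y.2‖ * 1 := by gcongr; exact ContinuousLinearMap.norm_snd_le ..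
          _ ≤ ‖rotL i‖ / ‖y.2‖ := by rw [mul_one]; exact norm_rotForm_le i hy0
          _ ≤ _ := by gcongr; exact hs2 y hy
      have e1 : ‖(expCoeff (k + 1) y.1 l * ext (harm l g) y.2) • ContinuousLinearMap.fst ℝ ℝ E3‖ ≤
          R * C * (1 / ((l : ℝ) + 1) ^ 2) := by
        rw [norm_smul]
        calc _ ≤ (Real.exp |y.1| * C * (1 / ((l : ℝ) + 1) ^ 2)) * 1 := by
              gcongr
              · exact hCb _ _ _ _
              · exact ContinuousLinearMap.norm_fst_le ..
          _ ≤ _ := by rw [mul_one]; gcongr; exact hs1 y hy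
      have e2 : ∀ i, ‖(expCoeff k y.1 l * ext (harm l (rotD i g)) y.2) •
          (rotForm i y.2 ∘L ContinuousLinearMap.snd ℝ ℝ E3)‖ ≤
          R * D i * (‖rotL i‖ / (‖x.2‖ / 2)) * (1 / ((l : ℝ) + 1) ^ 2) := by
        intro i
        have hDi := hD i
        rw [norm_smul]
        calc _ ≤ (Real.exp |y.1| * D i * (1 / ((l : ℝ) + 1) ^ 2)) * (‖rotL i‖ / (‖x.2‖ / 2)) := by
              gcongr
              · exact hDb _ _ _ _ _
              · exact e0 i
          _ ≤ (R * D i * (1 / ((l : ℝ) + 1) ^ 2)) * (‖rotL i‖ / (‖x.2‖ / 2)) := by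
              gcongr; exact hs1 y hy
          _ = _ := by ring
      calc ‖expTermDeriv k g l y‖ ≤ _ := norm_add_le _ _
        _ ≤ R * C * (1 / ((l : ℝ) + 1) ^ 2) +
            ∑ i, R * D i * (‖rotL i‖ / (‖x.2‖ / 2)) * (1 / ((l : ℝ) + 1) ^ 2) :=
          add_le_add e1 ((norm_sum_le _ _).trans (Finset.sum_le_sum fun i _ => e2 i))
        _ = u l := by rw [hu]; simp only [add_mul, Finset.sum_mul])
    hxs (summable_expSeries k g x) hxs
  have hsum : HasSum (fun l => expTermDeriv k g l x)
      (expSeries (k + 1) g x • ContinuousLinearMap.fst ℝ ℝ E3 +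
      ∑ i, expSeries k (rotD i g) x • (rotForm i x.2 ∘L ContinuousLinearMap.snd ℝ ℝ E3)) := by
    refine ((summable_expSeries (k + 1) g x).hasSum.smul_const _).add (hasSum_sum fun i _ => ?_)
    exact (summable_expSeries k (rotD i g) x).hasSum.smul_const _
  rw [hsum.tsum_eq] at key
  exact key

/-- Induction on the order, for all k and g at once, since the derivative formula leads to other
members of the family. -/
theorem contDiffOn_expSeries_nat (n : ℕ) (k : ℕ) (g : SmoothFun) :
    ContDiffOn ℝ n (expSeries k g) (Set.univ ×ˢ {0}ᶜ) := by
  have ho : IsOpen ((Set.univ : Set ℝ) ×ˢ ({0}ᶜ : Set E3)) := isOpen_univ.prod isOpen_compl_singleton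
  induction n generalizing k g with
  | zero =>
    rw [Nat.cast_zero, contDiffOn_zero]
    exact fun x hx => (hasFDerivAt_expSeries k g hx.2).continuousAt.continuousWithinAt
  | succ n ih =>
    rw [Nat.cast_succ, contDiffOn_succ_iff_fderiv_of_isOpen ho]
    refine ⟨fun x hx => (hasFDerivAt_expSeries k g hx.2).differentiableAt.differentiableWithinAt,
      by simp, ?_⟩
    refine ContDiffOn.congr (f := fun x => expSeries (k + 1) g x • ContinuousLinearMap.fst ℝ ℝ E3 +
      ∑ i, expSeries k (rotD i g) x • (rotForm i x.2 ∘L ContinuousLinearMap.snd ℝ ℝ E3)) ?_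
      fun x hx => (hasFDerivAt_expSeries k g hx.2).fderiv
    refine ((ih (k + 1) g).smul contDiffOn_const).add (ContDiffOn.sum fun i _ => ?_)
    refine (ih k (rotD i g)).smul ?_
    have h1 : ContDiffOn ℝ n (fun x : ℝ × E3 => rotForm i x.2) (Set.univ ×ˢ {0}ᶜ) :=
      ((contDiffOn_rotForm i).of_le (by exact_mod_cast le_top)).comp contDiff_snd.contDiffOn
        fun x hx => hx.2
    exact h1.clm_comp contDiffOn_const

theorem contDiffOn_expSeries (k : ℕ) (g : SmoothFun) :
    ContDiffOn ℝ ∞ (expSeries k g) (Set.univ ×ˢ {0}ᶜ) :=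
  contDiffOn_infty.2 fun n => contDiffOn_expSeries_nat n k g

/-- The operator `(-Δ)⁻ᵏ exp (τ (-Δ)⁻¹)` on functions of mean zero, extended by zero to
constants. -/
def expOp (k : ℕ) (τ : ℝ) : SmoothFun →ₗ[ℝ] SmoothFun where
  toFun g := ⟨fun p => expSeries k g (τ, p), by
    refine contMDiff_restrict (Ψ := fun x => expSeries k g (τ, x)) ?_
    exact (contDiffOn_expSeries k g).comp (contDiff_const.prodMk contDiff_id).contDiffOn
      fun x hx => ⟨Set.mem_univ _, hx⟩⟩
  map_add' g g' := by
    ext p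
    change expSeries k (g + g') (τ, p) = expSeries k g (τ, p) + expSeries k g' (τ, p)
    rw [expSeries, expSeries, expSeries,
      ← (summable_expSeries k g (τ, p)).tsum_add (summable_expSeries k g' (τ, p))]
    refine tsum_congr fun l => ?_
    simp [mul_add]
  map_smul' c g := by
    ext p
    change expSeries k (c • g) (τ, p) = c * expSeries k g (τ, p)
    rw [expSeries, expSeries, ← tsum_mul_left]
    refine tsum_congr fun l => ?_
    simp [mul_left_comm]

theorem expOp_apply (k : ℕ) (τ : ℝ) (g : SmoothFun) (p : Sph) :
    expOp k τ g p = expSeries k g (τ, p) := rfl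

/-- The series converges uniformly on the sphere, hence in L², where the harmonic components of a
sum can be read off. -/
theorem harm_expOp (k : ℕ) (τ : ℝ) (g : SmoothFun) (l : ℕ) :
    harm l (expOp k τ g) = expCoeff k τ l • harm l g := by
  obtain ⟨C, hC, hb⟩ := expSeries_bound g
  have hs : Summable fun l => toCM (expCoeff k τ l • harm l g) := by
    refine Summable.of_norm_bounded (summable_inv_sq.mul_left (Real.exp |τ| * C)) fun l => ?_
    rw [ContinuousMap.norm_le _ (by positivity)]
    intro p
    have := hb k l τ p
    rwa [ext_sphere] at this
  have h1 : ∑' l, toCM (expCoeff k τ l • harm l g) = toCM (expOp k τ g) := by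
    ext p
    rw [← ContinuousMap.tsum_apply hs p]
    change _ = expSeries k g (τ, p)
    rw [expSeries]
    refine tsum_congr fun l => ?_
    rw [ext_sphere]
    rfl
  have h2 := hs.hasSum
  rw [h1] at h2
  have h3 := h2.mapL (ContinuousMap.toLp 2 surf ℝ)
  have h4 := proj_of_hasSum (w := fun l => toL2 (expCoeff k τ l • harm l g)) (fun l =>
    toL2_mem_HL ((Harm l).smul_mem _ (harm_mem l g))) h3 l
  apply toL2_injective
  rw [toL2_harm]
  exact h4

theorem lap_expOp_succ (k : ℕ) (τ : ℝ) (g : SmoothFun) :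
    lap (expOp (k + 1) τ g) = -expOp k τ g := by
  refine ext_harm fun l => ?_
  rw [harm_lap, harm_expOp, map_neg, harm_expOp, smul_smul, ← neg_smul]
  congr 1
  rw [expCoeff, expCoeff, ← lam_mul_invPow_succ k]
  ring

theorem lap_expOp (k : ℕ) (τ : ℝ) (g : SmoothFun) : lap (expOp k τ g) = expOp k τ (lap g) := by
  refine ext_harm fun l => ?_
  rw [harm_lap, harm_expOp, harm_expOp, harm_lap, smul_smul, smul_smul, mul_comm]

/-- At k = 0, τ = 0 the operator merely removes the mean, and a Laplacian has none. -/
theorem expOp_zero_zero_lap (g : SmoothFun) : expOp 0 0 (lap g) = lap g := by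
  refine ext_harm fun l => ?_
  rw [harm_expOp, harm_lap, smul_smul]
  congr 1
  rcases eq_or_ne l 0 with rfl | hl <;> simp [expCoeff, invPow, lam, *]

theorem hasDerivAt_expOp (k : ℕ) (τ : ℝ) (g : SmoothFun) (p : Sph) :
    HasDerivAt (fun τ => expOp k τ g p) (expOp (k + 1) τ g p) τ := by
  have h := (hasFDerivAt_expSeries k g (x := (τ, (p : E3))) (sphere_ne_zero p)).comp_hasDerivAt τ
    ((hasDerivAt_id τ).prodMk (hasDerivAt_const τ (p : E3)))
  convert! h using 1
  simp [expOp_apply]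

/-! ### Diagonal operators are self-adjoint -/

section Diagonal

variable {H : Type*} [NormedAddCommGroup H] [InnerProductSpace ℝ H] [CompleteSpace H]

/-- An operator that acts by a scalar on each of the ranges of a complete family of orthogonal
projections is self-adjoint on its maximal domain. -/
theorem isSelfAdjoint_diagonal (P : ℕ → H →L[ℝ] H) (m : ℕ → ℝ)
    (hsymm : ∀ l f g, inner ℝ (P l f) g = inner ℝ f (P l g))
    (horth : ∀ l k f, P l (P k f) = if l = k then P l f else 0)
    (hsum : ∀ f, HasSum (fun l => P l f) f) (G : Submodule ℝ (H × H))
    (hG : ∀ x, x ∈ G ↔ ∀ l, P l x.2 = m l • P l x.1) : IsSelfAdjoint G.toLinearPMap := by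
  -- These elements of the graph make the domain dense and are the vectors on which the adjoint
  -- relation is tested to recover the coefficient condition.
  have hmem : ∀ l f, (P l f, m l • P l f) ∈ G := fun l f => (hG _).2 fun k => by
    rw [map_smul, horth]
    split_ifs with h
    · rw [h]
    · rw [smul_zero, smul_zero]
  have hinner : ∀ f g, HasSum (fun l => inner ℝ (P l f) (P l g)) (inner ℝ f g) := fun f g => by
    have h := (hsum f).mapL ((innerSL ℝ (E := H)) g)
    convert! h using 1
    · ext l
      rw [innerSL_apply_apply, ← hsymm, horth, if_pos rfl, real_inner_comm]
    · rw [innerSL_apply_apply, real_inner_comm]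
  have hgr : G.toLinearPMap.graph = G := by
    refine Submodule.toLinearPMap_graph_eq G fun x hx hx0 => ?_
    have h := hsum x.2
    simp only [(hG x).1 hx, hx0, map_zero, smul_zero] at h
    exact h.unique hasSum_zero
  have hdense : Dense (G.toLinearPMap.domain : Set H) := by
    intro f
    refine mem_closure_of_tendsto (hsum f) (Filter.Eventually.of_forall fun s => ?_)
    refine Submodule.sum_mem _ fun l _ => ?_
    exact ⟨_, hmem l f, rfl⟩
  rw [LinearPMap.isSelfAdjoint_def]
  apply LinearPMap.eq_of_eq_graph
  rw [LinearPMap.adjoint_graph_eq_graph_adjoint hdense, hgr]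
  ext x
  rw [Submodule.mem_adjoint_iff, hG]
  constructor
  · intro h l
    refine ext_inner_left ℝ fun f => ?_
    have := h _ _ (hmem l f)
    rw [inner_smul_left, hsymm, hsymm] at this
    rw [inner_smul_right]
    simp only [conj_trivial] at this
    linarith
  -- Conversely, both scalar products expand into series over l whose terms agree, as m l is real
  -- and can be moved across.
  · intro h a b hab
    have h1 := hinner b x.1
    have h2 := hinner a x.2
    simp only [h, (hG _).1 hab] at h1 h2
    rw [sub_eq_zero]
    refine h1.unique ?_
    convert! h2 using 2
    rw [inner_smul_left, inner_smul_right]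
    rfl

end Diagonal

/-! ### Weak derivatives and harmonic components -/

/-- Harmonics are restrictions of polynomials, which are admissible test functions. -/
theorem IsWeakDeriv.inner_harm {i : Fin 3} {f g : L2} (h : IsWeakDeriv i f g) {l : ℕ}
    {Y : SmoothFun} (hY : Y ∈ Harm l) :
    inner ℝ f (toL2 (rotD i Y)) = -inner ℝ g (toL2 Y) := by
  obtain ⟨P, -, -, rfl⟩ := mem_Harm.1 hY
  rw [inner_toL2_right, inner_toL2_right]
  refine Eq.trans ?_ (h (evE P) (contDiff_evE P))
  refine integral_congr_ae (Filter.Eventually.of_forall fun p => ?_)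
  exact congrArg (f p * ·) (hasFDerivAt_ext_restrict (contDiff_evE P) i p)

theorem isWeakDeriv_of_inner {i : Fin 3} {f g : L2}
    (h : ∀ k : SmoothFun, inner ℝ f (toL2 (rotD i k)) = -inner ℝ g (toL2 k)) :
    IsWeakDeriv i f g := by
  intro Ψ hΨ
  have := h (restrict Ψ hΨ)
  rw [inner_toL2_right, inner_toL2_right] at this
  refine Eq.trans ?_ this
  refine integral_congr_ae (Filter.Eventually.of_forall fun p => ?_)
  exact congrArg (f p * ·) (hasFDerivAt_ext_restrict hΨ i p).symm

/-- Pairing with a fixed test function is continuous in L², so classical integration by parts on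
each term passes to the sum. -/
theorem isWeakDeriv_of_hasSum {i : Fin 3} {Y : ℕ → SmoothFun} {f g : L2}
    (hf : HasSum (fun l => toL2 (Y l)) f) (hg : HasSum (fun l => toL2 (rotD i (Y l))) g) :
    IsWeakDeriv i f g := by
  refine isWeakDeriv_of_inner fun k => ?_
  have h1 := hf.mapL ((innerSL ℝ (E := L2)) (toL2 (rotD i k)))
  have h2 := hg.mapL ((innerSL ℝ (E := L2)) (toL2 k))
  simp only [innerSL_apply_apply] at h1 h2
  rw [real_inner_comm, real_inner_comm (toL2 k)]
  refine h1.unique ?_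
  convert! h2.neg using 2
  rw [real_inner_comm, real_inner_comm _ (toL2 k), inner_toL2_rotD, neg_neg]

theorem inner_proj_harm {l : ℕ} (f : L2) {Y : SmoothFun} (hY : Y ∈ Harm l) :
    inner ℝ (proj l f) (toL2 Y) = inner ℝ f (toL2 Y) := by
  rw [inner_proj_left, proj_of_mem (toL2_mem_HL hY)]

theorem eq_of_inner_harm {l : ℕ} {f g : L2} (hf : f ∈ HL l) (hg : g ∈ HL l)
    (h : ∀ Y ∈ Harm l, inner ℝ f (toL2 Y) = inner ℝ g (toL2 Y)) : f = g := by
  obtain ⟨Z, hZ, hZe⟩ := (HL l).sub_mem hf hg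
  have := h Z hZ
  rw [← sub_eq_zero, ← inner_sub_left, ← toL2L_apply, hZe, inner_self_eq_zero] at this
  exact sub_eq_zero.1 this

theorem eq_zero_of_inner_harm {f : L2} (h : ∀ l, ∀ Y ∈ Harm l, inner ℝ f (toL2 Y) = 0) : f = 0 := by
  refine ext_proj fun l => ?_
  rw [map_zero]
  refine eq_of_inner_harm (proj_mem l f) (HL l).zero_mem fun Y hY => ?_
  rw [inner_proj_harm f hY, h l Y hY, inner_zero_left]

theorem sum_norm_rotD_sq {l : ℕ} {Y : SmoothFun} (hY : Y ∈ Harm l) :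
    ∑ i, ‖toL2 (rotD i Y)‖ ^ 2 = lam l * ‖toL2 Y‖ ^ 2 := by
  have h1 : ∀ i, ‖toL2 (rotD i Y)‖ ^ 2 = -inner ℝ (toL2 Y) (toL2 (rotD i (rotD i Y))) := fun i => by
    rw [← real_inner_self_eq_norm_sq, inner_toL2_rotD]
  have h2 : ∑ i, toL2 (rotD i (rotD i Y)) = (-lam l) • toL2 Y := by
    rw [← toL2L_apply Y, ← map_smul, ← lap_of_mem_Harm hY, lap_eq, map_sum]
    rfl
  simp only [h1]
  rw [Finset.sum_neg_distrib, ← inner_sum, h2, inner_smul_right, real_inner_self_eq_norm_sq]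
  ring

theorem norm_rotD_sq_le {l : ℕ} {Y : SmoothFun} (hY : Y ∈ Harm l) (i : Fin 3) :
    ‖toL2 (rotD i Y)‖ ^ 2 ≤ lam l * ‖toL2 Y‖ ^ 2 := by
  rw [← sum_norm_rotD_sq hY]
  exact Finset.single_le_sum (f := fun i => ‖toL2 (rotD i Y)‖ ^ 2) (fun _ _ => by positivity)
    (Finset.mem_univ i)

/-! ### The Sobolev space -/

/-- Weak derivatives are determined by the function, since their pairings with all harmonics are.
The stored jet therefore carries no extra information. -/
theorem incl_injective : Function.Injective incl := by
  rw [← LinearMap.ker_eq_bot, LinearMap.ker_eq_bot']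
  rintro ⟨w, hw1, hw2⟩ (h0 : w (Sum.inl ()) = 0)
  have h1 : ∀ i, w (Sum.inr (Sum.inl i)) = 0 := fun i => eq_zero_of_inner_harm fun l Y hY => by
    have := (hw1 i).inner_harm hY
    rw [h0, inner_zero_left] at this
    linarith
  have h2 : ∀ i j, w (Sum.inr (Sum.inr (i, j))) = 0 := fun i j =>
    eq_zero_of_inner_harm fun l Y hY => by
      have := (hw2 i j).inner_harm hY
      rw [h1, inner_zero_left] at this
      linarith
  ext1
  refine PiLp.ext fun a => ?_
  rcases a with u | i | ⟨i, j⟩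
  exacts [h0, h1 i, h2 i j]

/-- A function whose harmonic components decay is in the Sobolev space. -/
theorem exists_incl_eq {f : L2} (hf : Summable fun l => lam l ^ 2 * ‖proj l f‖ ^ 2) :
    ∃ w : H2, incl w = f := by
  choose Y hY hYe using fun l => proj_mem l f
  have hYe' : ∀ l, toL2 (Y l) = proj l f := hYe
  have hs0 : HasSum (fun l => toL2 (Y l)) f := by
    simpa only [hYe'] using hasSum_proj f
  -- First derivatives cost one factor λ, and λ ≤ λ² + 1.
  have hsum1 : ∀ i, Summable fun l => ‖toL2 (rotD i (Y l))‖ ^ 2 := fun i => by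
    refine Summable.of_nonneg_of_le (fun l => by positivity) (fun l => ?_)
      (hf.add (hasSum_norm_proj f).summable)
    refine (norm_rotD_sq_le (hY l) i).trans ?_
    rw [hYe']
    nlinarith [sq_nonneg (lam l - 1), sq_nonneg ‖proj l f‖,
      mul_nonneg (sq_nonneg (lam l - 1)) (sq_nonneg ‖proj l f‖),
      mul_nonneg (lam_nonneg l) (sq_nonneg ‖proj l f‖)]
  have hsum2 : ∀ i j, Summable fun l => ‖toL2 (rotD j (rotD i (Y l)))‖ ^ 2 := fun i j => by
    refine Summable.of_nonneg_of_le (fun l => by positivity) (fun l => ?_) hf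
    refine (norm_rotD_sq_le (rotD_mem_Harm i (hY l)) j).trans ?_
    rw [sq (lam l), mul_assoc, ← hYe']
    exact mul_le_mul_of_nonneg_left (norm_rotD_sq_le (hY l) i) (lam_nonneg l)
  choose w1 hw1 using fun i => exists_hasSum
    (fun l => toL2_mem_HL (rotD_mem_Harm i (hY l))) (hsum1 i)
  choose w2 hw2 using fun i j => exists_hasSum
    (fun l => toL2_mem_HL (rotD_mem_Harm j (rotD_mem_Harm i (hY l)))) (hsum2 i j)
  refine ⟨⟨WithLp.toLp 2 (Sum.elim (fun _ => f) (Sum.elim w1 fun x => w2 x.1 x.2)),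
    fun i => isWeakDeriv_of_hasSum hs0 (hw1 i), fun i j => isWeakDeriv_of_hasSum (hw1 i) (hw2 i j)⟩,
    rfl⟩

/-- The Laplacian of an element of the Sobolev space. -/
def lapH2 : H2 →L[ℝ] L2 :=
  (∑ i : Fin 3, PiLp.proj (𝕜 := ℝ) 2 (fun _ : Jet => L2) (Sum.inr (Sum.inr (i, i)))) ∘L H2.subtypeL

theorem lapH2_apply (w : H2) :
    lapH2 w = ∑ i : Fin 3, (w : PiLp 2 (fun _ : Jet => L2)) (Sum.inr (Sum.inr (i, i))) := by
  simp [lapH2, sum_apply]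

/-- Move two weak derivatives onto a harmonic of degree l, where the sum of second rotational
derivatives is multiplication by -λ. -/
theorem proj_lapH2 (w : H2) (l : ℕ) : proj l (lapH2 w) = (-lam l) • proj l (incl w) := by
  refine eq_of_inner_harm (proj_mem _ _) ((HL l).smul_mem _ (proj_mem _ _)) fun Y hY => ?_
  rw [inner_smul_left, inner_proj_harm _ hY, inner_proj_harm _ hY, lapH2_apply, sum_inner]
  have h : ∀ i : Fin 3, inner ℝ ((w : PiLp 2 (fun _ : Jet => L2)) (Sum.inr (Sum.inr (i, i))))
      (toL2 Y) = inner ℝ (incl w) (toL2 (rotD i (rotD i Y))) := fun i => by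
    have h1 := (w.2.2 i i).inner_harm hY
    have h2 := (w.2.1 i).inner_harm (rotD_mem_Harm i hY)
    rw [show incl w = (w : PiLp 2 (fun _ : Jet => L2)) (Sum.inl ()) from rfl]
    linarith
  simp only [h]
  rw [← inner_sum]
  have h2 : ∑ i, toL2 (rotD i (rotD i Y)) = (-lam l) • toL2 Y := by
    rw [← toL2L_apply Y, ← map_smul, ← lap_of_mem_Harm hY, lap_eq, map_sum]
    rfl
  rw [h2, inner_smul_right]
  rfl

/-! ### The span of the harmonics of degrees `0` and `1` -/

theorem V_eq : V = HL 0 ⊔ HL 1 := by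
  apply le_antisymm
  · refine Submodule.span_le.2 ?_
    rintro _ ⟨l, hl, Y, hY, rfl⟩
    interval_cases l
    · exact Submodule.mem_sup_left (toL2_mem_HL hY)
    · exact Submodule.mem_sup_right (toL2_mem_HL hY)
  · refine sup_le ?_ ?_
    · rintro _ ⟨Y, hY, rfl⟩
      exact Submodule.subset_span ⟨0, by simp, Y, hY, rfl⟩
    · rintro _ ⟨Y, hY, rfl⟩
      exact Submodule.subset_span ⟨1, le_rfl, Y, hY, rfl⟩

theorem HL_le_V {l : ℕ} (hl : l < 2) : HL l ≤ V := by
  rw [V_eq]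
  interval_cases l
  exacts [le_sup_left, le_sup_right]

theorem mem_V_iff {f : L2} : f ∈ V ↔ ∀ l, 2 ≤ l → proj l f = 0 := by
  constructor
  · intro h l hl
    rw [V_eq] at h
    obtain ⟨a, ha, b, hb, rfl⟩ := Submodule.mem_sup.1 h
    rw [map_add, proj_of_mem_ne (by omega) ha, proj_of_mem_ne (by omega) hb, add_zero]
  · intro h
    have h1 : HasSum (fun l => proj l f) (∑ l ∈ Finset.range 2, proj l f) :=
      hasSum_sum_of_ne_finset_zero fun l hl => h l (by rw [Finset.mem_range] at hl; omega)
    rw [(hasSum_proj f).unique h1]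
    exact Submodule.sum_mem _ fun l hl => HL_le_V (Finset.mem_range.1 hl) (proj_mem l f)

theorem mem_V_orthogonal_iff {f : L2} : f ∈ Vᗮ ↔ ∀ l, l < 2 → proj l f = 0 := by
  constructor
  · intro h l hl
    refine (Submodule.starProjection_apply_eq_zero_iff (HL l)).2 ?_
    exact Submodule.orthogonal_le (HL_le_V hl) h
  · intro h
    rw [V_eq, ← Submodule.inf_orthogonal]
    exact ⟨(Submodule.starProjection_apply_eq_zero_iff _).1 (h 0 (by simp)),
      (Submodule.starProjection_apply_eq_zero_iff _).1 (h 1 (by simp))⟩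

/-- A basis is 1 and the three coordinates. Evaluation at the points ±e_k gives linear independence,
and Euler's identity shows that a homogeneous polynomial of degree one is a combination of the
coordinates. -/
theorem finrank_V : Module.finrank ℝ V = 4 := by
  let b : Fin 4 → SmoothFun := fun i => polyFun
    (![1, MvPolynomial.X 0, MvPolynomial.X 1, MvPolynomial.X 2] i)
  have hli : LinearIndependent ℝ (fun i => toL2L (b i)) := by
    have : LinearMap.ker toL2L = ⊥ := LinearMap.ker_eq_bot.2 toL2_injective
    refine LinearIndependent.map' (v := b) ?_ toL2L this
    rw [Fintype.linearIndependent_iff]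
    intro g hg
    have hev : ∀ p : Sph, g 0 + g 1 * (p : E3) 0 + g 2 * (p : E3) 1 + g 3 * (p : E3) 2 = 0 := by
      intro p
      have := DFunLike.congr_fun hg p
      simpa [Fin.sum_univ_four, b, polyFun_apply] using this
    have h1 : ∀ k : Fin 3, ∃ p : Sph, (p : E3) = EuclideanSpace.single k 1 := fun k =>
      ⟨⟨EuclideanSpace.single k 1, by simp⟩, rfl⟩
    have h2 : ∀ k : Fin 3, ∃ p : Sph, (p : E3) = EuclideanSpace.single k (-1) := fun k =>
      ⟨⟨EuclideanSpace.single k (-1), by simp⟩, rfl⟩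
    have e1 : ∀ k : Fin 3, _ := fun k => hev (h1 k).choose
    have e2 : ∀ k : Fin 3, _ := fun k => hev (h2 k).choose
    simp only [(h1 _).choose_spec, (h2 _).choose_spec] at e1 e2
    have a0 := e1 0
    have a1 := e1 1
    have a2 := e1 2
    have b0 := e2 0
    have b1 := e2 1
    have b2 := e2 2
    simp at a0 a1 a2 b0 b1 b2
    intro i
    fin_cases i <;> simp <;> linarith
  have hV : V = Submodule.span ℝ (Set.range fun i => toL2L (b i)) := by
    apply le_antisymm
    · refine Submodule.span_le.2 ?_
      rintro _ ⟨l, hl, Y, hY, rfl⟩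
      obtain ⟨P, hP, -, rfl⟩ := mem_Harm.1 hY
      have hconst : ∀ {Q : MvPolynomial (Fin 3) ℝ}, Q.IsHomogeneous 0 → ∃ a : ℝ,
          Q = MvPolynomial.C a := fun {Q} hQ =>
        ⟨_, MvPolynomial.totalDegree_eq_zero_iff_eq_C.1
          ((MvPolynomial.totalDegree_zero_iff_isHomogeneous _).2 hQ)⟩
      have hspan : ∀ i, toL2L (b i) ∈ Submodule.span ℝ (Set.range fun i => toL2L (b i)) :=
        fun i => Submodule.subset_span ⟨i, rfl⟩
      change toL2L (polyFun P) ∈ Submodule.span ℝ (Set.range fun i => toL2L (b i))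
      interval_cases l
      · obtain ⟨a, rfl⟩ := hconst hP
        rw [← mul_one (MvPolynomial.C a), ← MvPolynomial.smul_eq_C_mul, map_smul, map_smul]
        exact Submodule.smul_mem _ a (hspan 0)
      · have hE := hP.sum_X_mul_pderiv
        choose a ha using fun i => hconst (hP.pderiv (i := i))
        rw [one_smul] at hE
        rw [← hE, map_sum, map_sum]
        refine Submodule.sum_mem _ fun i _ => ?_
        rw [ha, mul_comm, ← MvPolynomial.smul_eq_C_mul, map_smul, map_smul]
        refine Submodule.smul_mem _ _ ?_
        fin_cases i
        exacts [hspan 1, hspan 2, hspan 3]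
    · refine Submodule.span_le.2 ?_
      rintro _ ⟨i, rfl⟩
      have hX : ∀ k : Fin 3, toL2L (polyFun (MvPolynomial.X k)) ∈ V := fun k => by
        refine HL_le_V (l := 1) (by simp) (toL2_mem_HL (mem_Harm.2 ⟨_, MvPolynomial.isHomogeneous_X ℝ k, ?_, rfl⟩))
        exact lapP_eq_zero (MvPolynomial.isHomogeneous_X ℝ k) (by simp)
      have h1 : toL2L (polyFun 1) ∈ V := by
        refine HL_le_V (l := 0) (by simp) (toL2_mem_HL (mem_Harm.2 ⟨_, MvPolynomial.isHomogeneous_one _ _, ?_, rfl⟩))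
        exact lapP_eq_zero (MvPolynomial.isHomogeneous_one _ _) (by simp)
      fin_cases i
      exacts [h1, hX 0, hX 1, hX 2]
  rw [hV, finrank_span_eq_card hli]
  simp

/-! ### Diagonal maps from the Sobolev space -/

/-- A diagonal operator of order two with kernel `V`, as a self-adjoint Fredholm map from `H²`
to `L²`. -/
theorem exists_diagonal_map {m : ℕ → ℝ} {C D : ℝ} (h01 : ∀ l, l < 2 → m l = 0)
    (hC : ∀ l, |m l| ≤ C * lam l) (hD : ∀ l, 2 ≤ l → lam l ≤ D * |m l|) :
    ∃ T : H2 →L[ℝ] L2,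
      (∀ f k : L2, (∀ l, proj l k = m l • proj l f) → ∃ w : H2, incl w = f ∧ T w = k) ∧
      IsSelfAdjoint (toOperator T) ∧
      Submodule.map incl (LinearMap.ker (T : H2 →ₗ[ℝ] L2)) = V ∧
      LinearMap.range (T : H2 →ₗ[ℝ] L2) = Vᗮ ∧
      Set.BijOn T {f : H2 | incl f ∈ Vᗮ} (Vᗮ : Submodule ℝ L2) ∧
      IsSelfAdjoint (toOperatorOn T Vᗮ) := by
  have hlam : ∀ l, 2 ≤ l → 6 ≤ lam l := fun l hl => by
    have : (2 : ℝ) ≤ l := by exact_mod_cast hl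
    unfold lam
    nlinarith
  have hC0 : 0 ≤ C := by
    have h := (abs_nonneg _).trans (hC 1)
    have := lam_pos (l := 1) (by simp)
    exact nonneg_of_mul_nonneg_left h this
  have hm : ∀ l, 2 ≤ l → m l ≠ 0 := fun l hl h => by
    have := hD l hl
    rw [h, abs_zero, mul_zero] at this
    linarith [hlam l hl]
  have hn : ∀ l, |-(m l / lam l)| ≤ C := fun l => by
    rw [abs_neg, abs_div, abs_of_nonneg (lam_nonneg l)]
    exact div_le_of_le_mul₀ (lam_nonneg l) hC0 (hC l)
  -- An order two operator is a bounded multiplier composed with the Laplacian. At l = 0 the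
  -- quotient is 0/0 = 0, which is harmless because m 0 = 0.
  set T : H2 →L[ℝ] L2 := mult (fun l => -(m l / lam l)) C hn ∘L lapH2 with hT
  have hproj : ∀ w l, proj l (T w) = m l • proj l (incl w) := fun w l => by
    rw [hT, ContinuousLinearMap.comp_apply, proj_mult, proj_lapH2, smul_smul]
    congr 1
    rcases Nat.eq_zero_or_pos l with rfl | hl
    · simp [h01]
    · have := (lam_pos hl.ne').ne'
      field_simp
  -- Elliptic regularity: if the coefficients m l · f_l are square summable, then the lower bound on
  -- |m l| for l ≥ 2 makes λ f_l square summable as well. For l < 2 one has λ² ≤ 4, whence the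
  -- factor 4.
  have hex : ∀ f k : L2, (∀ l, proj l k = m l • proj l f) → ∃ w : H2, incl w = f ∧ T w = k := by
    intro f k hfk
    obtain ⟨w, rfl⟩ : ∃ w : H2, incl w = f := by
      refine exists_incl_eq (Summable.of_nonneg_of_le (fun l => by positivity) (fun l => ?_)
        (((hasSum_norm_proj k).summable.mul_left (D ^ 2)).add
          ((hasSum_norm_proj f).summable.mul_left 4)))
      by_cases hl : 2 ≤ l
      · have h1 : lam l ^ 2 ≤ D ^ 2 * |m l| ^ 2 := by
          rw [← mul_pow]
          exact pow_le_pow_left₀ (lam_nonneg l) (hD l hl) 2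
        rw [hfk, norm_smul, mul_pow, Real.norm_eq_abs]
        have h2 := mul_le_mul_of_nonneg_right h1 (sq_nonneg ‖proj l f‖)
        have h3 := sq_nonneg ‖proj l f‖
        linarith
      · have h1 : lam l ^ 2 ≤ 4 := by
          interval_cases l <;> norm_num [lam]
        have h2 := mul_le_mul_of_nonneg_right h1 (sq_nonneg ‖proj l f‖)
        have h3 : 0 ≤ D ^ 2 * ‖proj l k‖ ^ 2 := by positivity
        linarith
    refine ⟨w, rfl, ext_proj fun l => ?_⟩
    rw [hproj, hfk]
  have hgraph : ∀ x : L2 × L2, x ∈ LinearMap.range (incl.prod (T : H2 →ₗ[ℝ] L2)) ↔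
      ∀ l, proj l x.2 = m l • proj l x.1 := fun x => by
    constructor
    · rintro ⟨w, rfl⟩ l
      exact hproj w l
    · intro h
      obtain ⟨w, h1, h2⟩ := hex x.1 x.2 h
      exact ⟨w, Prod.ext h1 h2⟩
  have horth : ∀ l k f, proj l (proj k f) = if l = k then proj l f else 0 := fun l k f => by
    split_ifs with h
    · rw [h, proj_of_mem (proj_mem k f)]
    · exact proj_of_mem_ne h (proj_mem k f)
  -- For l ≥ 2 this uses D |m l| ≥ λ ≥ 6. For l < 2 the inverse of zero is zero, so the multiplier
  -- inverts T on the complement of `V` and annihilates `V`.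
  have hinv : ∀ l, |(m l)⁻¹| ≤ |D| := fun l => by
    by_cases hl : 2 ≤ l
    · have h0 : 0 < |m l| := abs_pos.2 (hm l hl)
      rw [abs_inv, inv_le_iff_one_le_mul₀ h0]
      have := mul_le_mul_of_nonneg_right (le_abs_self D) h0.le
      linarith [hD l hl, hlam l hl]
    · rw [h01 l (by omega)]
      simp
  have hrange : ∀ k ∈ Vᗮ, ∃ w : H2, incl w ∈ Vᗮ ∧ T w = k := fun k hk => by
    rw [mem_V_orthogonal_iff] at hk
    obtain ⟨w, hw1, hw2⟩ := hex (mult (fun l => (m l)⁻¹) |D| hinv k) k fun l => by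
      rw [proj_mult, smul_smul]
      by_cases hl : 2 ≤ l
      · rw [mul_inv_cancel₀ (hm l hl), one_smul]
      · rw [hk l (by omega), smul_zero]
    refine ⟨w, mem_V_orthogonal_iff.2 fun l hl => ?_, hw2⟩
    rw [hw1, proj_mult, hk l hl, smul_zero]
  have hTV : ∀ w, T w ∈ Vᗮ := fun w => mem_V_orthogonal_iff.2 fun l hl => by
    rw [hproj, h01 l hl, zero_smul]
  refine ⟨T, hex, ?_, ?_, ?_, ⟨fun w _ => hTV w, ?_, ?_⟩, ?_⟩
  · exact isSelfAdjoint_diagonal proj m inner_proj_left horth hasSum_proj _ hgraph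
  · ext f
    rw [mem_V_iff]
    constructor
    · rintro ⟨w, hw, rfl⟩ l hl
      have := hproj w l
      rw [show T w = 0 from hw, map_zero] at this
      exact (smul_eq_zero.1 this.symm).resolve_left (hm l hl)
    · intro h
      obtain ⟨w, hw1, hw2⟩ := hex f 0 fun l => by
        by_cases hl : 2 ≤ l
        · rw [h l hl, map_zero, smul_zero]
        · rw [h01 l (by omega), map_zero, zero_smul]
      exact ⟨w, hw2, hw1⟩
  · ext k
    constructor
    · rintro ⟨w, rfl⟩
      exact hTV w
    · intro hk
      obtain ⟨w, -, hw⟩ := hrange k hk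
      exact ⟨w, hw⟩
  · intro w hw w' hw' h
    apply incl_injective
    refine ext_proj fun l => ?_
    by_cases hl : 2 ≤ l
    · have := congrArg (proj l) h
      rw [hproj, hproj] at this
      exact smul_right_injective _ (hm l hl) this
    · rw [mem_V_orthogonal_iff.1 hw l (by omega), mem_V_orthogonal_iff.1 hw' l (by omega)]
  · intro k hk
    obtain ⟨w, hw1, hw2⟩ := hrange k hk
    exact ⟨w, hw1, hw2⟩
  -- The harmonic projections preserve the complement of `V`, so the diagonal criterion applies
  -- inside that subspace too.
  · have hmaps : ∀ l, ∀ f ∈ Vᗮ, proj l f ∈ Vᗮ := fun l f hf => mem_V_orthogonal_iff.2 fun k hk => by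
      rw [horth]
      split_ifs with h
      · exact mem_V_orthogonal_iff.1 hf k hk
      · rfl
    let P : ℕ → Vᗮ →L[ℝ] Vᗮ := fun l =>
      (proj l ∘L (Vᗮ).subtypeL).codRestrict Vᗮ fun f => hmaps l f f.2
    have hP : ∀ l f, ((P l f : Vᗮ) : L2) = proj l f := fun l f => rfl
    refine isSelfAdjoint_diagonal P m (fun l f g => ?_) (fun l k f => ?_) (fun f => ?_) _ fun x => ?_
    · exact inner_proj_left l f g
    · ext1
      rw [hP, hP, horth]
      split_ifs <;> rfl
    · have h := hasSum_proj (f : L2)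
      refine (Topology.IsInducing.subtypeVal.hasSum_iff (g := (Vᗮ).subtype) _ _).1 ?_
      exact h
    · rw [Submodule.mem_comap, hgraph]
      refine forall_congr' fun l => ?_
      exact (Subtype.ext_iff (a1 := P l x.2) (a2 := m l • P l x.1)).symm

/-! ### The coefficients of the linearised curvature -/

theorem curvatureCoeff_of_lt {l : ℕ} (hl : l < 2) : curvatureCoeff l = 0 := by
  interval_cases l
  · simp [curvatureCoeff]
  · norm_num [curvatureCoeff, lam]

/-- The leading powers of λ cancel. With x = 3/λ, the coefficient is governed by (3 - x)eˣ - 3 - 2x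
= x²/2 + O(x⁴), so its negative is about (λ - 2)/2. For λ ≥ 6 one has x ≤ 1/2, and Taylor bounds for
eˣ make this quantitative. -/
theorem curvatureCoeff_bounds {l : ℕ} (hl : 2 ≤ l) :
    lam l / 6 ≤ -curvatureCoeff l ∧ -curvatureCoeff l ≤ 2 * lam l := by
  have h6 : 6 ≤ lam l := by
    have : (2 : ℝ) ≤ l := by exact_mod_cast hl
    unfold lam
    nlinarith
  set Λ := lam l with hΛ
  obtain ⟨x, hx⟩ : ∃ x, x = 3 / Λ := ⟨_, rfl⟩
  have hx0 : 0 < x := by rw [hx]; positivity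
  have hx1 : x ≤ 1 / 2 := by rw [hx, div_le_iff₀ (by linarith)]; linarith
  have hΛx : Λ * x = 3 := by rw [hx]; field_simp
  have hlow : 1 + x + x ^ 2 / 2 + x ^ 3 / 6 ≤ Real.exp x := by
    have := Real.sum_le_exp_of_nonneg hx0.le 4
    simp [Finset.sum_range_succ, Nat.factorial] at this
    linarith
  have hup : Real.exp x ≤ 1 + x + x ^ 2 := by
    have := Real.abs_exp_sub_one_sub_id_le (x := x) (by rw [abs_le]; constructor <;> linarith)
    linarith [(abs_le.1 this).2]
  -- Multiplying by x² and using λx = 3 removes the powers of λ that cancel, leaving only the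
  -- harmless factor λ - 2.
  have hc : -curvatureCoeff l * x ^ 2 = (Λ - 2) * ((3 - x) * Real.exp x - 3 - 2 * x) := by
    rw [curvatureCoeff, if_neg (by omega), ← hΛ, ← hx]
    linear_combination (-(1 / 3) * (Λ - 2) * x * ((Λ + 2) - (Λ - 1) * Real.exp x)
      - (Λ - 2) * (1 - Real.exp x)) * hΛx
  constructor
  · have h1 : x ^ 2 / 4 ≤ (3 - x) * Real.exp x - 3 - 2 * x := by
      have := mul_le_mul_of_nonneg_left hlow (show 0 ≤ 3 - x by linarith)
      nlinarith [mul_nonneg (sq_nonneg x) (sq_nonneg x), mul_nonneg (sq_nonneg x) (show 0 ≤ 1 / 4 - x ^ 2 by nlinarith)]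
    have h2 : Λ / 6 * x ^ 2 ≤ -curvatureCoeff l * x ^ 2 := by
      rw [hc]
      have := mul_le_mul_of_nonneg_left h1 (show 0 ≤ Λ - 2 by linarith)
      nlinarith [sq_nonneg x]
    exact le_of_mul_le_mul_right h2 (by positivity)
  · have h1 : (3 - x) * Real.exp x - 3 - 2 * x ≤ 2 * x ^ 2 := by
      have := mul_le_mul_of_nonneg_left hup (show 0 ≤ 3 - x by linarith)
      nlinarith [pow_pos hx0 3]
    have h2 : -curvatureCoeff l * x ^ 2 ≤ 2 * Λ * x ^ 2 := by
      rw [hc]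
      have := mul_le_mul_of_nonneg_left h1 (show 0 ≤ Λ - 2 by linarith)
      nlinarith [sq_nonneg x]
    exact le_of_mul_le_mul_right h2 (by positivity)

theorem curvatureCoeff_ne_zero {l : ℕ} (hl : 2 ≤ l) : curvatureCoeff l ≠ 0 := by
  have h := (curvatureCoeff_bounds hl).1
  have := lam_pos (l := l) (by omega)
  intro h0
  rw [h0] at h
  linarith

theorem exists_curvature_operator {r₀ : ℝ} (hr₀ : 0 < r₀) {δk : SmoothFun → SmoothFun}
    (hδk : ∀ h l, harm l (δk h) = (curvatureCoeff l / r₀) • harm l h) :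
    ∃ T : H2 →L[ℝ] L2,
      (∀ h : SmoothFun, ∃ f : H2, incl f = toL2 h ∧ T f = toL2 (δk h)) ∧
      Function.Injective incl ∧
      IsSelfAdjoint (toOperator T) ∧
      Submodule.map incl (LinearMap.ker (T : H2 →ₗ[ℝ] L2)) = V ∧
      LinearMap.range (T : H2 →ₗ[ℝ] L2) = Vᗮ ∧
      Set.BijOn T {f : H2 | incl f ∈ Vᗮ} (Vᗮ : Submodule ℝ L2) ∧
      IsSelfAdjoint (toOperatorOn T Vᗮ) := by
  obtain ⟨T, hT, h⟩ := exists_diagonal_map (m := fun l => curvatureCoeff l / r₀) (C := 2 / r₀)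
    (D := 6 * r₀) (fun l hl => by simp [curvatureCoeff_of_lt hl])
    (fun l => by
      rw [abs_div, abs_of_pos hr₀, div_mul_eq_mul_div]
      refine div_le_div_of_nonneg_right ?_ hr₀.le
      by_cases hl : 2 ≤ l
      · have := curvatureCoeff_bounds hl
        have h0 := lam_nonneg l
        rw [abs_of_nonpos (by linarith)]
        exact this.2
      · rw [curvatureCoeff_of_lt (by omega), abs_zero]
        have := lam_nonneg l
        positivity)
    (fun l hl => by
      have := curvatureCoeff_bounds hl
      have h0 := lam_nonneg l
      rw [abs_div, abs_of_pos hr₀, abs_of_nonpos (by linarith)]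
      field_simp
      linarith)
  refine ⟨T, fun k => hT _ _ fun l => ?_, incl_injective, h⟩
  rw [← toL2_harm, ← toL2_harm, hδk, ← toL2L_apply, map_smul]
  rfl

/-! ### The area radius and the null lapse -/

/-- The function that defines the area radius implicitly. -/
def radiusEq (r₀ ρ : ℝ) : ℝ := (ρ - r₀) * Real.exp (ρ / r₀)

theorem hasDerivAt_radiusEq {r₀ : ℝ} (hr₀ : 0 < r₀) (ρ : ℝ) :
    HasDerivAt (radiusEq r₀) (ρ / r₀ * Real.exp (ρ / r₀)) ρ := by
  unfold radiusEq
  convert! ((hasDerivAt_id ρ).sub_const r₀).mul ((hasDerivAt_id ρ).div_const r₀).exp using 1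
  simp only [id]
  field_simp
  ring

theorem contDiff_radiusEq (r₀ : ℝ) : ContDiff ℝ ∞ (radiusEq r₀) := by
  unfold radiusEq
  fun_prop

theorem strictMonoOn_radiusEq {r₀ : ℝ} (hr₀ : 0 < r₀) : StrictMonoOn (radiusEq r₀) (Set.Ioi 0) := by
  refine strictMonoOn_of_deriv_pos (convex_Ioi 0)
    (contDiff_radiusEq r₀).continuous.continuousOn fun ρ hρ => ?_
  rw [interior_Ioi] at hρ
  have : 0 < ρ := hρ
  rw [(hasDerivAt_radiusEq hr₀ ρ).deriv]
  positivity

/-- The inverse of `radiusEq`. -/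
def radiusInv (r₀ : ℝ) : ℝ → ℝ := Function.invFunOn (radiusEq r₀) (Set.Ioi 0)

theorem radius_eq (r₀ s sb : ℝ) :
    radius r₀ s sb = radiusInv r₀ (s * Real.exp ((sb + s + r₀) / r₀)) := rfl

/-- The defining function takes the value -r₀ at 0 and exceeds z at r₀ + |z|, so the intermediate
value theorem supplies a positive root. -/
theorem radiusInv_spec {r₀ : ℝ} (hr₀ : 0 < r₀) {z : ℝ} (hz : -r₀ < z) :
    0 < radiusInv r₀ z ∧ radiusEq r₀ (radiusInv r₀ z) = z := by
  have hM : z ≤ radiusEq r₀ (r₀ + |z|) := by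
    unfold radiusEq
    have h1 : 1 ≤ Real.exp ((r₀ + |z|) / r₀) := Real.one_le_exp (by positivity)
    have h2 := mul_le_mul_of_nonneg_left h1 (abs_nonneg z)
    have h3 := le_abs_self z
    rw [add_sub_cancel_left]
    linarith
  have h0 : radiusEq r₀ 0 = -r₀ := by simp [radiusEq]
  obtain ⟨ρ, hρ, hρz⟩ := intermediate_value_Icc (a := 0) (b := r₀ + |z|) (by positivity)
    (contDiff_radiusEq r₀).continuous.continuousOn (show z ∈ Set.Icc _ _ from ⟨by linarith, hM⟩)
  have hρ0 : ρ ∈ Set.Ioi (0 : ℝ) := by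
    refine lt_of_le_of_ne hρ.1 fun h => ?_
    rw [← h, h0] at hρz
    linarith
  exact ⟨Function.invFunOn_mem ⟨ρ, hρ0, hρz⟩, Function.invFunOn_eq ⟨ρ, hρ0, hρz⟩⟩

theorem radiusInv_radiusEq {r₀ : ℝ} (hr₀ : 0 < r₀) {ρ : ℝ} (hρ : 0 < ρ) :
    radiusInv r₀ (radiusEq r₀ ρ) = ρ :=
  (strictMonoOn_radiusEq hr₀).injOn.leftInvOn_invFunOn hρ

/-- The inverse function theorem gives a smooth local inverse. It stays positive nearby, so by
injectivity on the positive axis it agrees with the chosen inverse. -/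
theorem contDiffAt_radiusInv {r₀ : ℝ} (hr₀ : 0 < r₀) {z : ℝ} (hz : -r₀ < z) :
    ContDiffAt ℝ ∞ (radiusInv r₀) z := by
  obtain ⟨hpos, heq⟩ := radiusInv_spec hr₀ hz
  set ρ := radiusInv r₀ z
  have hne : ρ / r₀ * Real.exp (ρ / r₀) ≠ 0 := by positivity
  have hcd : ContDiffAt ℝ ∞ (radiusEq r₀) ρ := (contDiff_radiusEq r₀).contDiffAt
  have hfd : HasFDerivAt (radiusEq r₀)
      (ContinuousLinearEquiv.unitsEquivAut ℝ (Units.mk0 _ hne) : ℝ →L[ℝ] ℝ) ρ :=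
    (hasDerivAt_radiusEq hr₀ ρ).hasFDerivAt_equiv hne
  have h1 := hcd.to_localInverse hfd (by simp)
  rw [heq] at h1
  refine h1.congr_of_eventuallyEq ?_
  have hs := hcd.hasStrictFDerivAt' hfd (by simp)
  have h2 := hs.eventually_right_inverse
  have h3 : ∀ᶠ y in 𝓝 z, 0 < hcd.localInverse hfd (by simp) y := by
    have hc : ContinuousAt (hcd.localInverse hfd (by simp)) z := h1.continuousAt
    have h0 : hcd.localInverse hfd (by simp) z = ρ := by
      conv_lhs => rw [← heq]
      exact hcd.localInverse_apply_image hfd (by simp)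
    exact hc.eventually (by rw [h0]; exact lt_mem_nhds hpos)
  rw [heq] at h2
  filter_upwards [h2, h3] with y hy hy0
  conv_lhs => rw [← hy]
  exact radiusInv_radiusEq hr₀ hy0

theorem hasDerivAt_radiusInv {r₀ : ℝ} (hr₀ : 0 < r₀) {z : ℝ} (hz : -r₀ < z) :
    HasDerivAt (radiusInv r₀)
      (radiusInv r₀ z / r₀ * Real.exp (radiusInv r₀ z / r₀))⁻¹ z := by
  obtain ⟨hpos, heq⟩ := radiusInv_spec hr₀ hz
  refine HasDerivAt.of_local_left_inverse (contDiffAt_radiusInv hr₀ hz).continuousAt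
    (hasDerivAt_radiusEq hr₀ _) (by positivity) ?_
  filter_upwards [lt_mem_nhds hz] with y hy using (radiusInv_spec hr₀ hy).2

/-- The region of the `(s, s̲)` plane covered by the double null coordinates. -/
def region (r₀ : ℝ) : Set (ℝ × ℝ) :=
  {x | -r₀ < x.1 * Real.exp ((x.2 + x.1 + r₀) / r₀) ∧ -r₀ < x.1}

theorem isOpen_region (r₀ : ℝ) : IsOpen (region r₀) := by
  have h1 : IsOpen {x : ℝ × ℝ | -r₀ < x.1 * Real.exp ((x.2 + x.1 + r₀) / r₀)} :=
    isOpen_lt (by fun_prop) (by fun_prop)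
  have h2 : IsOpen {x : ℝ × ℝ | -r₀ < x.1} := isOpen_lt (by fun_prop) (by fun_prop)
  exact h1.inter h2

theorem mem_region {r₀ u : ℝ} (hr₀ : 0 < r₀) (hu : 0 ≤ u) (b : ℝ) : (u, b) ∈ region r₀ := by
  have : 0 ≤ u * Real.exp ((b + u + r₀) / r₀) := by positivity
  exact ⟨by simp only; linarith, by simp only; linarith⟩

section Region

variable {r₀ : ℝ} (hr₀ : 0 < r₀) {x : ℝ × ℝ} (hx : x ∈ region r₀)

include hr₀ hx

theorem radius_pos : 0 < radius r₀ x.1 x.2 := (radiusInv_spec hr₀ hx.1).1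

theorem OmegaSq_pos : 0 < OmegaSq r₀ x.1 x.2 := by
  have h1 := radius_pos hr₀ hx
  have h2 : 0 < x.1 + r₀ := by linarith [hx.2]
  unfold OmegaSq
  positivity

theorem contDiffAt_radius : ContDiffAt ℝ ∞ (fun z : ℝ × ℝ => radius r₀ z.1 z.2) x := by
  simp only [radius_eq]
  refine ContDiffAt.comp x (contDiffAt_radiusInv hr₀ hx.1) ?_
  fun_prop

theorem contDiffAt_OmegaSq : ContDiffAt ℝ ∞ (fun z : ℝ × ℝ => OmegaSq r₀ z.1 z.2) x := by
  have h1 := contDiffAt_radius hr₀ hx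
  have h2 := (radius_pos hr₀ hx).ne'
  unfold OmegaSq
  refine ContDiffAt.mul (ContDiffAt.div (by fun_prop) h1 h2) (ContDiffAt.exp ?_)
  exact ((by fun_prop : ContDiffAt ℝ ∞ (fun z : ℝ × ℝ => z.2 + z.1 + r₀) x).sub h1).div_const _

/-- Implicit differentiation of the defining equation; Ω² is precisely the derivative of the area
radius in s. -/
theorem hasFDerivAt_radius : HasFDerivAt (fun z : ℝ × ℝ => radius r₀ z.1 z.2)
    (OmegaSq r₀ x.1 x.2 • ContinuousLinearMap.fst ℝ ℝ ℝ +
      ((radius r₀ x.1 x.2 - r₀) / radius r₀ x.1 x.2) • ContinuousLinearMap.snd ℝ ℝ ℝ) x := by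
  have hpos := radius_pos hr₀ hx
  have heq := (radiusInv_spec hr₀ hx.1).2
  rw [← radius_eq] at heq
  have h0 : HasFDerivAt (fun z : ℝ × ℝ => (z.2 + z.1 + r₀) * r₀⁻¹)
      (r₀⁻¹ • (ContinuousLinearMap.snd ℝ ℝ ℝ + ContinuousLinearMap.fst ℝ ℝ ℝ)) x :=
    (((ContinuousLinearMap.snd ℝ ℝ ℝ + ContinuousLinearMap.fst ℝ ℝ ℝ).hasFDerivAt).add_const
      r₀).mul_const r₀⁻¹
  have h1 := (hasFDerivAt_fst (𝕜 := ℝ) (E := ℝ) (F := ℝ) (p := x)).mul h0.exp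
  have h2 := (hasDerivAt_radiusInv hr₀ hx.1).comp_hasFDerivAt x h1
  convert! h2 using 1
  rw [← radius_eq]
  set ρ := radius r₀ x.1 x.2
  have he : Real.exp ((x.2 + x.1 + r₀ - ρ) / r₀) * Real.exp (ρ / r₀) =
      Real.exp ((x.2 + x.1 + r₀) * r₀⁻¹) := by
    rw [← Real.exp_add]
    congr 1
    field_simp
    ring
  unfold radiusEq at heq
  rw [div_eq_mul_inv (_ + _ + _)] at heq
  have hOm : OmegaSq r₀ x.1 x.2 = (x.1 + r₀) / ρ * Real.exp ((x.2 + x.1 + r₀ - ρ) / r₀) := rfl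
  have hne := Real.exp_ne_zero (ρ / r₀)
  ext
  · simp only [hOm, ContinuousLinearMap.comp_apply, ContinuousLinearMap.inl_apply, add_apply,
      smul_apply, ContinuousLinearMap.coe_fst', ContinuousLinearMap.coe_snd', smul_eq_mul, mul_one,
      mul_zero, add_zero, zero_add]
    rw [← he]
    field_simp
  · simp only [ContinuousLinearMap.comp_apply, ContinuousLinearMap.inr_apply, add_apply,
      smul_apply, ContinuousLinearMap.coe_fst', ContinuousLinearMap.coe_snd', smul_eq_mul, mul_one,
      mul_zero, add_zero, zero_add]
    rw [← mul_assoc x.1, ← heq]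
    field_simp

theorem hasFDerivAt_OmegaSq : HasFDerivAt (fun z : ℝ × ℝ => OmegaSq r₀ z.1 z.2)
    ((OmegaSq r₀ x.1 x.2 * (1 / (x.1 + r₀) + 1 / r₀ -
        OmegaSq r₀ x.1 x.2 * (1 / radius r₀ x.1 x.2 + 1 / r₀))) • ContinuousLinearMap.fst ℝ ℝ ℝ +
      (OmegaSq r₀ x.1 x.2 * (r₀ / radius r₀ x.1 x.2 ^ 2)) • ContinuousLinearMap.snd ℝ ℝ ℝ) x := by
  have hpos := radius_pos hr₀ hx
  have hs : 0 < x.1 + r₀ := by linarith [hx.2]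
  have hR := hasFDerivAt_radius hr₀ hx
  have h0 : HasFDerivAt (fun z : ℝ × ℝ => z.2 + z.1 + r₀)
      (ContinuousLinearMap.snd ℝ ℝ ℝ + ContinuousLinearMap.fst ℝ ℝ ℝ) x :=
    ((ContinuousLinearMap.snd ℝ ℝ ℝ + ContinuousLinearMap.fst ℝ ℝ ℝ).hasFDerivAt).add_const r₀
  have hinv : HasFDerivAt (fun z : ℝ × ℝ => (radius r₀ z.1 z.2)⁻¹) _ x :=
    (hasDerivAt_inv hpos.ne').comp_hasFDerivAt x hR
  have h1 := (((hasFDerivAt_fst (𝕜 := ℝ) (E := ℝ) (F := ℝ) (p := x)).add_const r₀).mul hinv).mul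
    ((h0.sub hR).mul_const r₀⁻¹).exp
  simp only [Pi.mul_apply, Pi.sub_apply] at h1
  convert! h1 using 1
  set ρ := radius r₀ x.1 x.2
  set E := Real.exp ((x.2 + x.1 + r₀ - ρ) * r₀⁻¹) with hE
  have hOm : OmegaSq r₀ x.1 x.2 = (x.1 + r₀) / ρ * E := rfl
  ext
  · simp only [hOm, ContinuousLinearMap.comp_apply, ContinuousLinearMap.inl_apply, add_apply,
      smul_apply, ContinuousLinearMap.coe_fst', ContinuousLinearMap.coe_snd', smul_eq_mul, mul_one,
      mul_zero, add_zero, zero_add, sub_apply]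
    field_simp
    ring
  · simp only [hOm, ContinuousLinearMap.comp_apply, ContinuousLinearMap.inr_apply, add_apply,
      smul_apply, ContinuousLinearMap.coe_fst', ContinuousLinearMap.coe_snd', smul_eq_mul, mul_one,
      mul_zero, add_zero, zero_add, sub_apply]
    field_simp
    ring

end Region

/-- On s̲ = 0 the implicit equation is solved by r = r₀ + s, and then Ω² = 1. This is why the
background coefficients are rational functions of u. -/
theorem radius_zero {r₀ u : ℝ} (hr₀ : 0 < r₀) (hu : 0 ≤ u) : radius r₀ u 0 = r₀ + u := by
  have h := radiusInv_radiusEq hr₀ (show 0 < r₀ + u by linarith)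
  rw [radius_eq]
  conv_rhs => rw [← h]
  congr 1
  rw [radiusEq]
  ring_nf

theorem OmegaSq_zero {r₀ u : ℝ} (hr₀ : 0 < r₀) (hu : 0 ≤ u) : OmegaSq r₀ u 0 = 1 := by
  have : r₀ + u ≠ 0 := by linarith
  rw [OmegaSq, radius_zero hr₀ hu, show (0 + u + r₀ - (r₀ + u)) / r₀ = 0 by ring_nf, Real.exp_zero,
    add_comm u, div_self this, mul_one]

/-! ### The Christoffel symbols of the Schwarzschild metric -/

@[simp] theorem pd_const {ι : Type*} [Fintype ι] [DecidableEq ι] (i : ι) (c : ℝ) (x : ι → ℝ) :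
    pd i (fun _ => c) x = 0 := by
  simp [pd]

/-- The coordinates `(s, s̲)` of a point of the spacetime. -/
def planePart : (Idx → ℝ) →L[ℝ] ℝ × ℝ :=
  (ContinuousLinearMap.proj (Sum.inl 0)).prod (ContinuousLinearMap.proj (Sum.inl 1))

/-- The coordinates on the sphere of a point of the spacetime. -/
def spherePart : (Idx → ℝ) →L[ℝ] Fin 2 → ℝ :=
  ContinuousLinearMap.pi fun i => ContinuousLinearMap.proj (Sum.inr i)

theorem planePart_single_inr (k : Fin 2) : planePart (Pi.single (Sum.inr k) 1) = 0 := by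
  simp [planePart]

theorem planePart_single_zero : planePart (Pi.single (Sum.inl 0) 1) = (1, 0) := by
  simp [planePart]

theorem planePart_single_one : planePart (Pi.single (Sum.inl 1) 1) = (0, 1) := by
  simp [planePart]

theorem spherePart_single_inl (k : Fin 2) : spherePart (Pi.single (Sum.inl k) 1) = 0 := by
  ext i
  simp [spherePart]

theorem spherePart_single_inr (k : Fin 2) :
    spherePart (Pi.single (Sum.inr k) 1) = Pi.single k 1 := by
  ext i
  simp [spherePart, Pi.single_apply]

theorem metric_inl_inl (r₀ : ℝ) (p : Sph) (x : Idx → ℝ) (a b : Fin 2) :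
    metric r₀ p x (Sum.inl a) (Sum.inl b) =
      if a = b then 0 else 2 * OmegaSq r₀ (planePart x).1 (planePart x).2 := by
  fin_cases a <;> fin_cases b <;> simp [metric, planePart]

theorem metric_inr_inr (r₀ : ℝ) (p : Sph) (x : Idx → ℝ) (i j : Fin 2) :
    metric r₀ p x (Sum.inr i) (Sum.inr j) =
      if i = j then radius r₀ (planePart x).1 (planePart x).2 ^ 2 * psi (spherePart x) else 0 := by
  simp only [metric, Matrix.fromBlocks_apply₂₂, roundMetric_eq, Matrix.smul_apply, Matrix.one_apply,
    smul_eq_mul, mul_ite, mul_one, mul_zero]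
  rfl

@[simp] theorem metric_inl_inr (r₀ : ℝ) (p : Sph) (x : Idx → ℝ) (a i : Fin 2) :
    metric r₀ p x (Sum.inl a) (Sum.inr i) = 0 := rfl

@[simp] theorem metric_inr_inl (r₀ : ℝ) (p : Sph) (x : Idx → ℝ) (a i : Fin 2) :
    metric r₀ p x (Sum.inr i) (Sum.inl a) = 0 := rfl

section Christoffel

variable {r₀ : ℝ} (hr₀ : 0 < r₀) (p : Sph) {x : Idx → ℝ} (hx : planePart x ∈ region r₀)

/-- The derivatives of the area radius along the null coordinates. -/
def radiusD (r₀ : ℝ) (x : ℝ × ℝ) (a : Fin 2) : ℝ :=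
  ![OmegaSq r₀ x.1 x.2, (radius r₀ x.1 x.2 - r₀) / radius r₀ x.1 x.2] a

/-- The logarithmic derivatives of `Ω²` along the null coordinates. -/
def OmegaSqD (r₀ : ℝ) (x : ℝ × ℝ) (a : Fin 2) : ℝ :=
  ![1 / (x.1 + r₀) + 1 / r₀ - OmegaSq r₀ x.1 x.2 * (1 / radius r₀ x.1 x.2 + 1 / r₀),
    r₀ / radius r₀ x.1 x.2 ^ 2] a

include hr₀ hx

theorem metric_inv : (metric r₀ p x)⁻¹ = Matrix.fromBlocks
    !![0, (2 * OmegaSq r₀ (planePart x).1 (planePart x).2)⁻¹;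
      (2 * OmegaSq r₀ (planePart x).1 (planePart x).2)⁻¹, 0] 0 0
    ((radius r₀ (planePart x).1 (planePart x).2 ^ 2 * psi (spherePart x))⁻¹ • 1) := by
  have h1 := (radius_pos hr₀ hx).ne'
  have h2 := (OmegaSq_pos hr₀ hx).ne'
  have h3 := (psi_pos (spherePart x)).ne'
  refine Matrix.inv_eq_right_inv ?_
  ext a b
  rw [Matrix.mul_apply, Fintype.sum_sum_type]
  rcases a with a | a <;> rcases b with b | b
  · fin_cases a <;> fin_cases b <;> simp [metric_inl_inl] <;> field_simp
  · fin_cases a <;> fin_cases b <;> simp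
  · fin_cases a <;> fin_cases b <;> simp
  · fin_cases a <;> fin_cases b <;> simp [metric_inr_inr, Matrix.one_apply] <;> field_simp

theorem pd_metric_inl_inl (c : Idx) (a b : Fin 2) :
    pd c (fun z => metric r₀ p z (Sum.inl a) (Sum.inl b)) x = if a = b then 0 else
      Sum.elim (fun c => 2 * (OmegaSq r₀ (planePart x).1 (planePart x).2 *
        OmegaSqD r₀ (planePart x) c)) (fun _ => 0) c := by
  simp only [metric_inl_inl]
  split_ifs with h
  · simp [pd]
  have h1 : HasFDerivAt (fun z => 2 * OmegaSq r₀ (planePart z).1 (planePart z).2) _ x :=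
    ((hasFDerivAt_OmegaSq hr₀ hx).comp x planePart.hasFDerivAt).const_mul 2
  rw [pd, h1.fderiv]
  rcases c with c | c
  · fin_cases c
    · simp [planePart_single_zero, OmegaSqD]
    · simp [planePart_single_one, OmegaSqD]
  · simp [planePart_single_inr]

theorem pd_metric_inr_inr (c : Idx) (i j : Fin 2) :
    pd c (fun z => metric r₀ p z (Sum.inr i) (Sum.inr j)) x = if i = j then
      Sum.elim (fun c => 2 * radius r₀ (planePart x).1 (planePart x).2 *
        radiusD r₀ (planePart x) c * psi (spherePart x))
      (fun c => radius r₀ (planePart x).1 (planePart x).2 ^ 2 * pd c psi (spherePart x)) c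
      else 0 := by
  simp only [metric_inr_inr]
  split_ifs with h
  swap
  · simp [pd]
  have h0 : HasFDerivAt psi (fderiv ℝ psi (spherePart x)) (spherePart x) :=
    (contDiff_psi.differentiable (by simp)).differentiableAt.hasFDerivAt
  have h1 : HasFDerivAt (fun z => radius r₀ (planePart z).1 (planePart z).2 ^ 2 *
      psi (spherePart z)) _ x :=
    (((hasFDerivAt_radius hr₀ hx).comp x planePart.hasFDerivAt).pow 2).mul
      (h0.comp x spherePart.hasFDerivAt)
  rw [pd, h1.fderiv]
  rcases c with c | c
  · fin_cases c
    · simp [planePart_single_zero, spherePart_single_inl, radiusD]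
      ring
    · simp [planePart_single_one, spherePart_single_inl, radiusD]
      ring
  · simp [planePart_single_inr, spherePart_single_inr, pd]

theorem christoffel_lll (a b c : Fin 2) :
    christoffel (metric r₀ p) x (Sum.inl a) (Sum.inl b) (Sum.inl c) =
      if a = b ∧ a = c then OmegaSqD r₀ (planePart x) a else 0 := by
  have h2 := (OmegaSq_pos hr₀ hx).ne'
  rw [christoffel, Fintype.sum_sum_type, metric_inv hr₀ p hx]
  simp only [pd_metric_inl_inl hr₀ p hx]
  fin_cases a <;> fin_cases b <;> fin_cases c <;> simp <;> field_simp <;> ring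

theorem christoffel_llr (a b c : Fin 2) :
    christoffel (metric r₀ p) x (Sum.inl a) (Sum.inl b) (Sum.inr c) = 0 := by
  rw [christoffel, Fintype.sum_sum_type, metric_inv hr₀ p hx]
  simp only [pd_metric_inl_inl hr₀ p hx]
  simp

theorem christoffel_lrl (a b c : Fin 2) :
    christoffel (metric r₀ p) x (Sum.inl a) (Sum.inr b) (Sum.inl c) = 0 := by
  rw [christoffel, Fintype.sum_sum_type, metric_inv hr₀ p hx]
  simp only [pd_metric_inl_inl hr₀ p hx]
  simp

/-- The index 1 - a appears because the inverse metric pairs each null direction with the other one.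
-/
theorem christoffel_lrr (a i j : Fin 2) :
    christoffel (metric r₀ p) x (Sum.inl a) (Sum.inr i) (Sum.inr j) =
      if i = j then -(radius r₀ (planePart x).1 (planePart x).2 *
        radiusD r₀ (planePart x) (1 - a) /
          (2 * OmegaSq r₀ (planePart x).1 (planePart x).2) * psi (spherePart x)) else 0 := by
  have h2 := (OmegaSq_pos hr₀ hx).ne'
  rw [christoffel, Fintype.sum_sum_type, metric_inv hr₀ p hx]
  simp only [pd_metric_inr_inr hr₀ p hx]
  fin_cases a <;> fin_cases i <;> fin_cases j <;> simp <;> field_simp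

theorem christoffel_rll (k a b : Fin 2) :
    christoffel (metric r₀ p) x (Sum.inr k) (Sum.inl a) (Sum.inl b) = 0 := by
  rw [christoffel, Fintype.sum_sum_type, metric_inv hr₀ p hx]
  simp only [pd_metric_inl_inl hr₀ p hx]
  simp

theorem christoffel_rlr (k a j : Fin 2) :
    christoffel (metric r₀ p) x (Sum.inr k) (Sum.inl a) (Sum.inr j) =
      if k = j then radiusD r₀ (planePart x) a / radius r₀ (planePart x).1 (planePart x).2
      else 0 := by
  have h1 := (radius_pos hr₀ hx).ne'
  have h3 := (psi_pos (spherePart x)).ne'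
  rw [christoffel, Fintype.sum_sum_type, metric_inv hr₀ p hx]
  simp only [pd_metric_inr_inr hr₀ p hx]
  fin_cases k <;> fin_cases j <;> simp <;> field_simp

theorem christoffel_rrl (k j a : Fin 2) :
    christoffel (metric r₀ p) x (Sum.inr k) (Sum.inr j) (Sum.inl a) =
      if k = j then radiusD r₀ (planePart x) a / radius r₀ (planePart x).1 (planePart x).2
      else 0 := by
  have h1 := (radius_pos hr₀ hx).ne'
  have h3 := (psi_pos (spherePart x)).ne'
  rw [christoffel, Fintype.sum_sum_type, metric_inv hr₀ p hx]
  simp only [pd_metric_inr_inr hr₀ p hx]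
  fin_cases k <;> fin_cases j <;> simp <;> field_simp

theorem christoffel_rrr (k i j : Fin 2) :
    christoffel (metric r₀ p) x (Sum.inr k) (Sum.inr i) (Sum.inr j) =
      ((if j = k then pd i psi (spherePart x) else 0) + (if i = k then pd j psi (spherePart x) else 0)
        - if i = j then pd k psi (spherePart x) else 0) / (2 * psi (spherePart x)) := by
  have h1 := (radius_pos hr₀ hx).ne'
  have h3 := (psi_pos (spherePart x)).ne'
  rw [christoffel, Fintype.sum_sum_type, metric_inv hr₀ p hx]
  simp only [pd_metric_inr_inr hr₀ p hx]
  fin_cases k <;> fin_cases i <;> fin_cases j <;> simp <;> field_simp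

end Christoffel

/-! ### First order expansions in a parameter -/

/-- `Φ t y = Φ₀ y + t Φ₁ y + O(t²)`, with smooth dependence on `(t, y)` near `t = 0`. -/
structure HasJet (Φ : ℝ → (Fin 2 → ℝ) → ℝ) (Φ₀ Φ₁ : (Fin 2 → ℝ) → ℝ) : Prop where
  smooth : ∀ y, ContDiffAt ℝ ∞ (fun x : ℝ × (Fin 2 → ℝ) => Φ x.1 x.2) (0, y)
  zero : ∀ y, Φ 0 y = Φ₀ y
  deriv : ∀ y, HasDerivAt (fun t => Φ t y) (Φ₁ y) 0

namespace HasJet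

variable {Φ Ψ : ℝ → (Fin 2 → ℝ) → ℝ} {Φ₀ Φ₁ Ψ₀ Ψ₁ : (Fin 2 → ℝ) → ℝ}

theorem congr_jet (h : HasJet Φ Φ₀ Φ₁) (h₀ : ∀ y, Φ₀ y = Ψ₀ y) (h₁ : ∀ y, Φ₁ y = Ψ₁ y) :
    HasJet Φ Ψ₀ Ψ₁ := by
  obtain rfl := funext h₀
  obtain rfl := funext h₁
  exact h

/-- Agreement is needed only near t = 0. The formulae for the Christoffel symbols hold only inside
the coordinate region, which contains the leaves for small t. -/
theorem congr (h : HasJet Φ Φ₀ Φ₁)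
    (he : ∀ y, ∀ᶠ x : ℝ × (Fin 2 → ℝ) in 𝓝 (0, y), Ψ x.1 x.2 = Φ x.1 x.2) : HasJet Ψ Φ₀ Φ₁ where
  smooth y := (h.smooth y).congr_of_eventuallyEq (he y)
  zero y := (he y).self_of_nhds.trans (h.zero y)
  deriv y := (h.deriv y).congr_of_eventuallyEq
    ((continuousAt_id.prodMk continuousAt_const : ContinuousAt (fun t : ℝ => (t, y)) 0).eventually
      (he y))

theorem of_contDiff {φ : (Fin 2 → ℝ) → ℝ} (h : ContDiff ℝ ∞ φ) :
    HasJet (fun _ y => φ y) φ fun _ => 0 where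
  smooth y := h.contDiffAt.comp (0, y) contDiffAt_snd
  zero _ := rfl
  deriv _ := hasDerivAt_const _ _

theorem const (c : ℝ) : HasJet (fun _ _ => c) (fun _ => c) fun _ => 0 := of_contDiff contDiff_const

theorem add (h : HasJet Φ Φ₀ Φ₁) (k : HasJet Ψ Ψ₀ Ψ₁) :
    HasJet (fun t y => Φ t y + Ψ t y) (fun y => Φ₀ y + Ψ₀ y) fun y => Φ₁ y + Ψ₁ y where
  smooth y := (h.smooth y).add (k.smooth y)
  zero y := by rw [h.zero, k.zero]
  deriv y := (h.deriv y).add (k.deriv y)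

theorem neg (h : HasJet Φ Φ₀ Φ₁) : HasJet (fun t y => -Φ t y) (fun y => -Φ₀ y) fun y => -Φ₁ y where
  smooth y := (h.smooth y).neg
  zero y := by rw [h.zero]
  deriv y := (h.deriv y).neg

theorem sub (h : HasJet Φ Φ₀ Φ₁) (k : HasJet Ψ Ψ₀ Ψ₁) :
    HasJet (fun t y => Φ t y - Ψ t y) (fun y => Φ₀ y - Ψ₀ y) fun y => Φ₁ y - Ψ₁ y where
  smooth y := (h.smooth y).sub (k.smooth y)
  zero y := by rw [h.zero, k.zero]
  deriv y := (h.deriv y).sub (k.deriv y)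

theorem mul (h : HasJet Φ Φ₀ Φ₁) (k : HasJet Ψ Ψ₀ Ψ₁) :
    HasJet (fun t y => Φ t y * Ψ t y) (fun y => Φ₀ y * Ψ₀ y)
      fun y => Φ₁ y * Ψ₀ y + Φ₀ y * Ψ₁ y where
  smooth y := (h.smooth y).mul (k.smooth y)
  zero y := by rw [h.zero, k.zero]
  deriv y := by
    have := (h.deriv y).mul (k.deriv y)
    rw [h.zero, k.zero] at this
    exact this

theorem const_mul (c : ℝ) (h : HasJet Φ Φ₀ Φ₁) :
    HasJet (fun t y => c * Φ t y) (fun y => c * Φ₀ y) fun y => c * Φ₁ y where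
  smooth y := contDiffAt_const.mul (h.smooth y)
  zero y := by rw [h.zero]
  deriv y := (h.deriv y).const_mul c

theorem sum {ι : Type*} {s : Finset ι} {Φ : ι → ℝ → (Fin 2 → ℝ) → ℝ} {Φ₀ Φ₁ : ι → (Fin 2 → ℝ) → ℝ}
    (h : ∀ i ∈ s, HasJet (Φ i) (Φ₀ i) (Φ₁ i)) :
    HasJet (fun t y => ∑ i ∈ s, Φ i t y) (fun y => ∑ i ∈ s, Φ₀ i y) fun y => ∑ i ∈ s, Φ₁ i y where
  smooth y := ContDiffAt.sum fun i hi => (h i hi).smooth y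
  zero y := Finset.sum_congr rfl fun i hi => (h i hi).zero y
  deriv y := HasDerivAt.fun_sum fun i hi => (h i hi).deriv y

theorem inv (h : HasJet Φ Φ₀ Φ₁) (h0 : ∀ y, Φ₀ y ≠ 0) :
    HasJet (fun t y => (Φ t y)⁻¹) (fun y => (Φ₀ y)⁻¹) fun y => -Φ₁ y / Φ₀ y ^ 2 where
  smooth y := (h.smooth y).inv (by simpa only [h.zero] using h0 y)
  zero y := by rw [h.zero]
  deriv y := by
    have := (h.deriv y).inv (by simpa only [h.zero] using h0 y)
    rw [h.zero] at this
    exact this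

theorem comp {S B : ℝ → (Fin 2 → ℝ) → ℝ} {S₀ S₁ B₀ B₁ : (Fin 2 → ℝ) → ℝ} (hS : HasJet S S₀ S₁)
    (hB : HasJet B B₀ B₁) {g : ℝ × ℝ → ℝ} {g' : (Fin 2 → ℝ) → ℝ × ℝ →L[ℝ] ℝ}
    (hg : ∀ y, ContDiffAt ℝ ∞ g (S₀ y, B₀ y)) (hg' : ∀ y, HasFDerivAt g (g' y) (S₀ y, B₀ y)) :
    HasJet (fun t y => g (S t y, B t y)) (fun y => g (S₀ y, B₀ y)) fun y => g' y (S₁ y, B₁ y) where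
  smooth y := by
    refine ContDiffAt.comp (g := g) (f := fun x : ℝ × (Fin 2 → ℝ) => (S x.1 x.2, B x.1 x.2)) (0, y)
      ?_ ((hS.smooth y).prodMk (hB.smooth y))
    simp only [hS.zero, hB.zero]
    exact hg y
  zero y := by rw [hS.zero, hB.zero]
  deriv y := by
    refine HasFDerivAt.comp_hasDerivAt (l := g) (f := fun t => (S t y, B t y)) 0 ?_
      ((hS.deriv y).prodMk (hB.deriv y))
    rw [hS.zero, hB.zero]
    exact hg' y

theorem fderiv_one (h : HasJet Φ Φ₀ Φ₁) (y : Fin 2 → ℝ) :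
    fderiv ℝ (fun x : ℝ × (Fin 2 → ℝ) => Φ x.1 x.2) (0, y) (1, 0) = Φ₁ y := by
  have h1 := ((h.smooth y).differentiableAt (by simp)).hasFDerivAt
  have h2 := h1.comp_hasDerivAt (f := fun t : ℝ => (t, y)) 0
    ((hasDerivAt_id 0).prodMk (hasDerivAt_const 0 y))
  exact h2.unique (h.deriv y)

theorem contDiff_one (h : HasJet Φ Φ₀ Φ₁) : ContDiff ℝ ∞ Φ₁ := by
  rw [contDiff_iff_contDiffAt]
  intro y
  have : Φ₁ = fun y => fderiv ℝ (fun x : ℝ × (Fin 2 → ℝ) => Φ x.1 x.2) (0, y) (1, 0) :=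
    funext fun y => (h.fderiv_one y).symm
  rw [this]
  refine ContDiffAt.clm_apply ?_ contDiffAt_const
  exact ContDiffAt.comp (g := fderiv ℝ fun x : ℝ × (Fin 2 → ℝ) => Φ x.1 x.2)
    (f := fun y => ((0 : ℝ), y)) y
    ((h.smooth y).fderiv_right (m := ∞) (by simp)) (contDiffAt_const.prodMk contDiffAt_id)

theorem eventually_pd_eq (h : HasJet Φ Φ₀ Φ₁) (i : Fin 2) (y : Fin 2 → ℝ) :
    ∀ᶠ x : ℝ × (Fin 2 → ℝ) in 𝓝 (0, y), pd i (Φ x.1) x.2 =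
      fderiv ℝ (fun x : ℝ × (Fin 2 → ℝ) => Φ x.1 x.2) x (0, Pi.single i 1) := by
  have h1 : ContDiffAt ℝ 1 (fun x : ℝ × (Fin 2 → ℝ) => Φ x.1 x.2) (0, y) :=
    (h.smooth y).of_le (by simp)
  filter_upwards [h1.eventually (by simp)] with x hx
  have h2 := (hx.differentiableAt (by simp)).hasFDerivAt
  have h3 : HasFDerivAt (fun z => (x.1, z)) (ContinuousLinearMap.inr ℝ ℝ (Fin 2 → ℝ)) x.2 :=
    hasFDerivAt_prodMk_right x.1 x.2
  have h4 : HasFDerivAt (Φ x.1) _ x.2 :=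
    HasFDerivAt.comp (g := fun x : ℝ × (Fin 2 → ℝ) => Φ x.1 x.2) x.2 h2 h3
  rw [pd, h4.fderiv]
  rfl

/-- Symmetry of second derivatives: the variation of a coordinate derivative is the coordinate
derivative of the variation. -/
theorem pd (h : HasJet Φ Φ₀ Φ₁) (i : Fin 2) :
    HasJet (fun t y => pd i (Φ t) y) (fun y => pd i Φ₀ y) fun y => pd i Φ₁ y where
  smooth y := by
    refine ContDiffAt.congr_of_eventuallyEq ?_ (h.eventually_pd_eq i y)
    exact ((h.smooth y).fderiv_right (m := ∞) (by simp)).clm_apply contDiffAt_const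
  zero y := by rw [show Φ 0 = Φ₀ from funext h.zero]
  deriv y := by
    set U : ℝ × (Fin 2 → ℝ) → ℝ := fun x => Φ x.1 x.2 with hU
    have hsm : ContDiffAt ℝ ∞ (fderiv ℝ U) (0, y) := (h.smooth y).fderiv_right (m := ∞) (by simp)
    have hd := (hsm.differentiableAt (by simp)).hasFDerivAt
    have h1 : HasDerivAt (fun t => Schwarzschild.pd i (Φ t) y)
        (fderiv ℝ (fderiv ℝ U) (0, y) (1, 0) (0, Pi.single i 1)) 0 := by
      have h2 := hd.comp_hasDerivAt (f := fun t : ℝ => (t, y)) 0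
        ((hasDerivAt_id 0).prodMk (hasDerivAt_const 0 y))
      have h3 := h2.clm_apply (hasDerivAt_const (0 : ℝ) ((0 : ℝ), (Pi.single i 1 : Fin 2 → ℝ)))
      simp only [map_zero, add_zero] at h3
      refine h3.congr_of_eventuallyEq ?_
      exact (continuousAt_id.prodMk continuousAt_const :
        ContinuousAt (fun t : ℝ => (t, y)) 0).eventually (h.eventually_pd_eq i y)
    have h4 : Schwarzschild.pd i Φ₁ y =
        fderiv ℝ (fderiv ℝ U) (0, y) (0, Pi.single i 1) (1, 0) := by
      have : Φ₁ = fun y => fderiv ℝ U (0, y) (1, 0) := funext fun y => (h.fderiv_one y).symm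
      have h2 : HasFDerivAt (fun z : Fin 2 → ℝ => fderiv ℝ U ((0 : ℝ), z)) _ y :=
        hd.comp y (hasFDerivAt_prodMk_right (0 : ℝ) y)
      have h3 := h2.clm_apply (hasFDerivAt_const ((1 : ℝ), (0 : Fin 2 → ℝ)) y)
      rw [this, Schwarzschild.pd, h3.fderiv]
      simp
    have hsymm : IsSymmSndFDerivAt ℝ U (0, y) := (h.smooth y).isSymmSndFDerivAt
      (by simpa using (WithTop.coe_le_coe.2 le_top : ((2 : ℕ∞) : WithTop ℕ∞) ≤ ∞))
    rw [h4, hsymm.eq]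
    exact h1

end HasJet

/-! ### Derivatives of the conformal factor -/

theorem psi_zero : psi 0 = 1 := by
  norm_num [psi]

/-- The logarithmic derivative of the conformal factor of the round metric. -/
def psiLogD (i : Fin 2) (y : Fin 2 → ℝ) : ℝ := -4 * y i * (y 0 ^ 2 + y 1 ^ 2 + 4)⁻¹

theorem pd_psi (i : Fin 2) (y : Fin 2 → ℝ) : pd i psi y = psi y * psiLogD i y := by
  have hne : y 0 ^ 2 + y 1 ^ 2 + 4 ≠ 0 := by positivity
  have hd : ∀ i, HasFDerivAt (fun y : Fin 2 → ℝ => y i)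
      (ContinuousLinearMap.proj (R := ℝ) (φ := fun _ : Fin 2 => ℝ) i) y :=
    fun i => (ContinuousLinearMap.proj (R := ℝ) (φ := fun _ : Fin 2 => ℝ) i).hasFDerivAt
  have hs := ((hd 0).pow 2).add ((hd 1).pow 2)
  have hi : HasFDerivAt psi _ y := (((hasDerivAt_inv (pow_ne_zero 2 hne)).comp_hasFDerivAt y
    ((hs.add_const 4).pow 2)).const_mul 16)
  rw [pd, hi.fderiv]
  fin_cases i <;> simp [psiLogD, psi] <;> field_simp <;> ring

theorem contDiff_psiLogD (i : Fin 2) : ContDiff ℝ ∞ (psiLogD i) := by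
  have h0 : ∀ i : Fin 2, ContDiff ℝ ∞ (fun y : Fin 2 → ℝ => y i) := fun i => contDiff_apply ℝ ℝ i
  have h1 := h0 0
  have h2 := h0 1
  have h3 := h0 i
  unfold psiLogD
  refine ContDiff.mul (by fun_prop) (ContDiff.inv (by fun_prop) fun y => ?_)
  positivity

theorem psiLogD_zero (i : Fin 2) : psiLogD i 0 = 0 := by simp [psiLogD]

/-! ### Rules of calculus for coordinate derivatives. -/

section PartialDerivatives

variable {φ χ : (Fin 2 → ℝ) → ℝ} {y : Fin 2 → ℝ}

theorem pd_add (hφ : DifferentiableAt ℝ φ y) (hχ : DifferentiableAt ℝ χ y) (i : Fin 2) :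
    pd i (fun z => φ z + χ z) y = pd i φ y + pd i χ y := by
  rw [pd, fderiv_fun_add hφ hχ]
  rfl

theorem pd_sub (hφ : DifferentiableAt ℝ φ y) (hχ : DifferentiableAt ℝ χ y) (i : Fin 2) :
    pd i (fun z => φ z - χ z) y = pd i φ y - pd i χ y := by
  rw [pd, fderiv_fun_sub hφ hχ]
  rfl

theorem pd_mul (hφ : DifferentiableAt ℝ φ y) (hχ : DifferentiableAt ℝ χ y) (i : Fin 2) :
    pd i (fun z => φ z * χ z) y = pd i φ y * χ y + φ y * pd i χ y := by
  rw [pd, fderiv_fun_mul hφ hχ]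
  simp only [add_apply, smul_apply, smul_eq_mul, pd]
  ring

theorem pd_const_mul (hφ : DifferentiableAt ℝ φ y) (c : ℝ) (i : Fin 2) :
    pd i (fun z => c * φ z) y = c * pd i φ y := by
  rw [pd, fderiv_const_mul hφ]
  rfl

theorem pd_ite (P : Prop) [Decidable P] (i : Fin 2) :
    pd i (fun z => if P then φ z else 0) y = if P then pd i φ y else 0 := by
  split_ifs
  · rfl
  · exact pd_const i 0 y

end PartialDerivatives

/-- The only place where the curvature of the round sphere enters: in chart centres all first
derivatives vanish and curvature sits in this Hessian. -/
theorem pd_psiLogD_zero (i j : Fin 2) : pd i (psiLogD j) 0 = if i = j then -1 else 0 := by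
  have hd : HasFDerivAt (fun y : Fin 2 → ℝ => -4 * y j)
      ((-4 : ℝ) • ContinuousLinearMap.proj (R := ℝ) (φ := fun _ : Fin 2 => ℝ) j) 0 :=
    ((ContinuousLinearMap.proj (R := ℝ) (φ := fun _ : Fin 2 => ℝ) j).hasFDerivAt).const_mul (-4)
  have h2 : DifferentiableAt ℝ (fun y : Fin 2 → ℝ => (y 0 ^ 2 + y 1 ^ 2 + 4)⁻¹) 0 :=
    DifferentiableAt.inv (by fun_prop) (by norm_num)
  rw [show psiLogD j = fun y => (-4 * y j) * (y 0 ^ 2 + y 1 ^ 2 + 4)⁻¹ from rfl,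
    pd_mul hd.differentiableAt h2, pd, hd.fderiv]
  fin_cases i <;> fin_cases j <;> simp

/-! ### The curvature of a metric that is conformally round to first order -/

/-- The Christoffel symbols of a conformally flat metric in terms of the derivative `A` of half the
logarithm of the conformal factor. -/
def confGamma (A : Fin 2 → ℝ) (k i j : Fin 2) : ℝ :=
  1 / 2 * ((if j = k then A i else 0) + (if i = k then A j else 0) - if i = j then A k else 0)

theorem pd_confGamma {A : Fin 2 → (Fin 2 → ℝ) → ℝ} {y : Fin 2 → ℝ}
    (hA : ∀ i, DifferentiableAt ℝ (A i) y) (m k i j : Fin 2) :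
    pd m (fun z => confGamma (fun i => A i z) k i j) y = confGamma (fun i => pd m (A i) y) k i j := by
  have h : ∀ (P : Prop) [Decidable P] (i : Fin 2),
      DifferentiableAt ℝ (fun z => if P then A i z else 0) y := fun P _ i => by
    split_ifs
    · exact hA i
    · exact differentiableAt_const 0
  unfold confGamma
  rw [pd_const_mul (((h _ _).fun_add (h _ _)).fun_sub (h _ _)), pd_sub ((h _ _).fun_add (h _ _)) (h _ _),
    pd_add (h _ _) (h _ _), pd_ite, pd_ite, pd_ite]

section Conformal

variable {G : ℝ → (Fin 2 → ℝ) → Matrix (Fin 2) (Fin 2) ℝ} {κ : ℝ} (hκ : 0 < κ)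
  {D : (Fin 2 → ℝ) → ℝ} (hD : ContDiff ℝ ∞ D)
  (hG : ∀ i j, HasJet (fun t y => G t y i j) (fun y => if i = j then κ * psi y else 0)
    (fun y => if i = j then κ * psi y * D y else 0))

include hG in
theorem hasJet_det : HasJet (fun t y => (G t y).det) (fun y => (κ * psi y) ^ 2)
    (fun y => 2 * (κ * psi y) ^ 2 * D y) := by
  simp only [Matrix.det_fin_two]
  refine (((hG 0 0).mul (hG 1 1)).sub ((hG 0 1).mul (hG 1 0))).congr_jet (fun y => ?_) fun y => ?_
  · simp; ring
  · simp; ring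

include hκ hG

theorem hasJet_inv (i j : Fin 2) : HasJet (fun t y => (G t y)⁻¹ i j)
    (fun y => if i = j then (κ * psi y)⁻¹ else 0)
    (fun y => if i = j then -(κ * psi y)⁻¹ * D y else 0) := by
  have h0 : ∀ y, κ * psi y ≠ 0 := fun y => (mul_pos hκ (psi_pos y)).ne'
  have hdet := (hasJet_det hG).inv fun y => pow_ne_zero 2 (h0 y)
  have hadj : ∀ i j, HasJet (fun t y => (G t y).adjugate i j)
      (fun y => if i = j then κ * psi y else 0)
      (fun y => if i = j then κ * psi y * D y else 0) := by
    intro i j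
    fin_cases i <;> fin_cases j <;> simp only [Matrix.adjugate_fin_two]
    · exact hG 1 1
    · exact ((hG 0 1).neg).congr_jet (fun y => by simp) fun y => by simp
    · exact ((hG 1 0).neg).congr_jet (fun y => by simp) fun y => by simp
    · exact hG 0 0
  simp only [Matrix.inv_def, Ring.inverse_eq_inv', Matrix.smul_apply, smul_eq_mul]
  refine (hdet.mul (hadj i j)).congr_jet (fun y => ?_) fun y => ?_
  · have := h0 y
    split_ifs
    · field_simp
    · simp
  · have := h0 y
    split_ifs
    · field_simp
      ring
    · simp

include hD

/-- The metric is κψ(1 + tD) times the identity up to second order in t. Its Christoffel symbols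
depend linearly on the logarithmic derivative ∂ log ψ + t ∂D, from which κ drops out. -/
theorem hasJet_christoffel (k i j : Fin 2) : HasJet (fun t y => christoffel (G t) y k i j)
    (fun y => confGamma (fun i => psiLogD i y) k i j)
    (fun y => confGamma (fun i => pd i D y) k i j) := by
  have h0 : ∀ y, κ * psi y ≠ 0 := fun y => (mul_pos hκ (psi_pos y)).ne'
  unfold christoffel
  refine ((HasJet.sum fun l _ => (hasJet_inv hκ hG k l).mul
    ((((hG j l).pd i).add ((hG i l).pd j)).sub ((hG i j).pd l))).const_mul (1 / 2)).congr_jet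
      (fun y => ?_) fun y => ?_
  all_goals
    have h1 := h0 y
    have hκ0 := hκ.ne'
    have hψ0 := (psi_pos y).ne'
    have hψ : DifferentiableAt ℝ psi y := contDiff_psi.contDiffAt.differentiableAt (by simp)
    have hDd : DifferentiableAt ℝ D y := hD.contDiffAt.differentiableAt (by simp)
    simp only [pd_ite, pd_const_mul hψ, pd_mul (hψ.const_mul κ) hDd, pd_psi, Fin.sum_univ_two,
      confGamma]
  · fin_cases k <;> fin_cases i <;> fin_cases j <;> simp <;> field_simp
  · fin_cases k <;> fin_cases i <;> fin_cases j <;> simp <;> field_simp <;> ring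

/-- The conformal change formula for the Gauss curvature, to first order. At the chart centre ψ = 1
and ∂ψ = 0, so the flat Laplacian of D appears. -/
theorem hasDerivAt_gaussCurvature : gaussCurvature (G 0) 0 = κ⁻¹ ∧
    HasDerivAt (fun t => gaussCurvature (G t) 0)
      (κ⁻¹ * (-D 0 - (∑ k, pd k (pd k D) 0) / 2)) 0 := by
  have h0 : ∀ y, κ * psi y ≠ 0 := fun y => (mul_pos hκ (psi_pos y)).ne'
  have hΓ := hasJet_christoffel hκ hD hG
  have hR : ∀ l, HasJet (fun t y => curvature (G t) y l 1 0 1) _ _ := fun l =>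
    (((hΓ l 1 1).pd 0).sub ((hΓ l 0 1).pd 1)).add (HasJet.sum fun m _ =>
      ((hΓ l 0 m).mul (hΓ m 1 1)).sub ((hΓ l 1 m).mul (hΓ m 0 1)))
  have hK : HasJet (fun t y => gaussCurvature (G t) y) _ _ :=
    (HasJet.sum fun l _ => (hG 0 l).mul (hR l)).mul
      ((hasJet_det hG).inv fun y => pow_ne_zero 2 (h0 y))
  have hA : ∀ i, DifferentiableAt ℝ (psiLogD i) 0 := fun i =>
    (contDiff_psiLogD i).contDiffAt.differentiableAt (by simp)
  have hDi : ∀ i, DifferentiableAt ℝ (pd i D) 0 := fun i =>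
    (contDiff_pd hD i).contDiffAt.differentiableAt (by simp)
  have hκ0 := hκ.ne'
  constructor
  · rw [hK.zero 0]
    simp only [pd_confGamma hA, pd_psiLogD_zero, psiLogD_zero, psi_zero, Fin.sum_univ_two]
    simp [confGamma]
    field_simp
    norm_num
  · convert! hK.deriv 0 using 1
    simp only [pd_confGamma hA, pd_confGamma hDi, pd_psiLogD_zero, psiLogD_zero, psi_zero,
      Fin.sum_univ_two]
    simp [confGamma]
    field_simp
    ring

end Conformal

/-! ### First order perturbations of a round leaf -/

theorem HasJet.unique {Φ : ℝ → (Fin 2 → ℝ) → ℝ} {Φ₀ Φ₁ Ψ₀ Ψ₁ : (Fin 2 → ℝ) → ℝ}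
    (h : HasJet Φ Φ₀ Φ₁) (k : HasJet Φ Ψ₀ Ψ₁) (y : Fin 2 → ℝ) : Φ₁ y = Ψ₁ y :=
  (h.deriv y).unique (k.deriv y)

/-- The spacetime vector with the given components. -/
def vec (α β : ℝ) (ξ : Fin 2 → ℝ) : Idx → ℝ := Sum.elim ![α, β] ξ

@[simp] theorem vec_zero (α β : ℝ) (ξ : Fin 2 → ℝ) : vec α β ξ (Sum.inl 0) = α := rfl

@[simp] theorem vec_one (α β : ℝ) (ξ : Fin 2 → ℝ) : vec α β ξ (Sum.inl 1) = β := rfl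

@[simp] theorem vec_inr (α β : ℝ) (ξ : Fin 2 → ℝ) (k : Fin 2) : vec α β ξ (Sum.inr k) = ξ k := rfl

/-- The first order expansion of a vector field. -/
def HasVJet (X : ℝ → (Fin 2 → ℝ) → Idx → ℝ) (X₀ X₁ : (Fin 2 → ℝ) → Idx → ℝ) : Prop :=
  ∀ a, HasJet (fun t y => X t y a) (fun y => X₀ y a) fun y => X₁ y a

theorem hasVJet_iff {X : ℝ → (Fin 2 → ℝ) → Idx → ℝ} {α₀ α₁ β₀ β₁ : (Fin 2 → ℝ) → ℝ}
    {ξ₀ ξ₁ : (Fin 2 → ℝ) → Fin 2 → ℝ} :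
    HasVJet X (fun y => vec (α₀ y) (β₀ y) (ξ₀ y)) (fun y => vec (α₁ y) (β₁ y) (ξ₁ y)) ↔
      HasJet (fun t y => X t y (Sum.inl 0)) α₀ α₁ ∧ HasJet (fun t y => X t y (Sum.inl 1)) β₀ β₁ ∧
      ∀ k, HasJet (fun t y => X t y (Sum.inr k)) (fun y => ξ₀ y k) fun y => ξ₁ y k := by
  constructor
  · exact fun h => ⟨h _, h _, fun k => h _⟩
  · rintro ⟨h0, h1, h2⟩ (a | k)
    · fin_cases a
      exacts [h0, h1]
    · exact h2 k

theorem ip_metric (r₀ : ℝ) (p : Sph) (x v w : Idx → ℝ) : ip (metric r₀ p x) v w =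
    2 * OmegaSq r₀ (planePart x).1 (planePart x).2 *
      (v (Sum.inl 0) * w (Sum.inl 1) + v (Sum.inl 1) * w (Sum.inl 0)) +
    radius r₀ (planePart x).1 (planePart x).2 ^ 2 * psi (spherePart x) *
      ∑ k, v (Sum.inr k) * w (Sum.inr k) := by
  simp only [ip, dotProduct, Matrix.mulVec, Fintype.sum_sum_type, Fin.sum_univ_two, metric_inl_inl,
    metric_inl_inr, metric_inr_inl, metric_inr_inr]
  simp
  ring

/-- The scalar product of the unperturbed metric at a leaf of area radius `r`. -/
def bil (r : ℝ) (y : Fin 2 → ℝ) (v w : Idx → ℝ) : ℝ :=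
  2 * (v (Sum.inl 0) * w (Sum.inl 1) + v (Sum.inl 1) * w (Sum.inl 0)) +
    r ^ 2 * psi y * ∑ k, v (Sum.inr k) * w (Sum.inr k)

theorem planePart_embed (F : ℝ → Sph → ℝ × ℝ) (p : Sph) (u : ℝ) (y : Fin 2 → ℝ) :
    planePart (embed F p u y) = F u (pt p y) := rfl

theorem spherePart_embed (F : ℝ → Sph → ℝ × ℝ) (p : Sph) (u : ℝ) (y : Fin 2 → ℝ) :
    spherePart (embed F p u y) = y := rfl

/-- The first order expansion, in the chart centred at `p`, of the leaf of parameter `u` of a family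
of foliations that starts from the spherically symmetric one. -/
structure LeafJets (r₀ u : ℝ) (F : ℝ → ℝ → Sph → ℝ × ℝ) (p : Sph)
    (f b fd bd : (Fin 2 → ℝ) → ℝ) : Prop where
  pos : 0 < r₀
  nonneg : 0 ≤ u
  s : HasJet (fun t y => (F t u (pt p y)).1) (fun _ => u) f
  sb : HasJet (fun t y => (F t u (pt p y)).2) (fun _ => 0) b
  ds : HasJet (fun t y => deriv (fun v => (F t v (pt p y)).1) u) (fun _ => 1) fd
  dsb : HasJet (fun t y => deriv (fun v => (F t v (pt p y)).2) u) (fun _ => 0) bd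

/-- The perturbation of the area radius function. -/
def rho (r₀ u : ℝ) (f b : (Fin 2 → ℝ) → ℝ) (y : Fin 2 → ℝ) : ℝ := f y + u / (r₀ + u) * b y

/-- The unperturbed Christoffel symbols at a leaf. -/
def chr (r₀ u : ℝ) (y : Fin 2 → ℝ) : Idx → Idx → Idx → ℝ
  | Sum.inl a, Sum.inl b, Sum.inl c => if a = b ∧ a = c then ![0, r₀ / (r₀ + u) ^ 2] a else 0
  | Sum.inl _, Sum.inl _, Sum.inr _ => 0
  | Sum.inl _, Sum.inr _, Sum.inl _ => 0
  | Sum.inl a, Sum.inr i, Sum.inr j => if i = j then -(![u, r₀ + u] a / 2 * psi y) else 0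
  | Sum.inr _, Sum.inl _, Sum.inl _ => 0
  | Sum.inr k, Sum.inl a, Sum.inr j => if k = j then ![1 / (r₀ + u), u / (r₀ + u) ^ 2] a else 0
  | Sum.inr k, Sum.inr j, Sum.inl a => if k = j then ![1 / (r₀ + u), u / (r₀ + u) ^ 2] a else 0
  | Sum.inr k, Sum.inr i, Sum.inr j => confGamma (fun i => psiLogD i y) k i j

/-- The conformal factor is stationary at the centre, so it may be treated as constant when
differentiating once there. -/
theorem pd_inv_psi_mul {κ : ℝ} {φ : (Fin 2 → ℝ) → ℝ} (hφ : ContDiff ℝ ∞ φ) (hκ : κ ≠ 0)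
    (i : Fin 2) : pd i (fun y => -(2 * (κ * psi y)⁻¹ * φ y)) 0 = -(2 / κ * pd i φ 0) := by
  have hψ0 : ∀ y, psi y ≠ 0 := fun y => (psi_pos y).ne'
  have hi : ContDiff ℝ ∞ (fun y => (psi y)⁻¹) := contDiff_psi.inv hψ0
  have hid : DifferentiableAt ℝ (fun y => (psi y)⁻¹) 0 := hi.contDiffAt.differentiableAt (by simp)
  have hψd : DifferentiableAt ℝ psi 0 := contDiff_psi.contDiffAt.differentiableAt (by simp)
  have hφd : DifferentiableAt ℝ φ 0 := hφ.contDiffAt.differentiableAt (by simp)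
  have h1 : pd i (fun y => (psi y)⁻¹) 0 = 0 := by
    have h2 := pd_mul hψd hid i
    have h3 : (fun y => psi y * (psi y)⁻¹) = fun _ => 1 :=
      funext fun y => mul_inv_cancel₀ (hψ0 y)
    rw [h3, pd_const, pd_psi, psiLogD_zero, psi_zero] at h2
    linarith
  have h4 : (fun y => -(2 * (κ * psi y)⁻¹ * φ y)) = fun y => (-2 / κ) * ((psi y)⁻¹ * φ y) := by
    ext y
    have := hψ0 y
    field_simp
  rw [h4, pd_const_mul (hid.fun_mul hφd), pd_mul hid hφd, h1, psi_zero]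
  ring

/-! ### First order variation of the geometry of a single leaf. -/

namespace LeafJets

variable {r₀ u : ℝ} {F : ℝ → ℝ → Sph → ℝ × ℝ} {p : Sph} {f b fd bd : (Fin 2 → ℝ) → ℝ}
  (h : LeafJets r₀ u F p f b fd bd)

include h

theorem r_pos : 0 < r₀ + u := by linarith [h.pos, h.nonneg]

theorem background (y : Fin 2 → ℝ) : F 0 u (pt p y) = (u, 0) := Prod.ext (h.s.zero y) (h.sb.zero y)

theorem eventually_region (y : Fin 2 → ℝ) :
    ∀ᶠ x : ℝ × (Fin 2 → ℝ) in 𝓝 (0, y), F x.1 u (pt p x.2) ∈ region r₀ := by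
  have hc : ContinuousAt (fun x : ℝ × (Fin 2 → ℝ) => F x.1 u (pt p x.2)) (0, y) :=
    (h.s.smooth y).continuousAt.prodMk (h.sb.smooth y).continuousAt
  refine hc.eventually ((isOpen_region r₀).mem_nhds ?_)
  simp only [h.background]
  exact mem_region h.pos h.nonneg 0

theorem jet_radius : HasJet (fun t y => radius r₀ (F t u (pt p y)).1 (F t u (pt p y)).2)
    (fun _ => r₀ + u) (rho r₀ u f b) := by
  have hm := mem_region h.pos h.nonneg 0
  refine (HasJet.comp h.s h.sb (fun _ => contDiffAt_radius h.pos hm)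
    (fun _ => hasFDerivAt_radius h.pos hm)).congr_jet (fun y => ?_) fun y => ?_
  · exact radius_zero h.pos h.nonneg
  · simp [radius_zero h.pos h.nonneg, OmegaSq_zero h.pos h.nonneg, rho]

theorem jet_OmegaSq : HasJet (fun t y => OmegaSq r₀ (F t u (pt p y)).1 (F t u (pt p y)).2)
    (fun _ => 1) (fun y => r₀ / (r₀ + u) ^ 2 * b y) := by
  have hm := mem_region h.pos h.nonneg 0
  have := h.r_pos
  refine (HasJet.comp h.s h.sb (fun _ => contDiffAt_OmegaSq h.pos hm)
    (fun _ => hasFDerivAt_OmegaSq h.pos hm)).congr_jet (fun y => ?_) fun y => ?_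
  · exact OmegaSq_zero h.pos h.nonneg
  · simp [radius_zero h.pos h.nonneg, OmegaSq_zero h.pos h.nonneg, add_comm u]

theorem jet_radiusD (a : Fin 2) : HasJet (fun t y => radiusD r₀ (F t u (pt p y)) a)
    (fun _ => ![1, u / (r₀ + u)] a)
    (fun y => ![r₀ / (r₀ + u) ^ 2 * b y, r₀ / (r₀ + u) ^ 2 * rho r₀ u f b y] a) := by
  have hr := h.r_pos.ne'
  fin_cases a
  · exact h.jet_OmegaSq
  · refine ((h.jet_radius.sub (HasJet.const r₀)).mul
      (h.jet_radius.inv fun _ => hr)).congr_jet (fun y => ?_) fun y => ?_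
    · simp
      field_simp
    · simp
      field_simp
      ring

theorem jet_OmegaSqD (a : Fin 2) : ∃ g, HasJet (fun t y => OmegaSqD r₀ (F t u (pt p y)) a)
    (fun _ => ![0, r₀ / (r₀ + u) ^ 2] a) g := by
  have hr := h.r_pos.ne'
  have hr' : u + r₀ ≠ 0 := by rwa [add_comm]
  have hr₀ := h.pos.ne'
  have hRi := h.jet_radius.inv fun _ => hr
  fin_cases a
  · refine ⟨_, ((((((h.s.add (HasJet.const r₀)).inv fun _ => hr').add (HasJet.const r₀⁻¹)).sub
      (h.jet_OmegaSq.mul (hRi.add (HasJet.const r₀⁻¹)))).congr_jet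
      (fun y => ?_) fun y => rfl).congr fun y => Filter.Eventually.of_forall fun x => ?_)⟩
    · simp [add_comm]
    · simp [OmegaSqD]
  · refine ⟨_, ((((hRi.mul hRi).const_mul r₀)).congr_jet
      (fun y => ?_) fun y => rfl).congr fun y => Filter.Eventually.of_forall fun x => ?_⟩
    · simp
      field_simp
    · simp [OmegaSqD]
      ring

theorem jet_christoffel_mixed (k j a : Fin 2) : HasJet
    (fun t y => if k = j then radiusD r₀ (F t u (pt p y)) a /
      radius r₀ (F t u (pt p y)).1 (F t u (pt p y)).2 else 0)
    (fun _ => if k = j then ![1 / (r₀ + u), u / (r₀ + u) ^ 2] a else 0)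
    (fun y => if k = j then ![r₀ / (r₀ + u) ^ 3 * b y - rho r₀ u f b y / (r₀ + u) ^ 2,
      (r₀ - u) / (r₀ + u) ^ 3 * rho r₀ u f b y] a else 0) := by
  have hr := h.r_pos.ne'
  split_ifs
  · refine ((h.jet_radiusD a).mul (h.jet_radius.inv fun _ => hr)).congr_jet (fun y => ?_) fun y => ?_
    · fin_cases a <;> simp
      field_simp
    · fin_cases a <;> simp <;> field_simp <;> ring
  · exact HasJet.const 0

/-- Only the variations with middle index tangential and last index null are recorded explicitly.
The background tangent vectors have only tangential components and the background normals only null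
ones, so no other variation contributes to a covariant derivative at first order. -/
theorem jet_christoffel : ∃ Γ₁ : Idx → Idx → Idx → (Fin 2 → ℝ) → ℝ,
    (∀ a b c, HasJet (fun t y => christoffel (metric r₀ p) (embed (F t) p u y) a b c)
      (fun y => chr r₀ u y a b c) (Γ₁ a b c)) ∧
    (∀ a j c y, Γ₁ (Sum.inl a) (Sum.inr j) (Sum.inl c) y = 0) ∧
    ∀ k j a y, Γ₁ (Sum.inr k) (Sum.inr j) (Sum.inl a) y = if k = j then
      ![r₀ / (r₀ + u) ^ 3 * b y - rho r₀ u f b y / (r₀ + u) ^ 2,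
      (r₀ - u) / (r₀ + u) ^ 3 * rho r₀ u f b y] a else 0 := by
  have hr := h.r_pos.ne'
  have hex : ∀ a b c, ∃ g, HasJet (fun t y => christoffel (metric r₀ p) (embed (F t) p u y) a b c)
      (fun y => chr r₀ u y a b c) g := by
    rintro (a | a) (b | b) (c | c)
    · obtain ⟨g, hg⟩ : ∃ g, HasJet (fun t y => if a = b ∧ a = c then
          OmegaSqD r₀ (F t u (pt p y)) a else 0) (fun y => chr r₀ u y (Sum.inl a) (Sum.inl b)
            (Sum.inl c)) g := by
        simp only [chr]
        split_ifs
        · exact h.jet_OmegaSqD a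
        · exact ⟨_, HasJet.const 0⟩
      refine ⟨g, hg.congr fun y => ?_⟩
      filter_upwards [h.eventually_region y] with x hx using christoffel_lll h.pos p hx a b c
    · refine ⟨_, (HasJet.const 0).congr fun y => ?_⟩
      filter_upwards [h.eventually_region y] with x hx using christoffel_llr h.pos p hx a b c
    · refine ⟨_, (HasJet.const 0).congr fun y => ?_⟩
      filter_upwards [h.eventually_region y] with x hx using christoffel_lrl h.pos p hx a b c
    · have hj := ((((h.jet_radius.mul (h.jet_radiusD (1 - a))).mul ((h.jet_OmegaSq.const_mul 2).inv
        fun _ => by norm_num)).mul (HasJet.of_contDiff contDiff_psi))).neg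
      obtain ⟨g, hg⟩ : ∃ g, HasJet (fun t y => if b = c then
          -(radius r₀ (F t u (pt p y)).1 (F t u (pt p y)).2 * radiusD r₀ (F t u (pt p y)) (1 - a) *
            (2 * OmegaSq r₀ (F t u (pt p y)).1 (F t u (pt p y)).2)⁻¹ * psi y) else 0)
          (fun y => chr r₀ u y (Sum.inl a) (Sum.inr b) (Sum.inr c)) g := by
        simp only [chr]
        split_ifs
        · refine ⟨_, hj.congr_jet (fun y => ?_) fun y => rfl⟩
          fin_cases a <;> simp <;> field_simp <;> simp
        · exact ⟨_, HasJet.const 0⟩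
      refine ⟨g, hg.congr fun y => ?_⟩
      filter_upwards [h.eventually_region y] with x hx
      exact christoffel_lrr h.pos p hx a b c
    · refine ⟨_, (HasJet.const 0).congr fun y => ?_⟩
      filter_upwards [h.eventually_region y] with x hx using christoffel_rll h.pos p hx a b c
    · refine ⟨_, (h.jet_christoffel_mixed a c b).congr fun y => ?_⟩
      filter_upwards [h.eventually_region y] with x hx using christoffel_rlr h.pos p hx a b c
    · refine ⟨_, (h.jet_christoffel_mixed a b c).congr fun y => ?_⟩
      filter_upwards [h.eventually_region y] with x hx using christoffel_rrl h.pos p hx a b c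
    · refine ⟨_, (HasJet.of_contDiff (φ := fun y => confGamma (fun i => psiLogD i y) a b c)
        ?_).congr fun y => ?_⟩
      · have hp : ∀ (P : Prop) [Decidable P] (i : Fin 2),
            ContDiff ℝ ∞ fun y => if P then psiLogD i y else 0 := fun P _ i => by
          split_ifs
          · exact contDiff_psiLogD i
          · exact contDiff_const
        exact contDiff_const.mul (((hp _ _).add (hp _ _)).sub (hp _ _))
      · filter_upwards [h.eventually_region y] with x hx
        rw [christoffel_rrr h.pos p hx]
        have := (psi_pos x.2).ne'
        simp only [spherePart_embed, pd_psi, confGamma]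
        split_ifs <;> field_simp <;> ring
  choose Γ₁ hΓ using hex
  -- The variations were chosen abstractly; uniqueness of the first order part identifies the
  -- required ones.
  refine ⟨Γ₁, hΓ, fun a j c y => ?_, fun k j a y => ?_⟩
  · refine (hΓ _ _ _).unique ((HasJet.const 0).congr fun y => ?_) y
    filter_upwards [h.eventually_region y] with x hx using christoffel_lrl h.pos p hx a j c
  refine (hΓ _ _ _).unique ((h.jet_christoffel_mixed k j a).congr fun y => ?_) y
  filter_upwards [h.eventually_region y] with x hx using christoffel_rrl h.pos p hx k j a

theorem jet_ip {X Y : ℝ → (Fin 2 → ℝ) → Idx → ℝ} {X₀ X₁ Y₀ Y₁ : (Fin 2 → ℝ) → Idx → ℝ}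
    (hX : HasVJet X X₀ X₁) (hY : HasVJet Y Y₀ Y₁) :
    HasJet (fun t y => ip (metricAt r₀ (F t) p u y) (X t y) (Y t y))
      (fun y => bil (r₀ + u) y (X₀ y) (Y₀ y))
      (fun y => 2 * (r₀ / (r₀ + u) ^ 2 * b y) *
          (X₀ y (Sum.inl 0) * Y₀ y (Sum.inl 1) + X₀ y (Sum.inl 1) * Y₀ y (Sum.inl 0)) +
        2 * (r₀ + u) * rho r₀ u f b y * psi y * (∑ k, X₀ y (Sum.inr k) * Y₀ y (Sum.inr k)) +
        bil (r₀ + u) y (X₁ y) (Y₀ y) + bil (r₀ + u) y (X₀ y) (Y₁ y)) := by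
  simp only [metricAt, ip_metric, planePart_embed, spherePart_embed, sq]
  refine (((h.jet_OmegaSq.const_mul 2).mul (((hX (Sum.inl 0)).mul (hY (Sum.inl 1))).add
    ((hX (Sum.inl 1)).mul (hY (Sum.inl 0))))).add
    (((h.jet_radius.mul h.jet_radius).mul (HasJet.of_contDiff contDiff_psi)).mul
      (HasJet.sum fun k _ => (hX (Sum.inr k)).mul (hY (Sum.inr k))))).congr_jet
    (fun y => ?_) fun y => ?_
  · simp only [bil]
    ring
  · simp only [bil, Fin.sum_univ_two]
    ring

theorem jet_tangent (i : Fin 2) : HasVJet (fun t y => tangent (F t) p u y i)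
    (fun _ => vec 0 0 (Pi.single i 1)) (fun y => vec (pd i f y) (pd i b y) 0) := by
  rw [hasVJet_iff]
  refine ⟨(h.s.pd i).congr_jet (fun y => pd_const i u y) fun y => rfl,
    (h.sb.pd i).congr_jet (fun y => pd_const i 0 y) fun y => rfl, fun k => ?_⟩
  refine (HasJet.const _).congr fun y => Filter.Eventually.of_forall fun x => ?_
  change pd i (fun z => z k) x.2 = (Pi.single i 1 : Fin 2 → ℝ) k
  rw [pd, (hasFDerivAt_apply k x.2).fderiv]
  rfl

/-- The gradients of s and s̲ along the leaf are O(t), so the cross term ds ds̲ is of second order.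
Only the change of the area radius remains, which is conformal. -/
theorem jet_leafMetric (i j : Fin 2) : HasJet (fun t y => leafMetric r₀ (F t) p u y i j)
    (fun y => if i = j then (r₀ + u) ^ 2 * psi y else 0)
    (fun y => if i = j then (r₀ + u) ^ 2 * psi y * (2 / (r₀ + u) * rho r₀ u f b y) else 0) := by
  have hr := h.r_pos.ne'
  refine (h.jet_ip (h.jet_tangent i) (h.jet_tangent j)).congr_jet (fun y => ?_) fun y => ?_
  · fin_cases i <;> fin_cases j <;> simp [bil]
  · fin_cases i <;> fin_cases j <;> simp [bil] <;> field_simp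

theorem jet_leafMetric_inv (i j : Fin 2) : HasJet (fun t y => (leafMetric r₀ (F t) p u y)⁻¹ i j)
    (fun y => if i = j then ((r₀ + u) ^ 2 * psi y)⁻¹ else 0)
    (fun y => if i = j then -((r₀ + u) ^ 2 * psi y)⁻¹ * (2 / (r₀ + u) * rho r₀ u f b y) else 0) :=
  hasJet_inv (pow_pos h.r_pos 2) h.jet_leafMetric i j

/-- The field is normal on the background, so at first order the projection sees only the variation
of its tangential products, contracted with the unperturbed inverse metric. -/
theorem jet_normalPart {W : ℝ → (Fin 2 → ℝ) → Idx → ℝ} {α₀ α₁ β₀ β₁ : (Fin 2 → ℝ) → ℝ}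
    {ξ₀ ξ₁ e : (Fin 2 → ℝ) → Fin 2 → ℝ}
    (hW : HasVJet W (fun y => vec (α₀ y) (β₀ y) (ξ₀ y)) (fun y => vec (α₁ y) (β₁ y) (ξ₁ y)))
    (he : ∀ j, HasJet (fun t y => ip (metricAt r₀ (F t) p u y) (W t y) (tangent (F t) p u y j))
      (fun _ => 0) (fun y => e y j)) :
    HasVJet (fun t y => normalPart r₀ (F t) p u y (W t y)) (fun y => vec (α₀ y) (β₀ y) (ξ₀ y))
      (fun y => vec (α₁ y) (β₁ y) (fun k => ξ₁ y k - ((r₀ + u) ^ 2 * psi y)⁻¹ * e y k)) := by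
  intro a
  have hs := (hW a).sub (HasJet.sum fun i (_ : i ∈ Finset.univ) => HasJet.sum fun j
    (_ : j ∈ Finset.univ) => ((h.jet_leafMetric_inv i j).mul (he j)).mul (h.jet_tangent i a))
  refine (hs.congr fun y => Filter.Eventually.of_forall fun x => ?_).congr_jet
    (fun y => ?_) fun y => ?_
  · simp [normalPart]
  · simp
  · rcases a with a | k
    · fin_cases a <;> simp
    · fin_cases k <;> simp [Fin.sum_univ_two]

theorem jet_Lbar : HasVJet (fun t y => Lbar r₀ (F t) p u y) (fun _ => vec 1 0 0)
    (fun y => vec (fd y) (bd y) (fun k => -(2 * ((r₀ + u) ^ 2 * psi y)⁻¹ * pd k b y))) := by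
  have hW : HasVJet (fun t y => fun a => deriv (fun v => embed (F t) p v y a) u)
      (fun _ => vec 1 0 0) (fun y => vec (fd y) (bd y) 0) := by
    rw [hasVJet_iff]
    refine ⟨h.ds, h.dsb, fun k => ?_⟩
    refine (HasJet.const _).congr fun y => Filter.Eventually.of_forall fun x => ?_
    exact deriv_const u (x.2 k)
  have he : ∀ j, HasJet (fun t y => ip (metricAt r₀ (F t) p u y)
      (fun a => deriv (fun v => embed (F t) p v y a) u) (tangent (F t) p u y j))
      (fun _ => 0) (fun y => 2 * pd j b y) := fun j => by
    refine (h.jet_ip hW (h.jet_tangent j)).congr_jet (fun y => ?_) fun y => ?_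
    · simp [bil]
    · simp [bil]
  intro a
  refine (h.jet_normalPart hW he a).congr_jet (fun y => rfl) fun y => congrFun ?_ a
  congr 1
  ext k
  simp
  ring

theorem jet_normal : HasVJet
    (fun t y => normalPart r₀ (F t) p u y (Pi.single (Sum.inl 1) 1)) (fun _ => vec 0 1 0)
    (fun y => vec 0 0 (fun k => -(2 * ((r₀ + u) ^ 2 * psi y)⁻¹ * pd k f y))) := by
  have hW : HasVJet (fun _ _ => Pi.single (Sum.inl 1) 1)
      (fun _ => vec 0 1 0) (fun y => vec 0 0 0) := by
    rw [hasVJet_iff]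
    refine ⟨?_, ?_, fun k => ?_⟩
    · simpa using HasJet.const 0
    · simpa using HasJet.const 1
    · simpa using HasJet.const 0
  have he : ∀ j, HasJet (fun t y => ip (metricAt r₀ (F t) p u y)
      (Pi.single (Sum.inl 1) 1) (tangent (F t) p u y j))
      (fun _ => 0) (fun y => 2 * pd j f y) := fun j => by
    refine (h.jet_ip hW (h.jet_tangent j)).congr_jet (fun y => ?_) fun y => ?_
    · simp [bil]
    · simp [bil]
  intro a
  refine (h.jet_normalPart hW he a).congr_jet (fun y => rfl) fun y => congrFun ?_ a
  congr 1
  ext k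
  simp
  ring

/-- The normal part of ∂_s̲ stays null to first order, so the correction along `Lbar` drops out and
only the normalisation 2 / g(n, L) has to be expanded. -/
theorem jet_Lprime : HasVJet (fun t y => Lprime r₀ (F t) p u y) (fun _ => vec 0 1 0)
    (fun y => vec 0 (-(r₀ / (r₀ + u) ^ 2 * b y + fd y))
      (fun k => -(2 * ((r₀ + u) ^ 2 * psi y)⁻¹ * pd k f y))) := by
  have hnL : HasJet (fun t y => ip (metricAt r₀ (F t) p u y)
      (normalPart r₀ (F t) p u y (Pi.single (Sum.inl 1) 1)) (Lbar r₀ (F t) p u y))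
      (fun _ => 2) (fun y => 2 * (r₀ / (r₀ + u) ^ 2 * b y + fd y)) := by
    refine (h.jet_ip h.jet_normal h.jet_Lbar).congr_jet (fun y => ?_) fun y => ?_
    · simp [bil]
    · simp [bil]
      ring
  have hnn : HasJet (fun t y => ip (metricAt r₀ (F t) p u y)
      (normalPart r₀ (F t) p u y (Pi.single (Sum.inl 1) 1))
      (normalPart r₀ (F t) p u y (Pi.single (Sum.inl 1) 1))) (fun _ => 0) (fun _ => 0) := by
    refine (h.jet_ip h.jet_normal h.jet_normal).congr_jet (fun y => ?_) fun y => ?_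
    · simp [bil]
    · simp [bil]
  intro a
  have hj := (((hnL.inv fun _ => by norm_num).const_mul 2).mul ((h.jet_normal a).sub
    ((hnn.mul ((hnL.const_mul 2).inv fun _ => by norm_num)).mul (h.jet_Lbar a))))
  refine (hj.congr fun y => Filter.Eventually.of_forall fun x => ?_).congr_jet
    (fun y => ?_) fun y => ?_
  · simp only [Lprime, Pi.smul_apply, Pi.sub_apply, smul_eq_mul, div_eq_mul_inv]
  · simp
  · rcases a with a | k
    · fin_cases a
      · simp
      · simp
        ring
    · simp

/-- The perturbation of the null expansion of the hypersurface normal to the leaf. -/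
theorem hasDerivAt_nullity : nullity r₀ (F 0) p u = 0 ∧
    HasDerivAt (fun t => nullity r₀ (F t) p u) (4 * bd 0) 0 := by
  have hj := (h.jet_ip h.jet_Lbar h.jet_Lbar).congr_jet (Ψ₀ := fun _ => 0) (Ψ₁ := fun y => 4 * bd y)
    (fun y => by simp [bil]) (fun y => by simp [bil]; ring)
  simp only [nullity, centre_eq]
  exact ⟨hj.zero 0, hj.deriv 0⟩

/-- For fields that on the background are constant combinations of ∂_s and ∂_s̲. Both null normals
are of this form, so the one formula yields both second fundamental forms and the torsion. -/
theorem jet_covDeriv {X : ℝ → (Fin 2 → ℝ) → Idx → ℝ} {α β : ℝ} {α₁ β₁ : (Fin 2 → ℝ) → ℝ}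
    {ξ : Fin 2 → (Fin 2 → ℝ) → ℝ}
    (hX : HasVJet X (fun _ => vec α β 0) (fun y => vec (α₁ y) (β₁ y) fun k => ξ k y)) (i : Fin 2) :
    HasVJet (fun t y => covDeriv r₀ (F t) p u y i (X t))
      (fun _ => vec 0 0 fun j => if j = i then α / (r₀ + u) + u / (r₀ + u) ^ 2 * β else 0)
      (fun y => vec (pd i α₁ y - u / 2 * psi y * ξ i y)
        (pd i β₁ y - (r₀ + u) / 2 * psi y * ξ i y + r₀ / (r₀ + u) ^ 2 * β * pd i b y)
        fun j => pd i (ξ j) y + ∑ k, confGamma (fun i => psiLogD i y) j i k * ξ k y +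
          if j = i then (r₀ / (r₀ + u) ^ 3 * b y - rho r₀ u f b y / (r₀ + u) ^ 2) * α +
            α₁ y / (r₀ + u) + (r₀ - u) / (r₀ + u) ^ 3 * rho r₀ u f b y * β +
            u / (r₀ + u) ^ 2 * β₁ y else 0) := by
  obtain ⟨Γ₁, hΓ, hΓ₀, hΓ₁⟩ := h.jet_christoffel
  intro a
  have hj := ((hX a).pd i).add (HasJet.sum fun b (_ : b ∈ Finset.univ) => HasJet.sum fun c
    (_ : c ∈ Finset.univ) => ((hΓ a b c).mul (h.jet_tangent i b)).mul (hX c))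
  refine hj.congr_jet (fun y => ?_) fun y => ?_
  · rw [pd_const]
    simp only [Fintype.sum_sum_type, Fin.sum_univ_two]
    rcases a with a | j
    · fin_cases a <;> fin_cases i <;> simp [chr]
    · fin_cases j <;> fin_cases i <;> simp [chr] <;> ring
  · simp only [Fintype.sum_sum_type, Fin.sum_univ_two]
    rcases a with a | j
    · fin_cases a <;> fin_cases i <;> simp [chr, hΓ₀] <;> ring
    · fin_cases j <;> fin_cases i <;> simp [chr, hΓ₁] <;> ring

/-- The trace of the second fundamental form relative to a normal vector field. -/
theorem jet_trace {X : ℝ → (Fin 2 → ℝ) → Idx → ℝ} {α β : ℝ} {α₁ β₁ : (Fin 2 → ℝ) → ℝ}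
    {ξ : Fin 2 → (Fin 2 → ℝ) → ℝ}
    (hX : HasVJet X (fun _ => vec α β 0) (fun y => vec (α₁ y) (β₁ y) fun k => ξ k y)) :
    HasJet (fun t y => trace (leafMetric r₀ (F t) p u y) (Matrix.of fun i j =>
        ip (metricAt r₀ (F t) p u y) (covDeriv r₀ (F t) p u y i (X t)) (tangent (F t) p u y j)))
      (fun _ => 2 * (α / (r₀ + u) + u / (r₀ + u) ^ 2 * β))
      (fun y => ∑ i, (pd i (ξ i) y + ∑ k, confGamma (fun i => psiLogD i y) i i k * ξ k y) +
        2 * ((r₀ / (r₀ + u) ^ 3 * b y - rho r₀ u f b y / (r₀ + u) ^ 2) * α +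
            α₁ y / (r₀ + u) + (r₀ - u) / (r₀ + u) ^ 3 * rho r₀ u f b y * β +
            u / (r₀ + u) ^ 2 * β₁ y)) := by
  have hr := h.r_pos.ne'
  have hj := HasJet.sum fun i (_ : i ∈ Finset.univ) => HasJet.sum fun j (_ : j ∈ Finset.univ) =>
    (h.jet_leafMetric_inv i j).mul (h.jet_ip (h.jet_covDeriv hX i) (h.jet_tangent j))
  refine hj.congr_jet (fun y => ?_) fun y => ?_
  · have := (psi_pos y).ne'
    simp [bil]
    field_simp
  · have hψ := (psi_pos y).ne'
    simp only [Fin.sum_univ_two, bil, vec_zero, vec_one, vec_inr]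
    simp
    field_simp
    ring

theorem jet_torsion (i : Fin 2) :
    HasJet (fun t y => torsion r₀ (F t) p u y i) (fun _ => 0)
      (fun y => pd i fd y + u / (r₀ + u) ^ 2 * pd i b y - 1 / (r₀ + u) * pd i f y) := by
  have hr := h.r_pos.ne'
  have hj := (h.jet_ip (h.jet_covDeriv (ξ := fun k y => -(2 * ((r₀ + u) ^ 2 * psi y)⁻¹ * pd k b y))
    h.jet_Lbar i) h.jet_Lprime).const_mul (1 / 2)
  refine (hj.congr fun y => Filter.Eventually.of_forall fun x => ?_).congr_jet
    (fun y => ?_) fun y => ?_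
  · rw [torsion]
    ring
  · simp [bil]
  · have hψ := (psi_pos y).ne'
    fin_cases i <;> simp [bil] <;> field_simp <;> ring

theorem contDiff_rho : ContDiff ℝ ∞ (rho r₀ u f b) :=
  h.s.contDiff_one.add (contDiff_const.mul h.sb.contDiff_one)

/-- The perturbation of the Gauss curvature of the leaf. -/
theorem hasDerivAt_leafCurvature : leafCurvature r₀ (F 0) p u = ((r₀ + u) ^ 2)⁻¹ ∧
    HasDerivAt (fun t => leafCurvature r₀ (F t) p u)
      (-(2 * rho r₀ u f b 0 + ∑ k, pd k (pd k (rho r₀ u f b)) 0) / (r₀ + u) ^ 3) 0 := by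
  have hr := h.r_pos.ne'
  have hρ := h.contDiff_rho
  have hρd : ∀ y, DifferentiableAt ℝ (rho r₀ u f b) y := fun y =>
    hρ.contDiffAt.differentiableAt (by simp)
  have hK := hasDerivAt_gaussCurvature (pow_pos h.r_pos 2)
    (contDiff_const.mul hρ : ContDiff ℝ ∞ fun y => 2 / (r₀ + u) * rho r₀ u f b y) h.jet_leafMetric
  simp only [leafCurvature, centre_eq]
  refine ⟨hK.1, ?_⟩
  convert! hK.2 using 1
  have h1 : ∀ k, pd k (fun y => 2 / (r₀ + u) * rho r₀ u f b y) =
      fun y => 2 / (r₀ + u) * pd k (rho r₀ u f b) y := fun k =>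
    funext fun y => pd_const_mul (hρd y) _ k
  have h2 : ∀ k, DifferentiableAt ℝ (pd k (rho r₀ u f b)) 0 := fun k =>
    (contDiff_pd hρ k).contDiffAt.differentiableAt (by simp)
  simp only [h1, pd_const_mul (h2 _), ← Finset.mul_sum]
  field_simp
  ring

theorem jet_trace_chiBar : trace (leafMetric r₀ (F 0) p u 0) (chiBar r₀ (F 0) p u 0) =
      2 / (r₀ + u) ∧
    HasDerivAt (fun t => trace (leafMetric r₀ (F t) p u 0) (chiBar r₀ (F t) p u 0))
      (-(2 / (r₀ + u) ^ 2 * ∑ k, pd k (pd k b) 0) + 2 * (r₀ / (r₀ + u) ^ 3 * b 0 -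
        rho r₀ u f b 0 / (r₀ + u) ^ 2 + fd 0 / (r₀ + u) + u / (r₀ + u) ^ 2 * bd 0)) 0 := by
  have hj := h.jet_trace (ξ := fun k y => -(2 * ((r₀ + u) ^ 2 * psi y)⁻¹ * pd k b y)) h.jet_Lbar
  have hr := pow_ne_zero 2 h.r_pos.ne'
  constructor
  · refine (hj.zero 0).trans ?_
    ring
  · refine (hj.deriv 0).congr_deriv ?_
    simp only [pd_inv_psi_mul (contDiff_pd h.sb.contDiff_one _) hr, psiLogD_zero, Fin.sum_univ_two]
    simp [confGamma]
    ring

theorem jet_trace_chiPrime : trace (leafMetric r₀ (F 0) p u 0) (chiPrime r₀ (F 0) p u 0) =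
      2 * u / (r₀ + u) ^ 2 ∧
    HasDerivAt (fun t => trace (leafMetric r₀ (F t) p u 0) (chiPrime r₀ (F t) p u 0))
      (-(2 / (r₀ + u) ^ 2 * ∑ k, pd k (pd k f) 0) + 2 * ((r₀ - u) / (r₀ + u) ^ 3 *
        rho r₀ u f b 0 - u / (r₀ + u) ^ 2 * (r₀ / (r₀ + u) ^ 2 * b 0 + fd 0))) 0 := by
  have hj := h.jet_trace (ξ := fun k y => -(2 * ((r₀ + u) ^ 2 * psi y)⁻¹ * pd k f y))
    (α₁ := fun _ => 0) h.jet_Lprime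
  have hr := pow_ne_zero 2 h.r_pos.ne'
  constructor
  · refine (hj.zero 0).trans ?_
    ring
  · refine (hj.deriv 0).congr_deriv ?_
    simp only [pd_inv_psi_mul (contDiff_pd h.s.contDiff_one _) hr, psiLogD_zero, Fin.sum_univ_two]
    simp [confGamma]
    ring

/-- The torsion vanishes on the background, so neither the inverse metric nor the connection needs
to be varied. At the chart centre the divergence is the flat one, scaled by r⁻². -/
theorem jet_divergence : divergence (leafMetric r₀ (F 0) p u) (torsion r₀ (F 0) p u) 0 = 0 ∧
    HasDerivAt (fun t => divergence (leafMetric r₀ (F t) p u) (torsion r₀ (F t) p u) 0)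
      ((∑ k, pd k (pd k fd) 0 + u / (r₀ + u) ^ 2 * ∑ k, pd k (pd k b) 0 -
        1 / (r₀ + u) * ∑ k, pd k (pd k f) 0) / (r₀ + u) ^ 2) 0 := by
  have hr := h.r_pos.ne'
  have hΓ := hasJet_christoffel (pow_pos h.r_pos 2)
    (contDiff_const.mul h.contDiff_rho : ContDiff ℝ ∞ fun y => 2 / (r₀ + u) * rho r₀ u f b y)
    h.jet_leafMetric
  have hj := HasJet.sum fun i (_ : i ∈ Finset.univ) => HasJet.sum fun j (_ : j ∈ Finset.univ) =>
    (h.jet_leafMetric_inv i j).mul (((h.jet_torsion j).pd i).sub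
      (HasJet.sum fun k (_ : k ∈ Finset.univ) => (hΓ k i j).mul (h.jet_torsion k)))
  have hd : ∀ {φ : (Fin 2 → ℝ) → ℝ}, ContDiff ℝ ∞ φ → ∀ k, DifferentiableAt ℝ (pd k φ) 0 :=
    fun hφ k => (contDiff_pd hφ k).contDiffAt.differentiableAt (by simp)
  have hf := hd h.s.contDiff_one
  have hb := hd h.sb.contDiff_one
  have hfd := hd h.ds.contDiff_one
  have hpd : ∀ i j, pd i (fun y => pd j fd y + u / (r₀ + u) ^ 2 * pd j b y -
      1 / (r₀ + u) * pd j f y) 0 = pd i (pd j fd) 0 + u / (r₀ + u) ^ 2 * pd i (pd j b) 0 -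
      1 / (r₀ + u) * pd i (pd j f) 0 := fun i j => by
    rw [pd_sub ((hfd j).fun_add ((hb j).const_mul _)) ((hf j).const_mul _),
      pd_add (hfd j) ((hb j).const_mul _), pd_const_mul (hb j), pd_const_mul (hf j)]
  constructor
  · refine (hj.zero 0).trans ?_
    simp
  · refine (hj.deriv 0).congr_deriv ?_
    simp only [hpd, pd_const, psiLogD_zero, psi_zero, Fin.sum_univ_two]
    simp [confGamma]
    field_simp
    ring

/-- The perturbation of the mass aspect function of a leaf in a null hypersurface. -/
theorem hasDerivAt_massAspect (hbd : bd 0 = 0) :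
    massAspect r₀ (F 0) p u = r₀ / (r₀ + u) ^ 3 ∧
    HasDerivAt (fun t => massAspect r₀ (F t) p u)
      (-(3 * r₀ / (r₀ + u) ^ 4 * rho r₀ u f b 0) -
        (∑ k, pd k (pd k (rho r₀ u f b)) 0) / (r₀ + u) ^ 3 +
        2 / (r₀ + u) ^ 3 * ∑ k, pd k (pd k f) 0 - (∑ k, pd k (pd k fd) 0) / (r₀ + u) ^ 2) 0 := by
  have hr := h.r_pos.ne'
  obtain ⟨hK, hK'⟩ := h.hasDerivAt_leafCurvature
  obtain ⟨h1, h1'⟩ := h.jet_trace_chiBar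
  obtain ⟨h2, h2'⟩ := h.jet_trace_chiPrime
  obtain ⟨h3, h3'⟩ := h.jet_divergence
  simp only [massAspect, centre_eq]
  constructor
  · rw [hK, h1, h2, h3]
    field_simp
    ring
  · refine ((hK'.sub ((h2'.mul h1').div_const 4)).sub h3').congr_deriv ?_
    rw [h1, h2, hbd]
    field_simp
    ring

end LeafJets

/-! ### First order expansions of smooth families of foliations -/

section Slice

variable {Q : (ℝ × ℝ) × E3 → ℝ} {U : Set ((ℝ × ℝ) × E3)}

theorem contDiffOn_fderiv_apply {E : Type*} [NormedAddCommGroup E] [NormedSpace ℝ E] {Q : E → ℝ}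
    {U : Set E} (hU : IsOpen U) (hQ : ContDiffOn ℝ ∞ Q U) (e : E) :
    ContDiffOn ℝ ∞ (fun x => fderiv ℝ Q x e) U :=
  (hQ.fderiv_of_isOpen hU (by simp)).clm_apply contDiffOn_const

theorem hasDerivAt_slice_fst (hU : IsOpen U) (hQ : ContDiffOn ℝ ∞ Q U) {t v : ℝ} {z : E3}
    (hx : ((t, v), z) ∈ U) :
    HasDerivAt (fun s => Q ((s, v), z)) (fderiv ℝ Q ((t, v), z) ((1, 0), 0)) t :=
  (((hQ.contDiffAt (hU.mem_nhds hx)).differentiableAt (by simp)).hasFDerivAt).comp_hasDerivAt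
    (f := fun s : ℝ => ((s, v), z)) t
    (((hasDerivAt_id t).prodMk (hasDerivAt_const t v)).prodMk (hasDerivAt_const t z))

theorem hasDerivAt_slice_snd (hU : IsOpen U) (hQ : ContDiffOn ℝ ∞ Q U) {t v : ℝ} {z : E3}
    (hx : ((t, v), z) ∈ U) :
    HasDerivAt (fun s => Q ((t, s), z)) (fderiv ℝ Q ((t, v), z) ((0, 1), 0)) v :=
  (((hQ.contDiffAt (hU.mem_nhds hx)).differentiableAt (by simp)).hasFDerivAt).comp_hasDerivAt
    (f := fun s : ℝ => ((t, s), z)) v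
    (((hasDerivAt_const v t).prodMk (hasDerivAt_id v)).prodMk (hasDerivAt_const v z))

theorem hasJet_slice (hU : IsOpen U) (hQ : ContDiffOn ℝ ∞ Q U) {v : ℝ} {p : Sph}
    (hv : ∀ y, ((0, v), (pt p y : E3)) ∈ U) :
    HasJet (fun t y => Q ((t, v), (pt p y : E3))) (fun y => Q ((0, v), (pt p y : E3)))
      (fun y => fderiv ℝ Q ((0, v), (pt p y : E3)) ((1, 0), 0)) where
  smooth y := by
    refine ContDiffAt.comp (g := Q) (f := fun x : ℝ × (Fin 2 → ℝ) => ((x.1, v), (pt p x.2 : E3)))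
      (0, y) (hQ.contDiffAt (hU.mem_nhds (hv y))) ?_
    exact (contDiffAt_fst.prodMk contDiffAt_const).prodMk
      ((contDiff_pt p).contDiffAt.comp (0, y) contDiffAt_snd)
  zero _ := rfl
  deriv y := hasDerivAt_slice_fst hU hQ (hv y)

theorem fderiv_slice_comm (hU : IsOpen U) (hQ : ContDiffOn ℝ ∞ Q U) {x : (ℝ × ℝ) × E3} (hx : x ∈ U)
    (e e' : (ℝ × ℝ) × E3) :
    fderiv ℝ (fun z => fderiv ℝ Q z e) x e' = fderiv ℝ (fun z => fderiv ℝ Q z e') x e := by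
  have h1 := hQ.contDiffAt (hU.mem_nhds hx)
  have hd : DifferentiableAt ℝ (fderiv ℝ Q) x :=
    ((hQ.fderiv_of_isOpen hU (m := ∞) (by simp)).contDiffAt
      (hU.mem_nhds hx)).differentiableAt (by simp)
  have hs : IsSymmSndFDerivAt ℝ Q x := h1.isSymmSndFDerivAt
    (by simpa using (WithTop.coe_le_coe.2 le_top : ((2 : ℕ∞) : WithTop ℕ∞) ≤ ∞))
  have h2 : ∀ a b, fderiv ℝ (fun z => fderiv ℝ Q z a) x b = fderiv ℝ (fderiv ℝ Q) x b a := by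
    intro a b
    have h3 : HasFDerivAt (fun z => fderiv ℝ Q z a) _ x :=
      hd.hasFDerivAt.clm_apply (hasFDerivAt_const a x)
    rw [h3.fderiv]
    simp
  rw [h2, h2, hs.eq]

end Slice

/-- The first order part, `f` and `b`, of a smooth family of families of spheres
`(s, s̲) = F t u ϑ`, with its derivatives `fd`, `bd` in `u`. -/
structure FirstOrder (r₀ : ℝ) (F : ℝ → ℝ → Sph → ℝ × ℝ) (f b fd bd : ℝ → SmoothFun) : Prop where
  jets : ∀ u, 0 ≤ u → ∀ p, LeafJets r₀ u F p (fun y => f u (pt p y)) (fun y => b u (pt p y))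
    (fun y => fd u (pt p y)) (fun y => bd u (pt p y))
  deriv_f : ∀ u, 0 ≤ u → ∀ p, HasDerivAt (fun v => f v p) (fd u p) u
  deriv_b : ∀ u, 0 ≤ u → ∀ p, HasDerivAt (fun v => b v p) (bd u p) u
  deriv_integral_f : ∀ u, 0 ≤ u → ∀ Y : SmoothFun,
    HasDerivAt (fun v => ∫ p, f v p * Y p ∂surf) (∫ p, fd u p * Y p ∂surf) u

/-- The domain of smoothness of a family of families of spheres, extended to `ℝ³`. -/
def paramDomain (ε : ℝ) : Set ((ℝ × ℝ) × E3) := (Set.Ioo (-ε) ε ×ˢ Set.Ioi (-ε)) ×ˢ {0}ᶜ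

theorem isOpen_paramDomain (ε : ℝ) : IsOpen (paramDomain ε) :=
  (isOpen_Ioo.prod isOpen_Ioi).prod isOpen_compl_singleton

theorem mem_paramDomain {ε t v : ℝ} {p : Sph} (ht : t ∈ Set.Ioo (-ε) ε) (hv : -ε < v) :
    ((t, v), (p : E3)) ∈ paramDomain ε := ⟨⟨ht, hv⟩, sphere_ne_zero p⟩

/-- The first order part of a smooth family of functions on the sphere. -/
theorem exists_firstOrder_scalar {G : ℝ → ℝ → Sph → ℝ} {ε : ℝ} (hε : 0 < ε)
    (hG : ContDiffOn ℝ ∞ (fun x : (ℝ × ℝ) × E3 => G x.1.1 x.1.2 (nrm x.2)) (paramDomain ε)) :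
    ∃ g gd : ℝ → SmoothFun, ∀ v, -ε < v →
      (∀ p, HasJet (fun t y => G t v (pt p y)) (fun y => G 0 v (pt p y)) fun y => g v (pt p y)) ∧
      (∀ p, HasJet (fun t y => deriv (fun w => G t w (pt p y)) v)
        (fun y => deriv (fun w => G 0 w (pt p y)) v) fun y => gd v (pt p y)) ∧
      (∀ p, HasDerivAt (fun w => G 0 w p) (deriv (fun w => G 0 w p) v) v) ∧
      (∀ p, HasDerivAt (fun w => g w p) (gd v p) v) ∧
      ∀ Y : SmoothFun, HasDerivAt (fun v => ∫ p, g v p * Y p ∂surf) (∫ p, gd v p * Y p ∂surf) v := by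
  classical
  set Q : (ℝ × ℝ) × E3 → ℝ := fun x => G x.1.1 x.1.2 (nrm x.2) with hQdef
  have hU := isOpen_paramDomain ε
  have h0 : (0 : ℝ) ∈ Set.Ioo (-ε) ε := ⟨by linarith, hε⟩
  have hQp : ∀ t v (p : Sph), Q ((t, v), (p : E3)) = G t v p := fun t v p => by simp [hQdef]
  set DT : (ℝ × ℝ) × E3 → ℝ := fun x => fderiv ℝ Q x ((1, 0), 0) with hDT
  set DU : (ℝ × ℝ) × E3 → ℝ := fun x => fderiv ℝ Q x ((0, 1), 0) with hDU
  have cT : ContDiffOn ℝ ∞ DT (paramDomain ε) := contDiffOn_fderiv_apply hU hG _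
  have cU : ContDiffOn ℝ ∞ DU (paramDomain ε) := contDiffOn_fderiv_apply hU hG _
  set DD : (ℝ × ℝ) × E3 → ℝ := fun x => fderiv ℝ DU x ((1, 0), 0) with hDD
  have cD : ContDiffOn ℝ ∞ DD (paramDomain ε) := contDiffOn_fderiv_apply hU cU _
  -- The functions on the sphere are indexed by all real v; outside the domain of smoothness the
  -- value is 0 by default.
  have hsm : ∀ {D : (ℝ × ℝ) × E3 → ℝ}, ContDiffOn ℝ ∞ D (paramDomain ε) → ∃ g : ℝ → SmoothFun,
      ∀ v, -ε < v → ∀ p : Sph, g v p = D ((0, v), (p : E3)) := by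
    intro D hD
    have : ∀ v, ∃ g : SmoothFun, -ε < v → ∀ p : Sph, g p = D ((0, v), (p : E3)) := by
      intro v
      by_cases hv : -ε < v
      · refine ⟨⟨fun p => D ((0, v), (p : E3)), ?_⟩, fun _ p => rfl⟩
        refine contMDiff_restrict (Ψ := fun z => D ((0, v), z)) ?_
        refine hD.comp (contDiffOn_const.prodMk contDiffOn_id) fun z hz => ⟨⟨h0, hv⟩, hz⟩
      · exact ⟨0, fun h => absurd h hv⟩
    choose g hg using this
    exact ⟨g, hg⟩
  obtain ⟨g, hg⟩ := hsm cT
  obtain ⟨gd, hgd⟩ := hsm cD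
  have hdu : ∀ {t v : ℝ}, t ∈ Set.Ioo (-ε) ε → -ε < v → ∀ p : Sph,
      HasDerivAt (fun w => G t w p) (DU ((t, v), (p : E3))) v := by
    intro t v ht hv p
    have := hasDerivAt_slice_snd hU hG (mem_paramDomain (p := p) ht hv)
    simpa only [hQp, nrm_sphere] using this
  have hgder : ∀ v, -ε < v → ∀ p, HasDerivAt (fun w => g w p) (gd v p) v := by
    intro v hv p
    have h1 := hasDerivAt_slice_snd hU cT (mem_paramDomain (p := p) h0 hv)
    -- Interchanging ∂_u and ∂_t identifies the u-derivative of the first order part with the first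
    -- order part of the u-derivative.
    rw [hDT, fderiv_slice_comm hU hG (mem_paramDomain (p := p) h0 hv)] at h1
    rw [hgd v hv]
    refine h1.congr_of_eventuallyEq ?_
    filter_upwards [lt_mem_nhds hv] with w hw using hg w hw p
  refine ⟨g, gd, fun v hv => ⟨fun p => ?_, fun p => ?_, fun p => ?_, hgder v hv, fun Y => ?_⟩⟩
  · have := hasJet_slice hU hG (v := v) (p := p) fun y => mem_paramDomain h0 hv
    simp only [hg v hv]
    simpa only [hQp, nrm_sphere] using this
  · have hj := hasJet_slice hU cU (v := v) (p := p) fun y => mem_paramDomain h0 hv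
    simp only [hgd v hv]
    refine (hj.congr fun y => ?_).congr_jet (fun y => ((hdu h0 hv _).deriv).symm) fun y => rfl
    have : ∀ᶠ x : ℝ × (Fin 2 → ℝ) in 𝓝 (0, y), x.1 ∈ Set.Ioo (-ε) ε :=
      continuousAt_fst.eventually (isOpen_Ioo.mem_nhds h0)
    filter_upwards [this] with x hx using (hdu hx hv _).deriv
  · exact (hdu h0 hv p).differentiableAt.hasDerivAt
  · refine hasDerivAt_integral_sphere (Φ := fun v p => g v p * Y p)
      (Φ' := fun v p => gd v p * Y p) (U := Set.Ioi (-ε)) (lt_mem_nhds hv) (fun w hw => ?_) ?_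
      fun w hw p => (hgder w hw p).mul_const _
    · exact (g w).contMDiff.continuous.mul Y.contMDiff.continuous
    · have h1 : ContinuousOn (fun x : ℝ × Sph => DD ((0, x.1), (x.2 : E3)))
          (Set.Ioi (-ε) ×ˢ Set.univ) :=
        cD.continuousOn.comp (by fun_prop) fun x hx => mem_paramDomain h0 hx.1
      refine (h1.congr fun x hx => hgd x.1 hx.1 x.2).mul ?_
      exact (Y.contMDiff.continuous.comp continuous_snd).continuousOn

/-- The families are prescribed only for u ≥ 0, so at u = 0 a derivative must be identified from one
side. -/
theorem deriv_unique_Ici {φ ψ : ℝ → ℝ} {a b u : ℝ} (h : HasDerivAt φ a u) (k : HasDerivAt ψ b u)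
    (he : ∀ v, u ≤ v → φ v = ψ v) : a = b := by
  have h1 := h.hasDerivWithinAt (s := Set.Ici u)
  have h2 := (k.hasDerivWithinAt (s := Set.Ici u)).congr (fun v hv => he v hv) (he u le_rfl)
  exact (uniqueDiffOn_Ici u u Set.self_mem_Ici).eq_deriv _ h1 h2

/-- The first order part of a smooth family of families of spheres that starts from the spherically
symmetric foliation. -/
theorem exists_firstOrder {r₀ : ℝ} (hr₀ : 0 < r₀) {F : ℝ → ℝ → Sph → ℝ × ℝ}
    (smooth : ∃ ε > 0, ContMDiffOn (𝓘(ℝ, ℝ × ℝ).prod (𝓡 2)) 𝓘(ℝ, ℝ × ℝ) ∞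
      (fun x : (ℝ × ℝ) × Sph => F x.1.1 x.1.2 x.2)
      ((Set.Ioo (-ε) ε ×ˢ Set.Ioi (-ε)) ×ˢ Set.univ))
    (background : ∀ u, 0 ≤ u → ∀ p, F 0 u p = sphericalFoliation u p) :
    ∃ f b fd bd : ℝ → SmoothFun, FirstOrder r₀ F f b fd bd := by
  obtain ⟨ε, hε, hF⟩ := smooth
  have hc := contDiffOn_comp_nrm hF
  obtain ⟨f, fd, hf⟩ := exists_firstOrder_scalar (G := fun t u p => (F t u p).1) hε hc.fst
  obtain ⟨b, bd, hb⟩ := exists_firstOrder_scalar (G := fun t u p => (F t u p).2) hε hc.snd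
  refine ⟨f, b, fd, bd, fun u hu p => ⟨hr₀, hu, ?_, ?_, ?_, ?_⟩, fun u hu p => ?_, fun u hu p => ?_,
    fun u hu Y => ?_⟩
  all_goals obtain ⟨hf1, hf2, hf3, hf4, hf5⟩ := hf u (by linarith)
  all_goals obtain ⟨hb1, hb2, hb3, hb4, hb5⟩ := hb u (by linarith)
  · exact (hf1 p).congr_jet (fun y => by rw [background u hu]; rfl) fun y => rfl
  · exact (hb1 p).congr_jet (fun y => by rw [background u hu]; rfl) fun y => rfl
  · refine (hf2 p).congr_jet (fun y => ?_) fun y => rfl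
    exact deriv_unique_Ici (hf3 _) (hasDerivAt_id u) fun v hv => by
      rw [background v (hu.trans hv)]; rfl
  · refine (hb2 p).congr_jet (fun y => ?_) fun y => rfl
    exact deriv_unique_Ici (hb3 _) (hasDerivAt_const u 0) fun v hv => by
      rw [background v (hu.trans hv)]; rfl
  · exact hf4 p
  · exact hb4 p
  · exact hf5 Y

/-! ### The area of a leaf -/

/-- Differentiation under the integral sign over the sphere, at an isolated parameter. -/
theorem hasDerivAt_integral_of_contDiffAt {A : ℝ × E3 → ℝ}
    (hA : ∀ q : Sph, ContDiffAt ℝ 1 A (0, (q : E3))) :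
    HasDerivAt (fun t => ∫ q : Sph, A (t, (q : E3)) ∂surf)
      (∫ q : Sph, fderiv ℝ A (0, (q : E3)) (1, 0) ∂surf) 0 := by
  have hcoe : Continuous fun x : ℝ × Sph => (x.1, (x.2 : E3)) := by fun_prop
  -- Compactness of the sphere turns pointwise neighbourhoods into a single interval in t valid for
  -- all points.
  have hev : ∀ᶠ t in 𝓝 (0 : ℝ), ∀ q ∈ (Set.univ : Set Sph), ContDiffAt ℝ 1 A (t, (q : E3)) := by
    refine isCompact_univ.eventually_forall_of_forall_eventually
      (P := fun t (q : Sph) => ContDiffAt ℝ 1 A (t, (q : E3))) fun q _ => ?_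
    have h1 : ∀ᶠ z in 𝓝 ((0 : ℝ), (q : E3)), ContDiffAt ℝ 1 A z := (hA q).eventually (by simp)
    exact (hcoe.continuousAt (x := ((0 : ℝ), q))).eventually h1
  refine hasDerivAt_integral_sphere (Φ := fun t q => A (t, (q : E3)))
    (Φ' := fun t q => fderiv ℝ A (t, (q : E3)) (1, 0)) (U := {t | ∀ q : Sph,
      ContDiffAt ℝ 1 A (t, (q : E3))}) (hev.mono fun t ht q => ht q trivial)
      (fun t ht => ?_) ?_ fun t ht p => ?_
  · rw [continuous_iff_continuousAt]
    intro q
    exact ContinuousAt.comp (g := A) (f := fun q : Sph => (t, (q : E3))) (ht q).continuousAt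
      (by fun_prop)
  · rintro ⟨t, q⟩ ⟨ht, -⟩
    have h1 : ContinuousAt (fun z => fderiv ℝ A z (1, 0)) (t, (q : E3)) :=
      (((ht q).fderiv_right (m := 0) (by simp)).continuousAt).clm_apply continuousAt_const
    exact (ContinuousAt.comp (g := fun z => fderiv ℝ A z (1, 0))
      (f := fun x : ℝ × Sph => (x.1, (x.2 : E3))) (x := (t, q)) h1
        hcoe.continuousAt).continuousWithinAt
  · exact (((ht p).differentiableAt (by simp)).hasFDerivAt).comp_hasDerivAt
      (f := fun s : ℝ => (s, (p : E3))) t ((hasDerivAt_id t).prodMk (hasDerivAt_const t (p : E3)))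

/-- The scalar product of the differentials of two smooth functions on the sphere. -/
theorem sum_fderiv_frame {S B : Sph → ℝ} (hS : ContMDiff (𝓡 2) 𝓘(ℝ, ℝ) ∞ S)
    (q : Sph) :
    ∑ i, fderiv ℝ (ext S) q (frame q i) * fderiv ℝ (ext B) q (frame q i) =
      ∑ k, fderiv ℝ (ext S) q (EuclideanSpace.single k 1) *
        fderiv ℝ (ext B) q (EuclideanSpace.single k 1) := by
  have h1 : ∀ v : E3, fderiv ℝ (ext S) q v =
      ∑ i, inner ℝ (frame q i) v * fderiv ℝ (ext S) q (frame q i) := by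
    intro v
    have h2 := sum_frame q (v := v - inner ℝ (q : E3) v • (q : E3)) (by
      rw [inner_sub_right, inner_smul_right, inner_self_sphere]
      ring)
    have h3 := congrArg (fderiv ℝ (ext S) q) h2
    have h4 : ∀ k, inner ℝ (frame q k) (q : E3) = 0 := fun k => by
      rw [real_inner_comm, inner_frame_point]
    simp only [map_sub, map_smul, map_sum, fderiv_ext_self hS (sphere_ne_zero q),
      sub_zero, inner_sub_right, inner_smul_right, h4, mul_zero, smul_eq_mul] at h3
    exact h3
  have h2 : ∀ v : E3, v = ∑ k, v k • EuclideanSpace.single k (1 : ℝ) := by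
    intro v
    ext k
    simp [Pi.single_apply]
  have h3 : ∀ i, fderiv ℝ (ext B) q (frame q i) =
      ∑ k, frame q i k * fderiv ℝ (ext B) q (EuclideanSpace.single k 1) := by
    intro i
    conv_lhs => rw [h2 (frame q i)]
    simp only [map_sum, map_smul, smul_eq_mul]
  have h4 : ∀ k, fderiv ℝ (ext S) q (EuclideanSpace.single k 1) =
      ∑ i, frame q i k * fderiv ℝ (ext S) q (frame q i) := by
    intro k
    rw [h1]
    refine Finset.sum_congr rfl fun i _ => ?_
    simp [EuclideanSpace.inner_single_right]
  simp only [h3, h4, Finset.mul_sum, Finset.sum_mul]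
  rw [Finset.sum_comm]
  refine Finset.sum_congr rfl fun k _ => Finset.sum_congr rfl fun i _ => ?_
  ring

theorem leafMetric_centre {r₀ : ℝ} {F : ℝ → Sph → ℝ × ℝ} (q : Sph) (u : ℝ)
    (hS : ContMDiff (𝓡 2) 𝓘(ℝ, ℝ) ∞ fun p => (F u p).1)
    (hB : ContMDiff (𝓡 2) 𝓘(ℝ, ℝ) ∞ fun p => (F u p).2) (i j : Fin 2) :
    leafMetric r₀ F q u 0 i j = 2 * OmegaSq r₀ (F u q).1 (F u q).2 *
      (fderiv ℝ (ext fun p => (F u p).1) q (frame q i) *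
        fderiv ℝ (ext fun p => (F u p).2) q (frame q j) +
      fderiv ℝ (ext fun p => (F u p).2) q (frame q i) *
        fderiv ℝ (ext fun p => (F u p).1) q (frame q j)) +
      if i = j then radius r₀ (F u q).1 (F u q).2 ^ 2 else 0 := by
  have h0 : ∀ i, tangent F q u 0 i (Sum.inl 0) =
      fderiv ℝ (ext fun p => (F u p).1) q (frame q i) := fun i => pd_comp_pt_zero hS q i
  have h1 : ∀ i, tangent F q u 0 i (Sum.inl 1) =
      fderiv ℝ (ext fun p => (F u p).2) q (frame q i) := fun i => pd_comp_pt_zero hB q i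
  have h2 : ∀ i k, tangent F q u 0 i (Sum.inr k) = (Pi.single i 1 : Fin 2 → ℝ) k := by
    intro i k
    change pd i (fun z => z k) 0 = (Pi.single i 1 : Fin 2 → ℝ) k
    rw [pd, (hasFDerivAt_apply k (0 : Fin 2 → ℝ)).fderiv]
    rfl
  simp only [leafMetric, Matrix.of_apply, metricAt, ip_metric, planePart_embed, spherePart_embed,
    pt_zero, psi_zero, h0, h1, h2]
  fin_cases i <;> fin_cases j <;> simp

/-- The square of the area density of the graph of `(s, s̲)` over the sphere. -/
def areaDensitySq (r₀ s sb : ℝ) (ds dsb : Fin 3 → ℝ) : ℝ :=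
  radius r₀ s sb ^ 4 + 4 * OmegaSq r₀ s sb * radius r₀ s sb ^ 2 * ∑ k, ds k * dsb k -
    4 * OmegaSq r₀ s sb ^ 2 * ((∑ k, ds k * ds k) * (∑ k, dsb k * dsb k) -
      (∑ k, ds k * dsb k) ^ 2)

/-- The stereographic frame at q is chosen separately for each point, with no continuity known in q.
Rewriting the density through the standard basis of ℝ³ makes it a smooth function of q, as needed to
differentiate the area integral. -/
theorem det_leafMetric_div {r₀ : ℝ} {F : ℝ → Sph → ℝ × ℝ} (q : Sph) (u : ℝ)
    (hS : ContMDiff (𝓡 2) 𝓘(ℝ, ℝ) ∞ fun p => (F u p).1)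
    (hB : ContMDiff (𝓡 2) 𝓘(ℝ, ℝ) ∞ fun p => (F u p).2) :
    (leafMetric r₀ F q u (centre q)).det / (roundMetric q (centre q)).det =
      areaDensitySq r₀ (F u q).1 (F u q).2
        (fun k => fderiv ℝ (ext fun p => (F u p).1) q (EuclideanSpace.single k 1))
        (fun k => fderiv ℝ (ext fun p => (F u p).2) q (EuclideanSpace.single k 1)) := by
  have hround : (roundMetric q 0).det = 1 := by simp [roundMetric_eq, psi_zero]
  rw [centre_eq, hround, div_one, Matrix.det_fin_two]
  simp only [leafMetric_centre q u hS hB, areaDensitySq, ← sum_fderiv_frame hS,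
    ← sum_fderiv_frame hB]
  simp
  ring

theorem sqrt_mul_self_pow {r : ℝ} (hr : 0 < r) : Real.sqrt ((r ^ 2) ^ 2) = r ^ 2 :=
  Real.sqrt_sq (by positivity)

/-- The perturbation of the area of a leaf. -/
theorem FirstOrder.hasDerivAt_leafArea {r₀ : ℝ} (hr₀ : 0 < r₀) {F : ℝ → ℝ → Sph → ℝ × ℝ}
    (smooth : ∃ ε > 0, ContMDiffOn (𝓘(ℝ, ℝ × ℝ).prod (𝓡 2)) 𝓘(ℝ, ℝ × ℝ) ∞
      (fun x : (ℝ × ℝ) × Sph => F x.1.1 x.1.2 x.2)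
      ((Set.Ioo (-ε) ε ×ˢ Set.Ioi (-ε)) ×ˢ Set.univ))
    {f b fd bd : ℝ → SmoothFun} (hf : FirstOrder r₀ F f b fd bd) {u : ℝ} (hu : 0 ≤ u) :
    leafArea r₀ (F 0) u = 4 * Real.pi * (r₀ + u) ^ 2 ∧
    HasDerivAt (fun t => leafArea r₀ (F t) u)
      (∫ q, 2 * (r₀ + u) * (f u q + u / (r₀ + u) * b u q) ∂surf) 0 := by
  obtain ⟨ε, hε, hF⟩ := smooth
  have hr : 0 < r₀ + u := by linarith
  have hc := contDiffOn_comp_nrm hF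
  have hU := isOpen_paramDomain ε
  have h0 : (0 : ℝ) ∈ Set.Ioo (-ε) ε := ⟨by linarith, hε⟩
  have hv : -ε < u := by linarith
  set S : (ℝ × ℝ) × E3 → ℝ := fun x => (F x.1.1 x.1.2 (nrm x.2)).1 with hSdef
  set B : (ℝ × ℝ) × E3 → ℝ := fun x => (F x.1.1 x.1.2 (nrm x.2)).2 with hBdef
  have cS : ContDiffOn ℝ ∞ S (paramDomain ε) := hc.fst
  have cB : ContDiffOn ℝ ∞ B (paramDomain ε) := hc.snd
  -- The squared area density in ambient coordinates, smooth in both variables near t = 0.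
  set P : ℝ × E3 → ℝ := fun x => areaDensitySq r₀ (S ((x.1, u), x.2)) (B ((x.1, u), x.2))
    (fun k => fderiv ℝ S ((x.1, u), x.2) (0, EuclideanSpace.single k 1))
    (fun k => fderiv ℝ B ((x.1, u), x.2) (0, EuclideanSpace.single k 1)) with hP
  have hslice : ∀ {t : ℝ}, t ∈ Set.Ioo (-ε) ε → ∀ {D : (ℝ × ℝ) × E3 → ℝ},
      ContDiffOn ℝ ∞ D (paramDomain ε) → ContDiffOn ℝ ∞ (fun z => D ((t, u), z)) {0}ᶜ := by
    intro t ht D hD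
    exact hD.comp (contDiffOn_const.prodMk contDiffOn_id) fun z hz => ⟨⟨ht, hv⟩, hz⟩
  have hden : ∀ {t : ℝ}, t ∈ Set.Ioo (-ε) ε → ∀ q : Sph,
      (leafMetric r₀ (F t) q u (centre q)).det / (roundMetric q (centre q)).det = P (t, (q : E3)) := by
    intro t ht q
    have e1 : ContMDiff (𝓡 2) 𝓘(ℝ, ℝ) ∞ fun p => (F t u p).1 := by
      simpa [hSdef] using contMDiff_restrict (hslice ht cS)
    have e2 : ContMDiff (𝓡 2) 𝓘(ℝ, ℝ) ∞ fun p => (F t u p).2 := by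
      simpa [hBdef] using contMDiff_restrict (hslice ht cB)
    rw [det_leafMetric_div q u e1 e2]
    have hfd : ∀ {D : (ℝ × ℝ) × E3 → ℝ}, ContDiffOn ℝ ∞ D (paramDomain ε) → ∀ e,
        fderiv ℝ (fun z => D ((t, u), z)) q e = fderiv ℝ D ((t, u), (q : E3)) (0, e) := by
      intro D hD e
      have h1 := ((hD.contDiffAt (hU.mem_nhds
        (mem_paramDomain (p := q) ht hv))).differentiableAt (by simp)).hasFDerivAt
      have h2 : HasFDerivAt (fun z => D ((t, u), z)) _ (q : E3) :=
        HasFDerivAt.comp (g := D) (f := fun z : E3 => ((t, u), z)) (q : E3) h1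
          ((hasFDerivAt_const (t, u) (q : E3)).prodMk (hasFDerivAt_id (q : E3)))
      rw [h2.fderiv]
      simp
    simp only [hP, ← hfd cS, ← hfd cB]
    simp only [hSdef, hBdef, nrm_sphere]
    rfl
  have harea : ∀ {t : ℝ}, t ∈ Set.Ioo (-ε) ε →
      leafArea r₀ (F t) u = ∫ q : Sph, Real.sqrt (P (t, (q : E3))) ∂surf := by
    intro t ht
    simp only [leafArea, hden ht]
  -- The value and t-derivative of the density are read off from the expansion of the metric
  -- determinant at each chart centre; the ambient formula is needed only for smoothness.
  have hdet : ∀ q : Sph, P (0, (q : E3)) = ((r₀ + u) ^ 2) ^ 2 ∧ HasDerivAt (fun t => P (t, (q : E3)))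
      (2 * ((r₀ + u) ^ 2) ^ 2 * (2 / (r₀ + u) * (f u q + u / (r₀ + u) * b u q))) 0 := by
    intro q
    have hj := hasJet_det (hf.jets u hu q).jet_leafMetric
    have hround : (roundMetric q (centre q)).det = 1 := by simp [centre_eq, roundMetric_eq, psi_zero]
    constructor
    · rw [← hden h0, hround, div_one, centre_eq]
      refine (hj.zero 0).trans ?_
      rw [psi_zero, mul_one]
    · have h1 := hj.deriv 0
      simp only [psi_zero, mul_one, rho, pt_zero] at h1
      refine h1.congr_of_eventuallyEq ?_
      filter_upwards [isOpen_Ioo.mem_nhds h0] with t ht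
      rw [← hden ht, hround, div_one, centre_eq]
  have hPs : ∀ q : Sph, ContDiffAt ℝ 1 P (0, (q : E3)) := by
    intro q
    have hm : ((0, u), (q : E3)) ∈ paramDomain ε := mem_paramDomain h0 hv
    have hin : ContDiffAt ℝ ∞ (fun x : ℝ × E3 => ((x.1, u), x.2)) (0, (q : E3)) :=
      (contDiffAt_fst.prodMk contDiffAt_const).prodMk contDiffAt_snd
    have hcomp : ∀ {D : (ℝ × ℝ) × E3 → ℝ}, ContDiffOn ℝ ∞ D (paramDomain ε) →
        ContDiffAt ℝ ∞ (fun x : ℝ × E3 => D ((x.1, u), x.2)) (0, (q : E3)) := fun {D} hD =>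
      ContDiffAt.comp (g := D) (f := fun x : ℝ × E3 => ((x.1, u), x.2)) (0, (q : E3))
        (hD.contDiffAt (hU.mem_nhds hm)) hin
    have hd1 : ∀ k : Fin 3, _ := fun k =>
      hcomp (contDiffOn_fderiv_apply hU cS (0, EuclideanSpace.single k 1))
    have hd2 : ∀ k : Fin 3, _ := fun k =>
      hcomp (contDiffOn_fderiv_apply hU cB (0, EuclideanSpace.single k 1))
    have hsum : ∀ {a c : Fin 3 → ℝ × E3 → ℝ}, (∀ k, ContDiffAt ℝ ∞ (a k) (0, (q : E3))) →
        (∀ k, ContDiffAt ℝ ∞ (c k) (0, (q : E3))) →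
        ContDiffAt ℝ ∞ (fun x => ∑ k, a k x * c k x) (0, (q : E3)) := fun ha hc =>
      ContDiffAt.sum fun k _ => (ha k).mul (hc k)
    have hval : (S ((0, u), (q : E3)), B ((0, u), (q : E3))) = (u, 0) := by
      have := (hf.jets u hu q).background 0
      simpa [hSdef, hBdef, pt_zero] using this
    have hreg : (S ((0, u), (q : E3)), B ((0, u), (q : E3))) ∈ region r₀ := by
      rw [hval]
      exact mem_region hr₀ hu 0
    have hR := ContDiffAt.comp (g := fun z : ℝ × ℝ => radius r₀ z.1 z.2)
      (f := fun x : ℝ × E3 => (S ((x.1, u), x.2), B ((x.1, u), x.2))) (0, (q : E3))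
      (contDiffAt_radius hr₀ hreg) ((hcomp cS).prodMk (hcomp cB))
    have hO := ContDiffAt.comp (g := fun z : ℝ × ℝ => OmegaSq r₀ z.1 z.2)
      (f := fun x : ℝ × E3 => (S ((x.1, u), x.2), B ((x.1, u), x.2))) (0, (q : E3))
      (contDiffAt_OmegaSq hr₀ hreg) ((hcomp cS).prodMk (hcomp cB))
    have hall : ContDiffAt ℝ ∞ P (0, (q : E3)) :=
      ((hR.pow 4).add (((contDiffAt_const.mul hO).mul (hR.pow 2)).mul (hsum hd1 hd2))).sub
        ((contDiffAt_const.mul (hO.pow 2)).mul (((hsum hd1 hd1).mul (hsum hd2 hd2)).sub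
          ((hsum hd1 hd2).pow 2)))
    exact hall.of_le (by simp)
  have hPpos : ∀ q : Sph, P (0, (q : E3)) ≠ 0 := fun q => by
    rw [(hdet q).1]
    positivity
  constructor
  · rw [harea h0]
    simp only [(hdet _).1, sqrt_mul_self_pow hr]
    rw [integral_const, surf_univ, smul_eq_mul]
  · have hA : ∀ q : Sph, ContDiffAt ℝ 1 (fun x => Real.sqrt (P x)) (0, (q : E3)) := fun q =>
      (hPs q).sqrt (hPpos q)
    have hmain := hasDerivAt_integral_of_contDiffAt hA
    have hval : ∀ q : Sph, fderiv ℝ (fun x => Real.sqrt (P x)) (0, (q : E3)) (1, 0) =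
        2 * (r₀ + u) * (f u q + u / (r₀ + u) * b u q) := by
      intro q
      have h1 := (((hA q).differentiableAt (by simp)).hasFDerivAt).comp_hasDerivAt
        (f := fun s : ℝ => (s, (q : E3))) 0 ((hasDerivAt_id 0).prodMk (hasDerivAt_const 0 (q : E3)))
      have h2 := (hdet q).2.sqrt (hPpos q)
      rw [(hdet q).1, sqrt_mul_self_pow hr] at h2
      refine (h1.unique h2).trans ?_
      field_simp
    simp only [hval] at hmain
    refine hmain.congr_of_eventuallyEq ?_
    filter_upwards [isOpen_Ioo.mem_nhds h0] with t ht using harea ht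

/-- The perturbation of the area radius of a leaf. -/
theorem FirstOrder.hasDerivAt_leafRadius {r₀ : ℝ} (hr₀ : 0 < r₀) {F : ℝ → ℝ → Sph → ℝ × ℝ}
    (smooth : ∃ ε > 0, ContMDiffOn (𝓘(ℝ, ℝ × ℝ).prod (𝓡 2)) 𝓘(ℝ, ℝ × ℝ) ∞
      (fun x : (ℝ × ℝ) × Sph => F x.1.1 x.1.2 x.2)
      ((Set.Ioo (-ε) ε ×ˢ Set.Ioi (-ε)) ×ˢ Set.univ))
    {f b fd bd : ℝ → SmoothFun} (hf : FirstOrder r₀ F f b fd bd) {u : ℝ} (hu : 0 ≤ u) :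
    leafRadius r₀ (F 0) u = r₀ + u ∧ HasDerivAt (fun t => leafRadius r₀ (F t) u)
      ((∫ q, (f u q + u / (r₀ + u) * b u q) ∂surf) / (4 * Real.pi)) 0 := by
  have hr : 0 < r₀ + u := by linarith
  obtain ⟨h1, h2⟩ := hf.hasDerivAt_leafArea hr₀ smooth hu
  have hpi := Real.pi_pos
  have h3 : leafArea r₀ (F 0) u / (4 * Real.pi) = (r₀ + u) ^ 2 := by
    rw [h1]
    field_simp
  constructor
  · rw [leafRadius, h3, Real.sqrt_sq hr.le]
  · have h4 := (h2.div_const (4 * Real.pi)).sqrt (by rw [h3]; positivity)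
    refine h4.congr_deriv ?_
    rw [h3, Real.sqrt_sq hr.le, integral_const_mul]
    field_simp

/-! ### The solution of the linearised equations -/

/-- The operator `r₀⁻¹ (x Δ + (Δ² - 2 Δ) / 3 - exp (τ (-Δ)⁻¹) (Δ + Δ²) / 3)`. -/
def solOp (r₀ x τ : ℝ) : SmoothFun →ₗ[ℝ] SmoothFun :=
  r₀⁻¹ • (x • lap + (1 / 3 : ℝ) • (lap ∘ₗ lap - (2 : ℝ) • lap) -
    (1 / 3 : ℝ) • (expOp 0 τ ∘ₗ (lap + lap ∘ₗ lap)))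

/-- The eigenvalues of `solOp`. -/
def solCoeff (r₀ x τ : ℝ) (l : ℕ) : ℝ :=
  r₀⁻¹ * (-(x * lam l) + (lam l ^ 2 + 2 * lam l) / 3 -
    (lam l ^ 2 - lam l) * Real.exp (τ * (lam l)⁻¹) / 3)

theorem solOp_eq (r₀ x τ : ℝ) (h : SmoothFun) : solOp r₀ x τ h = r₀⁻¹ • (x • lap h +
    (1 / 3 : ℝ) • (lap (lap h) - (2 : ℝ) • lap h) -
    (1 / 3 : ℝ) • expOp 0 τ (lap h + lap (lap h))) := rfl

theorem solOp_apply (r₀ x τ : ℝ) (h : SmoothFun) (p : Sph) : solOp r₀ x τ h p =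
    r₀⁻¹ * (x * lap h p + 1 / 3 * (lap (lap h) p - 2 * lap h p) -
      1 / 3 * expOp 0 τ (lap h + lap (lap h)) p) := rfl

theorem lap_solOp (r₀ x τ : ℝ) (h : SmoothFun) :
    lap (solOp r₀ x τ h) = solOp r₀ x τ (lap h) := by
  simp only [solOp_eq, map_smul, map_sub, map_add, lap_expOp]

theorem expCoeff_zero {l : ℕ} (hl : l ≠ 0) (τ : ℝ) :
    expCoeff 0 τ l = Real.exp (τ * (lam l)⁻¹) := by
  simp [expCoeff, invPow, hl]

theorem lam_zero : lam 0 = 0 := by simp [lam]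

theorem solCoeff_zero (r₀ x τ : ℝ) : solCoeff r₀ x τ 0 = 0 := by
  simp [solCoeff, lam_zero]

theorem harm_solOp (r₀ x τ : ℝ) (l : ℕ) (h : SmoothFun) :
    harm l (solOp r₀ x τ h) = solCoeff r₀ x τ l • harm l h := by
  simp only [solOp_eq, map_smul, map_sub, map_add, harm_expOp, harm_lap, smul_smul]
  rcases eq_or_ne l 0 with rfl | hl
  · simp [lam_zero, solCoeff_zero]
  rw [expCoeff_zero hl, solCoeff]
  module

theorem solOp_of_mem (r₀ x τ : ℝ) {l : ℕ} {Y : SmoothFun} (hY : Y ∈ Harm l) :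
    solOp r₀ x τ Y = solCoeff r₀ x τ l • Y := by
  refine ext_harm fun m => ?_
  rw [harm_solOp, map_smul]
  rcases eq_or_ne m l with rfl | h
  · rfl
  · rw [harm_of_mem_ne h hY, smul_zero, smul_zero]

/-- Every term of the operator contains a Laplacian, so the image has mean zero. This is the
labelling condition. -/
theorem integral_solOp (r₀ x τ : ℝ) (h : SmoothFun) : ∫ p, solOp r₀ x τ h p ∂surf = 0 := by
  have : solOp r₀ x τ h = lap (r₀⁻¹ • (x • h + (1 / 3 : ℝ) • (lap h - (2 : ℝ) • h) -
      (1 / 3 : ℝ) • expOp 0 τ (h + lap h))) := by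
    simp only [solOp_eq, map_smul, map_sub, map_add, lap_expOp]
  rw [this, integral_lap]

/-- The relative perturbation of the area radius function of the leaf of parameter `u`. -/
def sol (r₀ : ℝ) (h : SmoothFun) (u : ℝ) : SmoothFun :=
  solOp r₀ (r₀ / (r₀ + u)) (3 * u / (r₀ + u)) h

theorem hasDerivAt_div_add {r₀ u : ℝ} (hr : r₀ + u ≠ 0) :
    HasDerivAt (fun v => r₀ / (r₀ + v)) (-(r₀ / (r₀ + u) ^ 2)) u ∧
    HasDerivAt (fun v => v / (r₀ + v)) (r₀ / (r₀ + u) ^ 2) u ∧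
    HasDerivAt (fun v => 3 * v / (r₀ + v)) (3 * r₀ / (r₀ + u) ^ 2) u := by
  have h1 : HasDerivAt (fun v => r₀ + v) 1 u := (hasDerivAt_id u).const_add r₀
  refine ⟨((hasDerivAt_const u r₀).fun_div h1 hr).congr_deriv ?_,
    ((hasDerivAt_id' u).fun_div h1 hr).congr_deriv ?_,
    (((hasDerivAt_id' u).const_mul 3).fun_div h1 hr).congr_deriv ?_⟩ <;> ring

/-- The derivative in `u` of `sol`. -/
def solDeriv (r₀ : ℝ) (h : SmoothFun) (u : ℝ) : SmoothFun :=
  -(((r₀ + u) ^ 2)⁻¹ • (lap h + expOp 1 (3 * u / (r₀ + u)) (lap h + lap (lap h))))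

theorem hasDerivAt_sol {r₀ u : ℝ} (hr₀ : r₀ ≠ 0) (hr : r₀ + u ≠ 0) (h : SmoothFun) (p : Sph) :
    HasDerivAt (fun v => sol r₀ h v p) (solDeriv r₀ h u p) u := by
  obtain ⟨h1, -, h3⟩ := hasDerivAt_div_add hr
  have h4 := (hasDerivAt_expOp 0 (3 * u / (r₀ + u)) (lap h + lap (lap h)) p).comp u h3
  have h5 := ((((h1.mul_const (lap h p)).add_const (1 / 3 * (lap (lap h) p - 2 * lap h p))).sub
    (h4.const_mul (1 / 3))).const_mul r₀⁻¹)
  refine h5.congr_deriv ?_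
  change _ = -(((r₀ + u) ^ 2)⁻¹ * (lap h p + expOp 1 (3 * u / (r₀ + u)) (lap h + lap (lap h)) p))
  field_simp
  ring

/-- The linearised mass aspect equation for `sol`. -/
theorem sol_equation {r₀ u : ℝ} (hr₀ : r₀ ≠ 0) (hr : r₀ + u ≠ 0) (h : SmoothFun) (p : Sph) :
    -(3 * r₀ / (r₀ + u) ^ 3 * sol r₀ h u p) - lap (solDeriv r₀ h u) p / (r₀ + u) +
      (r₀ - 2 * u) / (r₀ + u) ^ 4 * lap h p = 0 := by
  have h1 : lap (solDeriv r₀ h u) = -(((r₀ + u) ^ 2)⁻¹ •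
      (lap (lap h) - expOp 0 (3 * u / (r₀ + u)) (lap h + lap (lap h)))) := by
    rw [solDeriv, map_neg, map_smul, map_add, lap_expOp_succ, sub_eq_add_neg]
  have h2 : lap (solDeriv r₀ h u) p = -(((r₀ + u) ^ 2)⁻¹ *
      (lap (lap h) p - expOp 0 (3 * u / (r₀ + u)) (lap h + lap (lap h)) p)) := by rw [h1]; rfl
  rw [h2, sol, solOp_apply]
  field_simp
  ring

/-- At u = 0, where x = 1 and τ = 0, the operator is Δ + (Δ² - 2Δ)/3 - (Δ + Δ²)/3 = 0. -/
theorem sol_zero {r₀ : ℝ} (hr₀ : r₀ ≠ 0) (h : SmoothFun) : sol r₀ h 0 = 0 := by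
  rw [sol, solOp_eq, mul_zero, zero_div, map_add, expOp_zero_zero_lap, expOp_zero_zero_lap, add_zero,
    div_self hr₀]
  module

/-- This is the mass aspect equation in degree l for φ = ρ/r with h normalised to 1. The term -xλ +
(λ² + 2λ)/3 is a particular solution, and the exponential is the homogeneous one, with its
coefficient fixed by the value at u = 0. -/
theorem solCoeff_ode {r₀ u : ℝ} (hr₀ : r₀ ≠ 0) (hr : r₀ + u ≠ 0) {l : ℕ} (hl : l ≠ 0) :
    HasDerivAt (fun v => solCoeff r₀ (r₀ / (r₀ + v)) (3 * v / (r₀ + v)) l)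
      (3 * r₀ / (lam l * (r₀ + u) ^ 2) * solCoeff r₀ (r₀ / (r₀ + u)) (3 * u / (r₀ + u)) l +
        (r₀ - 2 * u) / (r₀ + u) ^ 3) u := by
  obtain ⟨h1, -, h3⟩ := hasDerivAt_div_add hr
  have hlam := (lam_pos hl).ne'
  have h4 := (((h1.mul_const (lam l)).neg.add_const ((lam l ^ 2 + 2 * lam l) / 3)).sub
    (((h3.mul_const (lam l)⁻¹).exp.const_mul (lam l ^ 2 - lam l)).div_const 3)).const_mul r₀⁻¹
  refine h4.congr_deriv ?_
  rw [solCoeff]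
  field_simp
  ring

theorem solCoeff_initial {r₀ : ℝ} (hr₀ : r₀ ≠ 0) (l : ℕ) :
    solCoeff r₀ (r₀ / (r₀ + 0)) (3 * 0 / (r₀ + 0)) l = 0 := by
  simp [solCoeff, hr₀]
  ring

/-! ### Testing against spherical harmonics -/

/-- The component of the difference is itself an admissible test harmonic, and pairing with it gives
its squared norm. -/
theorem harm_eq_of_inner {l : ℕ} {g k : SmoothFun}
    (H : ∀ Y ∈ Harm l, ∫ p, g p * Y p ∂surf = ∫ p, k p * Y p ∂surf) : harm l g = harm l k := by
  apply toL2_injective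
  have hY := harm_mem l (g - k)
  have h1 := H _ hY
  rw [← inner_toL2, ← inner_toL2, ← sub_eq_zero, ← inner_sub_left, ← toL2L_apply g, ← toL2L_apply k,
    ← map_sub, toL2L_apply, toL2_harm] at h1
  have h2 : proj l (toL2 (g - k)) = 0 := by
    have h3 := Submodule.starProjection_inner_eq_zero (K := HL l) (toL2 (g - k)) _
      (proj_mem l (toL2 (g - k)))
    rw [inner_sub_left, h1, zero_sub, neg_eq_zero] at h3
    exact inner_self_eq_zero.1 h3
  rw [toL2_harm, toL2_harm, ← sub_eq_zero, ← map_sub, ← toL2L_apply, ← toL2L_apply, ← map_sub,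
    toL2L_apply, h2]

theorem integral_lap_mul_of_mem {l : ℕ} (g : SmoothFun) {Y : SmoothFun} (hY : Y ∈ Harm l) :
    ∫ p, lap g p * Y p ∂surf = -lam l * ∫ p, g p * Y p ∂surf := by
  rw [integral_lap_symm, lap_of_mem_Harm hY, ← integral_const_mul]
  refine integral_congr_ae (Filter.Eventually.of_forall fun p => ?_)
  change g p * (-lam l * Y p) = _
  ring

theorem integral_of_mem {l : ℕ} (hl : l ≠ 0) {Y : SmoothFun} (hY : Y ∈ Harm l) :
    ∫ p, Y p ∂surf = 0 := by
  have h1 := integral_lap Y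
  rw [lap_of_mem_Harm hY] at h1
  have h2 : ∫ p, ((-lam l) • Y) p ∂surf = -lam l * ∫ p, Y p ∂surf := integral_const_mul _ _
  rw [h2] at h1
  exact (mul_eq_zero.1 h1).resolve_left (neg_ne_zero.2 (lam_pos hl).ne')

theorem exists_const_of_mem_Harm_zero {Y : SmoothFun} (hY : Y ∈ Harm 0) : ∃ c, ∀ p, Y p = c := by
  obtain ⟨P, hP, -, rfl⟩ := mem_Harm.1 hY
  rw [← MvPolynomial.totalDegree_zero_iff_isHomogeneous,
    MvPolynomial.totalDegree_eq_zero_iff_eq_C] at hP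
  refine ⟨P.coeff 0, fun p => ?_⟩
  rw [polyFun_apply, hP, MvPolynomial.eval_C, MvPolynomial.coeff_C, if_pos rfl]

theorem eq_of_constant_deriv {c : ℝ → ℝ} (h : ∀ u, 0 ≤ u → HasDerivAt c 0 u) {u : ℝ} (hu : 0 ≤ u) :
    c u = c 0 := by
  refine constant_of_has_deriv_right_zero (a := 0) (b := u) (fun v hv => ?_) (fun v hv => ?_) u
    ⟨hu, le_rfl⟩
  · exact (h v hv.1).continuousAt.continuousWithinAt
  · exact (h v hv.1).hasDerivWithinAt

/-! ### Linearised perturbations -/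

/-- The perturbation of the area radius function, on the whole leaf. -/
def leafRho (r₀ : ℝ) (f b : ℝ → SmoothFun) (u : ℝ) : SmoothFun := f u + (u / (r₀ + u)) • b u

/-- The perturbation of the mass aspect function of a leaf in a null hypersurface. -/
def massVar (r₀ : ℝ) (f b fd : ℝ → SmoothFun) (u : ℝ) : SmoothFun :=
  (-(3 * r₀ / (r₀ + u) ^ 4)) • leafRho r₀ f b u - (1 / (r₀ + u) ^ 3) • lap (leafRho r₀ f b u) +
    (2 / (r₀ + u) ^ 3) • lap (f u) - (1 / (r₀ + u) ^ 2) • lap (fd u)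

theorem massVar_apply (r₀ : ℝ) (f b fd : ℝ → SmoothFun) (u : ℝ) (p : Sph) :
    massVar r₀ f b fd u p = (-(3 * r₀ / (r₀ + u) ^ 4)) * leafRho r₀ f b u p -
      (1 / (r₀ + u) ^ 3) * lap (leafRho r₀ f b u) p +
      (2 / (r₀ + u) ^ 3) * lap (f u) p - (1 / (r₀ + u) ^ 2) * lap (fd u) p := rfl

namespace FirstOrder

variable {r₀ : ℝ} {F : ℝ → ℝ → Sph → ℝ × ℝ} {f b fd bd : ℝ → SmoothFun}
  (hf : FirstOrder r₀ F f b fd bd) {u : ℝ} (hu : 0 ≤ u) (p : Sph)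

include hf hu

theorem hasDerivAt_fst : HasDerivAt (fun t => (F t u p).1) (f u p) 0 := by
  simpa only [pt_zero] using (hf.jets u hu p).s.deriv 0

theorem hasDerivAt_snd : HasDerivAt (fun t => (F t u p).2) (b u p) 0 := by
  simpa only [pt_zero] using (hf.jets u hu p).sb.deriv 0

theorem hasDerivAt_nullity : HasDerivAt (fun t => nullity r₀ (F t) p u) (4 * bd u p) 0 := by
  simpa only [pt_zero] using (hf.jets u hu p).hasDerivAt_nullity.2

theorem hasDerivAt_massAspect (hbd : bd u p = 0) : massAspect r₀ (F 0) p u = r₀ / (r₀ + u) ^ 3 ∧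
    HasDerivAt (fun t => massAspect r₀ (F t) p u) (massVar r₀ f b fd u p) 0 := by
  have h1 := (hf.jets u hu p).hasDerivAt_massAspect (by rwa [pt_zero])
  refine ⟨h1.1, h1.2.congr_deriv ?_⟩
  rw [massVar_apply, lap_eq_chart, lap_eq_chart, lap_eq_chart]
  have h2 : rho r₀ u (fun y => f u (pt p y)) (fun y => b u (pt p y)) =
    fun y => leafRho r₀ f b u (pt p y) := rfl
  simp only [h2, pt_zero]
  ring

theorem hasDerivAt_leafCurvature : leafCurvature r₀ (F 0) p u = ((r₀ + u) ^ 2)⁻¹ ∧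
    HasDerivAt (fun t => leafCurvature r₀ (F t) p u)
      (-(2 * leafRho r₀ f b u p + lap (leafRho r₀ f b u) p) / (r₀ + u) ^ 3) 0 := by
  have h1 := (hf.jets u hu p).hasDerivAt_leafCurvature
  refine ⟨h1.1, h1.2.congr_deriv ?_⟩
  rw [lap_eq_chart]
  have h2 : rho r₀ u (fun y => f u (pt p y)) (fun y => b u (pt p y)) =
    fun y => leafRho r₀ f b u (pt p y) := rfl
  simp only [h2, pt_zero]

theorem hasDerivAt_leafMetric (y : Fin 2 → ℝ) (i j : Fin 2) :
    leafMetric r₀ (F 0) p u y i j = (r₀ + u) ^ 2 * roundMetric p y i j ∧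
    HasDerivAt (fun t => leafMetric r₀ (F t) p u y i j)
      (2 * (r₀ + u) * leafRho r₀ f b u (pt p y) * roundMetric p y i j) 0 := by
  have h1 := (hf.jets u hu p).jet_leafMetric i j
  have hr := (hf.jets u hu p).r_pos.ne'
  have h2 : roundMetric p y i j = if i = j then psi y else 0 := by
    rw [roundMetric_eq, Matrix.smul_apply, Matrix.one_apply]
    simp
  have h3 : rho r₀ u (fun y => f u (pt p y)) (fun y => b u (pt p y)) =
    fun y => leafRho r₀ f b u (pt p y) := rfl
  rw [h2]
  constructor
  · rw [h1.zero]
    simp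
  · refine (h1.deriv y).congr_deriv ?_
    rw [h3]
    split_ifs
    · field_simp
    · simp

end FirstOrder

/-- The equations for a linearised perturbation determine the perturbation of the area radius
function. -/
theorem IsLinearisedPerturbation.eq_sol {r₀ : ℝ} (hr₀ : 0 < r₀) {h : SmoothFun}
    {F : ℝ → ℝ → Sph → ℝ × ℝ} (hF : IsLinearisedPerturbation r₀ h F) {f b fd bd : ℝ → SmoothFun}
    (hf : FirstOrder r₀ F f b fd bd) {u : ℝ} (hu : 0 ≤ u) :
    leafRho r₀ f b u = (r₀ + u) • sol r₀ h u := by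
  have hr : ∀ {v : ℝ}, 0 ≤ v → r₀ + v ≠ 0 := fun hv => by linarith
  -- The nullity varies by 4 ∂_u b, so nullity to first order freezes b at its initial value h.
  have hbd : ∀ v, 0 ≤ v → ∀ p, bd v p = 0 := fun v hv p => by
    linarith [(hf.hasDerivAt_nullity hv p).unique (hF.null v hv p)]
  have hf0 : ∀ p, f 0 p = 0 := fun p => by
    refine (hf.hasDerivAt_fst le_rfl p).unique ((hasDerivAt_const 0 0).congr_of_eventuallyEq ?_)
    filter_upwards [hF.initial] with t ht
    rw [ht]
  have hb0 : ∀ p, b 0 p = h p := fun p => by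
    have h1 : HasDerivAt (fun t : ℝ => t * h p) (1 * h p) 0 := (hasDerivAt_id' (0 : ℝ)).mul_const _
    rw [one_mul] at h1
    refine (hf.hasDerivAt_snd le_rfl p).unique (h1.congr_of_eventuallyEq ?_)
    filter_upwards [hF.initial] with t ht
    rw [ht]
  have hb : ∀ v, 0 ≤ v → b v = h := fun v hv => by
    ext p
    rw [← hb0, eq_of_constant_deriv (c := fun v => b v p) (fun w hw => ?_) hv]
    rw [← hbd w hw p]
    exact hf.deriv_b w hw p
  have hmass : ∀ v, 0 ≤ v → ∀ p q, massVar r₀ f b fd v p = massVar r₀ f b fd v q := by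
    intro v hv p q
    have h1 := ((hf.hasDerivAt_massAspect hv p (hbd v hv p)).2.sub
      (hf.hasDerivAt_massAspect hv q (hbd v hv q)).2).unique (hF.constant v hv p q)
    linarith
  -- The labelling makes the variation of the area radius, which is the mean of ρ, independent of u.
  -- It vanishes at u = 0, where f = 0 and the weight u/r of b is zero.
  have hmean : ∀ v, 0 ≤ v → ∫ p, leafRho r₀ f b v p ∂surf = 0 := by
    intro v hv
    have h1 := (hf.hasDerivAt_leafRadius hr₀ hF.smooth hv).2
    have h2 := (hf.hasDerivAt_leafRadius hr₀ hF.smooth le_rfl).2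
    have h3 := (h1.sub (h2.add_const v)).unique (hF.labelling v hv)
    have h4 : ∫ p, (f 0 p + 0 / (r₀ + 0) * b 0 p) ∂surf = 0 := by simp [hf0]
    rw [h4, zero_div, sub_zero, div_eq_zero_iff] at h3
    exact h3.resolve_right (by positivity)
  refine ext_harm fun l => ?_
  -- Degree zero is controlled by the labelling, the other degrees by constancy of the mass aspect
  -- function.
  rcases eq_or_ne l 0 with rfl | hl
  · rw [map_smul, sol, harm_solOp, solCoeff_zero, zero_smul, smul_zero, ← map_zero (harm 0)]
    refine harm_eq_of_inner fun Y hY => ?_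
    obtain ⟨c, hc⟩ := exists_const_of_mem_Harm_zero hY
    simp only [hc]
    rw [integral_mul_const, hmean u hu]
    simp
  have hlam := lam_pos hl
  rw [map_smul, sol, harm_solOp, ← map_smul, ← map_smul]
  refine harm_eq_of_inner fun Y hY => ?_
  set H := ∫ p, h p * Y p ∂surf with hH
  set a : ℝ → ℝ := fun v => ∫ p, f v p * Y p ∂surf with ha
  set Q : ℝ → ℝ := fun v => solCoeff r₀ (r₀ / (r₀ + v)) (3 * v / (r₀ + v)) l with hQ
  have hI : ∀ g : SmoothFun, ∫ p, g p * Y p ∂surf = inner ℝ (toL2 Y) (toL2L g) := fun g => by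
    rw [toL2L_apply, real_inner_comm, inner_toL2]
  have hρ : ∀ v, 0 ≤ v → ∫ p, leafRho r₀ f b v p * Y p ∂surf = a v + v / (r₀ + v) * H := by
    intro v hv
    rw [hI, leafRho, map_add, map_smul, inner_add_right, inner_smul_right, ← hI, ← hI, hb v hv]
  -- The variation of the mass aspect function is constant on the leaf, hence orthogonal to Y. This
  -- leaves a linear scalar equation for the component of f.
  have hode : ∀ v, 0 ≤ v → HasDerivAt a ((3 * r₀ / (lam l * (r₀ + v) ^ 2) - 1 / (r₀ + v)) *
      (a v + v / (r₀ + v) * H) + 2 * a v / (r₀ + v)) v := by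
    intro v hv
    refine (hf.deriv_integral_f v hv Y).congr_deriv ?_
    have h1 : ∫ p, massVar r₀ f b fd v p * Y p ∂surf = 0 := by
      obtain ⟨q⟩ : Nonempty Sph := inferInstance
      simp only [hmass v hv _ q]
      rw [integral_const_mul, integral_of_mem hl hY, mul_zero]
    rw [hI, massVar, map_sub, map_add, map_sub] at h1
    simp only [map_smul, inner_sub_right, inner_add_right, inner_smul_right, ← hI,
      integral_lap_mul_of_mem _ hY, hρ v hv] at h1
    have hr' := hr hv
    field_simp at h1 ⊢
    linarith
  -- Integrating factor for the homogeneous equation c' = 3r₀ c / (λ r²), which the difference c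
  -- between the component of ρ/r and the explicit solution satisfies.
  set E : ℝ → ℝ := fun v => Real.exp (3 / lam l * (r₀ / (r₀ + v))) with hE
  set c : ℝ → ℝ := fun v => a v / (r₀ + v) + v / (r₀ + v) * (H / (r₀ + v)) - Q v * H with hc
  have hcE : ∀ v, 0 ≤ v → HasDerivAt (fun v => c v * E v) 0 v := by
    intro v hv
    have hr' := hr hv
    obtain ⟨d1, d2, -⟩ := hasDerivAt_div_add hr'
    have d3 : HasDerivAt (fun v => r₀ + v) 1 v := (hasDerivAt_id v).const_add r₀
    have d4 := (((hode v hv).fun_div d3 hr').add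
      (d2.mul ((hasDerivAt_const v H).fun_div d3 hr'))).sub
      ((solCoeff_ode hr₀.ne' hr' hl).mul_const H)
    have d5 := (d1.const_mul (3 / lam l)).exp
    refine (d4.mul d5).congr_deriv ?_
    simp only [Pi.add_apply, Pi.sub_apply, Pi.mul_apply]
    field_simp
    ring
  have hc0 : c 0 = 0 := by
    have h1 : a 0 = 0 := by simp [ha, hf0]
    simp only [hc, hQ, h1, solCoeff_initial hr₀.ne']
    simp
  have h1 := eq_of_constant_deriv hcE hu
  simp only [hc0, zero_mul] at h1
  have h2 : c u = 0 := (mul_eq_zero.1 h1).resolve_right (Real.exp_pos _).ne'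
  rw [hρ u hu, hI, map_smul, map_smul, inner_smul_right, inner_smul_right, ← hI, ← hH]
  have hr' := hr hu
  have h3 : a u / (r₀ + u) + u / (r₀ + u) * (H / (r₀ + u)) = Q u * H := sub_eq_zero.1 h2
  change _ = (r₀ + u) * (Q u * H)
  rw [← h3]
  field_simp

/-! ### Variation of the renormalised metric and curvature. -/

section Renormalised

variable {r₀ : ℝ} (hr₀ : 0 < r₀) {h : SmoothFun} {F : ℝ → ℝ → Sph → ℝ × ℝ}
  (hF : IsLinearisedPerturbation r₀ h F) {u : ℝ} (hu : 0 ≤ u) (p : Sph)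

include hr₀ hF hu

theorem IsLinearisedPerturbation.hasDerivAt_leafRadius :
    leafRadius r₀ (F 0) u = r₀ + u ∧ HasDerivAt (fun t => leafRadius r₀ (F t) u) 0 0 := by
  obtain ⟨f, b, fd, bd, hf⟩ := exists_firstOrder hr₀ hF.smooth hF.background
  have h1 := hf.hasDerivAt_leafRadius hr₀ hF.smooth hu
  refine ⟨h1.1, h1.2.congr_deriv ?_⟩
  have h2 : ∫ q, (f u q + u / (r₀ + u) * b u q) ∂surf = ∫ q, leafRho r₀ f b u q ∂surf := rfl
  rw [h2, hF.eq_sol hr₀ hf hu]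
  have h3 : ∫ q, ((r₀ + u) • sol r₀ h u) q ∂surf = (r₀ + u) * ∫ q, sol r₀ h u q ∂surf :=
    integral_const_mul _ _
  rw [h3, sol, integral_solOp, mul_zero, zero_div]

/-- The area radius does not vary to first order, so the renormalisation contributes nothing beyond
division by r². -/
theorem IsLinearisedPerturbation.hasDerivAt_renormMetric (y : Fin 2 → ℝ) (i j : Fin 2) :
    HasDerivAt (fun t => renormMetric r₀ (F t) p u y i j)
      (2 * sol r₀ h u (pt p y) * roundMetric p y i j) 0 := by
  obtain ⟨f, b, fd, bd, hf⟩ := exists_firstOrder hr₀ hF.smooth hF.background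
  have hr : r₀ + u ≠ 0 := by linarith
  obtain ⟨h1, h1'⟩ := hF.hasDerivAt_leafRadius hr₀ hu
  obtain ⟨h2, h2'⟩ := hf.hasDerivAt_leafMetric hu p y i j
  have h3 := ((h1'.fun_pow 2).fun_inv (by rw [h1]; positivity)).fun_mul h2'
  refine h3.congr_deriv ?_
  have h4 : leafRho r₀ f b u (pt p y) = (r₀ + u) * sol r₀ h u (pt p y) := by
    rw [hF.eq_sol hr₀ hf hu]
    rfl
  rw [h1, h4]
  field_simp
  ring

theorem IsLinearisedPerturbation.hasDerivAt_renormCurvature :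
    HasDerivAt (fun t => renormCurvature r₀ (F t) p u)
      (-(2 * sol r₀ h u p + lap (sol r₀ h u) p)) 0 := by
  obtain ⟨f, b, fd, bd, hf⟩ := exists_firstOrder hr₀ hF.smooth hF.background
  have hr : r₀ + u ≠ 0 := by linarith
  obtain ⟨h1, h1'⟩ := hF.hasDerivAt_leafRadius hr₀ hu
  obtain ⟨h2, h2'⟩ := hf.hasDerivAt_leafCurvature hu p
  have h3 := (h1'.fun_pow 2).fun_mul h2'
  refine h3.congr_deriv ?_
  have h4 : leafRho r₀ f b u p = (r₀ + u) * sol r₀ h u p := by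
    rw [hF.eq_sol hr₀ hf hu]
    rfl
  have h5 : lap (leafRho r₀ f b u) p = (r₀ + u) * lap (sol r₀ h u) p := by
    rw [hF.eq_sol hr₀ hf hu, map_smul]
    rfl
  rw [h1, h4, h5]
  field_simp
  ring

end Renormalised

/-! ### The spherically symmetric foliation -/

theorem smooth_sphericalFoliation : ∃ ε > 0, ContMDiffOn (𝓘(ℝ, ℝ × ℝ).prod (𝓡 2)) 𝓘(ℝ, ℝ × ℝ) ∞
    (fun x : (ℝ × ℝ) × Sph => sphericalFoliation x.1.2 x.2)
    ((Set.Ioo (-ε) ε ×ˢ Set.Ioi (-ε)) ×ˢ Set.univ) := by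
  refine ⟨1, one_pos, ?_⟩
  refine contMDiffOn_of_contDiffOn (Ψ := fun x : (ℝ × ℝ) × E3 => (x.1.2, (0 : ℝ))) ?_
  exact ((contDiff_snd.comp contDiff_fst).prodMk contDiff_const).contDiffOn

/-- The expansions contain the unperturbed geometry as their zeroth order part, so they are applied
to the family that is constant in t. -/
theorem isConstMassAspectFoliation_sphericalFoliation {r₀ : ℝ} (hr₀ : 0 < r₀) :
    IsConstMassAspectFoliation r₀ sphericalFoliation := by
  obtain ⟨f, b, fd, bd, hf⟩ := exists_firstOrder hr₀ (F := fun _ => sphericalFoliation)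
    smooth_sphericalFoliation fun _ _ _ => rfl
  have hb : ∀ u, 0 ≤ u → ∀ p, b u p = 0 := fun u hu p =>
    (hf.hasDerivAt_snd hu p).unique (hasDerivAt_const _ _)
  have hbd : ∀ u, 0 ≤ u → ∀ p, bd u p = 0 := fun u hu p =>
    deriv_unique_Ici (hf.deriv_b u hu p) (hasDerivAt_const u 0) fun v hv => hb v (hu.trans hv) p
  refine ⟨⟨1, one_pos, ?_⟩, fun u hu p => ?_, fun u hu p => ?_, fun u hu p => ?_, fun u hu p q => ?_,
    fun u hu => ?_⟩
  · refine contMDiffOn_of_contDiffOn (Ψ := fun x : ℝ × E3 => (x.1, (0 : ℝ))) ?_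
    exact (contDiff_fst.prodMk contDiff_const).contDiffOn
  · have h1 : leafMetric r₀ sphericalFoliation p u (centre p) =
        (r₀ + u) ^ 2 • (1 : Matrix (Fin 2) (Fin 2) ℝ) := by
      ext i j
      rw [(hf.hasDerivAt_leafMetric hu p (centre p) i j).1, centre_eq, roundMetric_eq, psi_zero]
      simp
    rw [h1]
    exact Matrix.PosDef.one.smul (pow_pos (by linarith) 2)
  · exact (hf.jets u hu p).hasDerivAt_nullity.1
  · have hX : HasVJet (fun _ _ => Pi.single (Sum.inl 1) 1) (fun _ => vec 0 1 0) fun _ => 0 := by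
      intro a
      refine ((HasJet.const (vec 0 1 0 a)).congr fun y => Filter.Eventually.of_forall fun x => ?_)
      rcases a with a | a
      · fin_cases a <;> rfl
      · rfl
    have hj := ((hf.jets u hu p).jet_ip hX (hf.jets u hu p).jet_Lbar).zero (centre p)
    rw [hj]
    simp [bil]
  · rw [(hf.hasDerivAt_massAspect hu p (hbd u hu p)).1,
      (hf.hasDerivAt_massAspect hu q (hbd u hu q)).1]
  · rw [(hf.hasDerivAt_leafRadius hr₀ smooth_sphericalFoliation hu).1,
      (hf.hasDerivAt_leafRadius hr₀ smooth_sphericalFoliation le_rfl).1]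
    ring

/-! ### Existence of linearised perturbations -/

/-- The perturbation of `s` in the solution of the linearised equations. -/
def solFst (r₀ : ℝ) (h : SmoothFun) (u : ℝ) : SmoothFun :=
  (r₀ + u) • sol r₀ h u - (u / (r₀ + u)) • h

/-- The derivative in `u` of `solFst`. -/
def solFstDeriv (r₀ : ℝ) (h : SmoothFun) (u : ℝ) : SmoothFun :=
  sol r₀ h u + (r₀ + u) • solDeriv r₀ h u - (r₀ / (r₀ + u) ^ 2) • h

theorem hasDerivAt_solFst {r₀ u : ℝ} (hr₀ : r₀ ≠ 0) (hr : r₀ + u ≠ 0) (h : SmoothFun) (p : Sph) :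
    HasDerivAt (fun v => solFst r₀ h v p) (solFstDeriv r₀ h u p) u := by
  have h1 : HasDerivAt (fun v => r₀ + v) 1 u := (hasDerivAt_id u).const_add r₀
  have h2 := (h1.mul (hasDerivAt_sol hr₀ hr h p)).sub
    ((hasDerivAt_div_add hr).2.1.mul_const (h p))
  rw [one_mul] at h2
  exact h2

/-- A family of families of spheres that solves the linearised equations. -/
def solFamily (r₀ : ℝ) (h : SmoothFun) (t u : ℝ) (p : Sph) : ℝ × ℝ :=
  (u + t * solFst r₀ h u p, t * h p)

/-- The explicit solution is singular only at u = -r₀, so ε = r₀ works. -/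
theorem smooth_solFamily {r₀ : ℝ} (hr₀ : 0 < r₀) (h : SmoothFun) : ∃ ε > 0,
    ContMDiffOn (𝓘(ℝ, ℝ × ℝ).prod (𝓡 2)) 𝓘(ℝ, ℝ × ℝ) ∞
      (fun x : (ℝ × ℝ) × Sph => solFamily r₀ h x.1.1 x.1.2 x.2)
      ((Set.Ioo (-ε) ε ×ˢ Set.Ioi (-ε)) ×ˢ Set.univ) := by
  refine ⟨r₀, hr₀, ?_⟩
  set W : Set ((ℝ × ℝ) × E3) := (Set.Ioo (-r₀) r₀ ×ˢ Set.Ioi (-r₀)) ×ˢ {0}ᶜ with hW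
  have ct : ContDiffOn ℝ ∞ (fun x : (ℝ × ℝ) × E3 => x.1.1) W :=
    (contDiff_fst.comp contDiff_fst).contDiffOn
  have cu : ContDiffOn ℝ ∞ (fun x : (ℝ × ℝ) × E3 => x.1.2) W :=
    (contDiff_snd.comp contDiff_fst).contDiffOn
  have cr : ContDiffOn ℝ ∞ (fun x : (ℝ × ℝ) × E3 => r₀ + x.1.2) W := contDiffOn_const.add cu
  have hr : ∀ x ∈ W, r₀ + x.1.2 ≠ 0 := fun x hx => by
    have : -r₀ < x.1.2 := hx.1.2
    linarith
  have cext : ∀ g : SmoothFun, ContDiffOn ℝ ∞ (fun x : (ℝ × ℝ) × E3 => ext g x.2) W := fun g =>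
    (contDiffOn_ext g.contMDiff).comp contDiffOn_snd fun x hx => hx.2
  have cexp : ∀ g : SmoothFun, ContDiffOn ℝ ∞ (fun x : (ℝ × ℝ) × E3 =>
      expSeries 0 g (3 * x.1.2 / (r₀ + x.1.2), x.2)) W := fun g =>
    (contDiffOn_expSeries 0 g).comp (((contDiffOn_const.mul cu).div cr hr).prodMk contDiffOn_snd)
      fun x hx => ⟨trivial, hx.2⟩
  have key : ContDiffOn ℝ ∞ (fun x : (ℝ × ℝ) × E3 => (x.1.2 + x.1.1 * ((r₀ + x.1.2) *
      (r₀⁻¹ * (r₀ / (r₀ + x.1.2) * ext (lap h) x.2 + 1 / 3 * (ext (lap (lap h)) x.2 -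
        2 * ext (lap h) x.2) - 1 / 3 * expSeries 0 (lap h + lap (lap h))
          (3 * x.1.2 / (r₀ + x.1.2), x.2))) -
      x.1.2 / (r₀ + x.1.2) * ext h x.2), x.1.1 * ext h x.2)) W :=
    (cu.add (ct.mul ((cr.mul (contDiffOn_const.mul ((((contDiffOn_const.div cr hr).mul
      (cext (lap h))).add (contDiffOn_const.mul ((cext (lap (lap h))).sub
        (contDiffOn_const.mul (cext (lap h)))))).sub (contDiffOn_const.mul (cexp _))))).sub
      ((cu.div cr hr).mul (cext h))))).prodMk (ct.mul (cext h))
  refine (contMDiffOn_of_contDiffOn key).congr fun x _ => ?_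
  simp only [ext_sphere]
  rfl

/-- The family is affine in t, so its first order part is the explicit solution. For it the
variation of the mass aspect function is not just constant on each leaf but zero. -/
theorem isLinearisedPerturbation_solFamily {r₀ : ℝ} (hr₀ : 0 < r₀) (h : SmoothFun) :
    IsLinearisedPerturbation r₀ h (solFamily r₀ h) := by
  have hback : ∀ u, 0 ≤ u → ∀ p, solFamily r₀ h 0 u p = sphericalFoliation u p := fun u _ p => by
    simp [solFamily, sphericalFoliation]
  have hr : ∀ {v : ℝ}, 0 ≤ v → r₀ + v ≠ 0 := fun hv => by linarith
  obtain ⟨f, b, fd, bd, hf⟩ := exists_firstOrder hr₀ (smooth_solFamily hr₀ h) hback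
  have hf1 : ∀ u, 0 ≤ u → f u = solFst r₀ h u := fun u hu => by
    ext p
    have h1 := ((hasDerivAt_id' (0 : ℝ)).mul_const (solFst r₀ h u p)).const_add u
    rw [one_mul] at h1
    exact (hf.hasDerivAt_fst hu p).unique h1
  have hb1 : ∀ u, 0 ≤ u → b u = h := fun u hu => by
    ext p
    have h1 := (hasDerivAt_id' (0 : ℝ)).mul_const (h p)
    rw [one_mul] at h1
    exact (hf.hasDerivAt_snd hu p).unique h1
  have hfd : ∀ u, 0 ≤ u → fd u = solFstDeriv r₀ h u := fun u hu => by
    ext p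
    exact deriv_unique_Ici (hf.deriv_f u hu p) (hasDerivAt_solFst hr₀.ne' (hr hu) h p)
      fun v hv => by rw [hf1 v (hu.trans hv)]
  have hbd : ∀ u, 0 ≤ u → ∀ p, bd u p = 0 := fun u hu p =>
    deriv_unique_Ici (hf.deriv_b u hu p) (hasDerivAt_const u (h p)) fun v hv => by
      rw [hb1 v (hu.trans hv)]
  have hρ : ∀ u, 0 ≤ u → leafRho r₀ f b u = (r₀ + u) • sol r₀ h u := fun u hu => by
    rw [leafRho, hf1 u hu, hb1 u hu, solFst, sub_add_cancel]
  have hrad : ∀ u, 0 ≤ u → HasDerivAt (fun t => leafRadius r₀ (solFamily r₀ h t) u) 0 0 := by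
    intro u hu
    refine (hf.hasDerivAt_leafRadius hr₀ (smooth_solFamily hr₀ h) hu).2.congr_deriv ?_
    have h2 : ∫ q, (f u q + u / (r₀ + u) * b u q) ∂surf = ∫ q, leafRho r₀ f b u q ∂surf := rfl
    have h3 : ∫ q, ((r₀ + u) • sol r₀ h u) q ∂surf = (r₀ + u) * ∫ q, sol r₀ h u q ∂surf :=
      integral_const_mul _ _
    rw [h2, hρ u hu, h3, sol, integral_solOp, mul_zero, zero_div]
  have hmass : ∀ u, 0 ≤ u → ∀ p, HasDerivAt (fun t => massAspect r₀ (solFamily r₀ h t) p u) 0 0 := by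
    intro u hu p
    have hr' := hr hu
    refine (hf.hasDerivAt_massAspect hu p (hbd u hu p)).2.congr_deriv ?_
    have h1 := sol_equation hr₀.ne' hr' h p
    have e1 : lap (leafRho r₀ f b u) p = (r₀ + u) * lap (sol r₀ h u) p := by
      rw [hρ u hu, map_smul]; rfl
    have e2 : lap (f u) p = (r₀ + u) * lap (sol r₀ h u) p - u / (r₀ + u) * lap h p := by
      rw [hf1 u hu, solFst, map_sub, map_smul, map_smul]; rfl
    have e3 : lap (fd u) p = lap (sol r₀ h u) p + (r₀ + u) * lap (solDeriv r₀ h u) p -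
        r₀ / (r₀ + u) ^ 2 * lap h p := by
      rw [hfd u hu, solFstDeriv, map_sub, map_add, map_smul, map_smul]; rfl
    have e4 : leafRho r₀ f b u p = (r₀ + u) * sol r₀ h u p := by rw [hρ u hu]; rfl
    rw [massVar_apply, e1, e2, e3, e4, ← h1]
    field_simp
    ring
  refine ⟨smooth_solFamily hr₀ h, hback, Filter.Eventually.of_forall fun t p => ?_, fun u hu p => ?_,
    fun u hu p q => ?_, fun u hu => ?_⟩
  · have : solFst r₀ h 0 p = 0 := by
      rw [solFst, sol_zero hr₀.ne', zero_div, zero_smul, smul_zero, sub_zero]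
      rfl
    simp [solFamily, this]
  · refine (hf.hasDerivAt_nullity hu p).congr_deriv ?_
    rw [hbd u hu, mul_zero]
  · exact ((hmass u hu p).fun_sub (hmass u hu q)).congr_deriv (sub_zero 0)
  · exact ((hrad u hu).fun_sub ((hrad 0 le_rfl).add_const u)).congr_deriv (sub_zero 0)

/-! ### The limits at null infinity -/

theorem tendsto_sol {r₀ : ℝ} (h : SmoothFun) (p : Sph) :
    Filter.Tendsto (fun u => sol r₀ h u p) Filter.atTop (𝓝 (solOp r₀ 0 3 h p)) := by
  have h1 : Filter.Tendsto (fun u : ℝ => r₀ + u) Filter.atTop Filter.atTop :=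
    Filter.tendsto_atTop_add_const_left _ _ Filter.tendsto_id
  have h2 : Filter.Tendsto (fun u : ℝ => r₀ / (r₀ + u)) Filter.atTop (𝓝 0) :=
    h1.const_div_atTop r₀
  have h3 : Filter.Tendsto (fun u : ℝ => 3 * u / (r₀ + u)) Filter.atTop (𝓝 3) := by
    have h4 : Filter.Tendsto (fun u : ℝ => 3 - 3 * (r₀ / (r₀ + u))) Filter.atTop
        (𝓝 (3 - 3 * 0)) := (h2.const_mul 3).const_sub 3
    rw [mul_zero, sub_zero] at h4
    refine h4.congr' ?_
    filter_upwards [h1.eventually_ne_atTop 0] with u hu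
    field_simp
    ring
  have h4 := (hasDerivAt_expOp 0 3 (lap h + lap (lap h)) p).continuousAt.tendsto.comp h3
  simp only [sol, solOp_apply]
  exact (((h2.mul_const _).add_const _).sub (h4.const_mul (1 / 3))).const_mul _

/-- The solution operator commutes with the Laplacian, so the limit for Δ of the solution is the
previous limit with Δh as datum. No exchange of limit and derivative is required. -/
theorem tendsto_lap_sol {r₀ : ℝ} (h : SmoothFun) (p : Sph) :
    Filter.Tendsto (fun u => lap (sol r₀ h u) p) Filter.atTop (𝓝 (lap (solOp r₀ 0 3 h) p)) := by
  simp only [sol, lap_solOp]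
  exact tendsto_sol (lap h) p

/-- The conformal factor of the linearised limit metric. -/
def limitFactor (r₀ : ℝ) : SmoothFun →ₗ[ℝ] SmoothFun := (2 : ℝ) • solOp r₀ 0 3

theorem limitFactor_apply (r₀ : ℝ) (h : SmoothFun) (p : Sph) :
    limitFactor r₀ h p = 2 * solOp r₀ 0 3 h p := rfl

/-- The linearised limit metric. -/
def limitMetric (r₀ : ℝ) : SmoothFun →ₗ[ℝ] TensorField where
  toFun h p y := limitFactor r₀ h (pt p y) • roundMetric p y
  map_add' h k := by
    funext p y
    rw [map_add]
    exact add_smul _ _ _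
  map_smul' c h := by
    funext p y
    rw [map_smul]
    exact mul_smul _ _ _

/-- The linearised limit Gauss curvature. -/
def limitCurvature (r₀ : ℝ) : SmoothFun →ₗ[ℝ] SmoothFun :=
  -((2 : ℝ) • solOp r₀ 0 3 + lap ∘ₗ solOp r₀ 0 3)

theorem limitCurvature_apply (r₀ : ℝ) (h : SmoothFun) (p : Sph) :
    limitCurvature r₀ h p = -(2 * solOp r₀ 0 3 h p + lap (solOp r₀ 0 3 h) p) := rfl

theorem solCoeff_limit {r₀ : ℝ} (hr₀ : r₀ ≠ 0) (l : ℕ) :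
    2 * solCoeff r₀ 0 3 l * r₀ = conformalCoeff l ∧
    (lam l - 2) * solCoeff r₀ 0 3 l = curvatureCoeff l / r₀ := by
  rcases eq_or_ne l 0 with rfl | hl
  · simp [solCoeff_zero, conformalCoeff, curvatureCoeff]
  · simp only [solCoeff, conformalCoeff, curvatureCoeff, if_neg hl, div_eq_mul_inv 3 (lam l)]
    constructor
    · field_simp
      ring
    · field_simp
      ring

theorem harm_limitCurvature {r₀ : ℝ} (hr₀ : r₀ ≠ 0) (h : SmoothFun) (l : ℕ) :
    harm l (limitCurvature r₀ h) = (curvatureCoeff l / r₀) • harm l h := by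
  have h1 : limitCurvature r₀ h = -((2 : ℝ) • solOp r₀ 0 3 h + lap (solOp r₀ 0 3 h)) := rfl
  rw [h1, map_neg, map_add, map_smul, harm_lap, harm_solOp, ← (solCoeff_limit hr₀ l).2]
  module

theorem isLinearisedLimitMetric {r₀ : ℝ} (hr₀ : 0 < r₀) (h : SmoothFun) :
    IsLinearisedLimitMetric r₀ h (limitMetric r₀ h) := by
  refine ⟨⟨_, isLinearisedPerturbation_solFamily hr₀ h⟩, fun F hF =>
    ⟨fun u p y => (2 * sol r₀ h u (pt p y)) • roundMetric p y, fun u hu p y i j =>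
      hF.hasDerivAt_renormMetric hr₀ hu p y i j, fun p y i j => ?_⟩⟩
  exact ((tendsto_sol h (pt p y)).const_mul 2).mul_const (roundMetric p y i j)

theorem isLinearisedLimitCurvature {r₀ : ℝ} (hr₀ : 0 < r₀) (h : SmoothFun) :
    IsLinearisedLimitCurvature r₀ h (limitCurvature r₀ h) :=
  ⟨⟨_, isLinearisedPerturbation_solFamily hr₀ h⟩, fun _ hF =>
    ⟨fun u p => -(2 * sol r₀ h u p + lap (sol r₀ h u) p), fun _ hu p =>
      hF.hasDerivAt_renormCurvature hr₀ hu p, fun p =>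
      (((tendsto_sol h p).const_mul 2).add (tendsto_lap_sol h p)).neg⟩⟩

/-- One linearised perturbation exists, and along it derivatives and limits are unique. -/
theorem IsLinearisedLimitCurvature.unique {r₀ : ℝ} {h κ κ' : Sph → ℝ}
    (H : IsLinearisedLimitCurvature r₀ h κ) (H' : IsLinearisedLimitCurvature r₀ h κ') : κ = κ' := by
  obtain ⟨⟨F, hF⟩, H1⟩ := H
  obtain ⟨k, hk, hk'⟩ := H1 F hF
  obtain ⟨k', hk1, hk1'⟩ := H'.2 F hF
  funext p
  refine tendsto_nhds_unique (hk' p) ((hk1' p).congr' ?_)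
  filter_upwards [Filter.eventually_ge_atTop 0] with u hu
  exact (hk1 u hu p).unique (hk u hu p)

theorem hasDerivAt_gaussCurvature_limitMetric (r₀ : ℝ) (h : SmoothFun) (p : Sph) : HasDerivAt
    (fun t : ℝ => gaussCurvature (fun y => roundMetric p y + t • limitMetric r₀ h p y) (centre p))
    (limitCurvature r₀ h p) 0 := by
  have hD : ContDiff ℝ ∞ fun y => limitFactor r₀ h (pt p y) :=
    contDiff_comp_pt (limitFactor r₀ h).contMDiff p
  have hG : ∀ i j, HasJet (fun t y => (roundMetric p y + t • limitMetric r₀ h p y) i j)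
      (fun y => if i = j then 1 * psi y else 0)
      (fun y => if i = j then 1 * psi y * limitFactor r₀ h (pt p y) else 0) := by
    intro i j
    have h1 : ∀ t y, (roundMetric p y + t • limitMetric r₀ h p y) i j =
        if i = j then psi y + t * (psi y * limitFactor r₀ h (pt p y)) else 0 := by
      intro t y
      change roundMetric p y i j + t * (limitFactor r₀ h (pt p y) * roundMetric p y i j) = _
      rw [roundMetric_eq, Matrix.smul_apply, Matrix.one_apply]
      split_ifs
      · simp only [smul_eq_mul, mul_one]
        ring
      · simp
    simp only [h1, one_mul]
    split_ifs
    · refine ⟨fun y => ?_, fun y => by simp, fun y => ?_⟩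
      · exact ((contDiff_psi.comp contDiff_snd).add (contDiff_fst.mul
          ((contDiff_psi.mul hD).comp contDiff_snd))).contDiffAt
      · have := ((hasDerivAt_id' (0 : ℝ)).mul_const (psi y * limitFactor r₀ h (pt p y))).const_add
          (psi y)
        rwa [one_mul] at this
    · exact HasJet.const 0
  rw [centre_eq]
  refine (hasDerivAt_gaussCurvature one_pos hD hG).2.congr_deriv ?_
  rw [← lap_eq_chart, limitCurvature_apply, pt_zero, limitFactor_apply]
  have : lap (limitFactor r₀ h) p = 2 * lap (solOp r₀ 0 3 h) p := by
    have : limitFactor r₀ h = (2 : ℝ) • solOp r₀ 0 3 h := rfl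
    rw [this, map_smul]
    rfl
  rw [this]
  ring

theorem limit_explicit {r₀ : ℝ} (hr₀ : r₀ ≠ 0) {l : ℕ} {Y : SmoothFun} (hY : Y ∈ Harm l) :
    limitFactor r₀ (r₀ • Y) = conformalCoeff l • Y ∧
    limitCurvature r₀ (r₀ • Y) = curvatureCoeff l • Y := by
  have h1 : solOp r₀ 0 3 (r₀ • Y) = (r₀ * solCoeff r₀ 0 3 l) • Y := by
    rw [map_smul, solOp_of_mem _ _ _ hY, smul_smul]
  constructor
  · have h2 : limitFactor r₀ (r₀ • Y) = (2 : ℝ) • solOp r₀ 0 3 (r₀ • Y) := rfl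
    rw [h2, h1, smul_smul, ← (solCoeff_limit hr₀ l).1]
    congr 1
    ring
  · refine ext_harm fun m => ?_
    rw [harm_limitCurvature hr₀, map_smul, map_smul, smul_smul]
    rcases eq_or_ne m l with rfl | h
    · congr 1
      field_simp
    · rw [harm_of_mem_ne h hY, smul_zero, smul_zero]

theorem staysAsymptoticallyRound_iff {r₀ : ℝ} (hr₀ : 0 < r₀) (h : SmoothFun) :
    StaysAsymptoticallyRound r₀ h ↔ limitCurvature r₀ h = 0 := by
  constructor
  · intro H
    ext p
    exact congrFun ((isLinearisedLimitCurvature hr₀ h).unique H) p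
  · intro H
    have := isLinearisedLimitCurvature hr₀ h
    rw [H] at this
    exact this

/-- The multiplier vanishes exactly for l < 2, so the vanishing of the curvature variation forces
all components of degree at least 2 to vanish. -/
theorem limitCurvature_eq_zero_iff {r₀ : ℝ} (hr₀ : r₀ ≠ 0) (h : SmoothFun) :
    limitCurvature r₀ h = 0 ↔ toL2 h ∈ V := by
  rw [mem_V_iff]
  constructor
  · intro H l hl
    have h1 := harm_limitCurvature hr₀ h l
    rw [H, map_zero, eq_comm, smul_eq_zero] at h1
    rw [← toL2_harm, h1.resolve_left (div_ne_zero (curvatureCoeff_ne_zero hl) hr₀), ← toL2L_apply,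
      map_zero]
  · intro H
    refine ext_harm fun l => ?_
    rw [harm_limitCurvature hr₀, map_zero]
    rcases lt_or_ge l 2 with hl | hl
    · rw [curvatureCoeff_of_lt hl, zero_div, zero_smul]
    · have : harm l h = 0 := toL2_injective (by rw [toL2_harm, H l hl, ← toL2L_apply, map_zero])
      rw [this, smul_zero]

/-- The spanning set consists of classes of smooth functions, so elements of `V`, a priori L²
classes, can serve as data for the perturbation problem. -/
theorem exists_toL2_eq_of_mem_V {v : L2} (hv : v ∈ V) : ∃ h : SmoothFun, toL2 h = v := by
  have : V ≤ LinearMap.range toL2L := by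
    refine Submodule.span_le.2 ?_
    rintro _ ⟨l, -, Y, -, rfl⟩
    exact ⟨Y, rfl⟩
  exact this hv

end Schwarzschild

end

/-! ### Assembly of the theorem. -/

open Schwarzschild in
theorem theorem11p1 (r₀ : ℝ) (hr₀ : 0 < r₀) :
    IsConstMassAspectFoliation r₀ sphericalFoliation ∧
    ∃ (δg : SmoothFun →ₗ[ℝ] TensorField) (δk : SmoothFun →ₗ[ℝ] SmoothFun),
      -- `δg` and `δk` are the linearisations of the limit metric and the limit Gauss curvature
      (∀ h : SmoothFun, IsLinearisedLimitMetric r₀ h (δg h)) ∧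
      (∀ h : SmoothFun, IsLinearisedLimitCurvature r₀ h (δk h)) ∧
      -- `δg` is a conformal deformation of the round metric
      (∃ w : SmoothFun →ₗ[ℝ] SmoothFun, ∀ (h : SmoothFun) (p : Sph) (y : Fin 2 → ℝ),
        δg h p y = w h (pt p y) • roundMetric p y) ∧
      -- `δk` is the linearised Gauss curvature relative to `δg`
      (∀ (h : SmoothFun) (p : Sph), HasDerivAt
        (fun t : ℝ => gaussCurvature (fun y => roundMetric p y + t • δg h p y) (centre p))
        (δk h p) 0) ∧
      -- explicit formulae
      (∀ (l : ℕ) (Y : SmoothFun), IsSphericalHarmonic l Y →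
        (∀ (p : Sph) (y : Fin 2 → ℝ),
          δg (r₀ • Y) p y = (conformalCoeff l * Y (pt p y)) • roundMetric p y) ∧
        δk (r₀ • Y) = curvatureCoeff l • Y) ∧
      -- `δk` as a bounded self-adjoint map from `H²` to `L²`
      (∃ T : H2 →L[ℝ] L2,
        (∀ h : SmoothFun, ∃ f : H2, incl f = toL2 h ∧ T f = toL2 (δk h)) ∧
        Function.Injective incl ∧
        IsSelfAdjoint (toOperator T) ∧
        Submodule.map incl (LinearMap.ker (T : H2 →ₗ[ℝ] L2)) = V ∧
        LinearMap.range (T : H2 →ₗ[ℝ] L2) = Vᗮ ∧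
        Set.BijOn T {f : H2 | incl f ∈ Vᗮ} (Vᗮ : Submodule ℝ L2) ∧
        IsSelfAdjoint (toOperatorOn T Vᗮ)) ∧
      -- `V` consists of the perturbations that keep the foliation asymptotically round
      Module.finrank ℝ V = 4 ∧
      ∀ v : L2, v ∈ V ↔ ∃ h : SmoothFun, toL2 h = v ∧ StaysAsymptoticallyRound r₀ h := by
  refine ⟨isConstMassAspectFoliation_sphericalFoliation hr₀, limitMetric r₀, limitCurvature r₀,
    isLinearisedLimitMetric hr₀, isLinearisedLimitCurvature hr₀, ⟨limitFactor r₀, fun _ _ _ => rfl⟩,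
    hasDerivAt_gaussCurvature_limitMetric r₀, fun l Y hY => ?_,
    exists_curvature_operator hr₀ (harm_limitCurvature hr₀.ne'), finrank_V, fun v => ?_⟩
  · obtain ⟨h1, h2⟩ := limit_explicit hr₀.ne' (l := l) (Y := Y) hY
    refine ⟨fun p y => ?_, h2⟩
    change limitFactor r₀ (r₀ • Y) (pt p y) • roundMetric p y = _
    rw [h1]
    rfl
  · constructor
    · intro hv
      obtain ⟨h, rfl⟩ := exists_toL2_eq_of_mem_V hv
      exact ⟨h, rfl, (staysAsymptoticallyRound_iff hr₀ h).2
        ((limitCurvature_eq_zero_iff hr₀.ne' h).2 hv)⟩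
    · rintro ⟨h, rfl, hh⟩
      exact (limitCurvature_eq_zero_iff hr₀.ne' h).1 ((staysAsymptoticallyRound_iff hr₀ h).1 hh)
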